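/- **Conventions.** A *regular germ* is a germ, at a point of the Riemann sphere $\mathbb S^2=\mathbb C\cup\{\infty\}$, of a holomorphic $\mathbb C$-valued function (holomorphy at $\infty$ is tested in the coordinate $1/z$; poles are not regular). Two regular germs are equivalent if one is obtained from the other by analytic continuation along some path in $\mathbb S^2$; a *multivalued function* $f$ is an equivalence class of regular germs, and it is *generated* by each of its germs. A point $b\in\mathbb S^2$ is *singular* for a germ $f_a$ if there is a path $\gamma:[0,1]\to\mathbb S^2$ from $a$ to $b$ along which $f_a$ has no analytic continuation, although it has one along $\gamma|_{[0,\tau]}$ for every $0\le\tau<1$. An *$\mathcal S$-function* is a multivalued function each of whose germs has an at most countable set of singular points. If $\Sigma$ is the set of singular points of $f$ and $x_0\notin\Sigma$, the *monodromy group* of $f$ is the group of those permutations of the set of germs of $f$ at $x_0$ that are induced by analytic continuation along loops in $\mathbb S^2\setminus\Sigma$ based at $x_0$; up to isomorphism it does not depend on $x_0$. The function $f$ is *single-valued* if it has at most one germ at each point. Operations on multivalued functions are performed on germs: a multivalued function is said to be obtained from $f_1,\dots,f_n$ by an operation if it is generated by some germ obtained by that operation from some germs of $f_1,\dots,f_n$.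 The operations considered are: composition $g\circ f$; the meromorphic operations $F(f_1,\dots,f_n)$, where $n$ is arbitrary and $F$ is a meromorphic function on $\mathbb C^n$; differentiation $f\mapsto f'$; and integration $f\mapsto y$ with $y'=f$. A class of multivalued functions is *stable* under an operation if it contains all functions obtained by the operation from functions of the class. A multivalued function is *strongly non-representable by quadratures* if it does not belong to the smallest class of multivalued functions that contains the basic elementary functions (complex constants, the independent variable $x$, $\exp$, $\ln$, $x^\alpha$ with $\alpha\in\mathbb C$, $\sin,\cos,\tan,\cot,\arcsin,\arccos,\arctan,\operatorname{arccot}$) and all single-valued $\mathcal S$-functions, and that is stable under composition, meromorphic operations, differentiation and integration. **Theorem.** (1) The class of all $\mathcal S$-functions having a solvable monodromy group is stable under composition, meromorphic operations, integration and differentiation. (2) If the monodromy group of an $\mathcal S$-function $f$ is not solvable, then $f$ is strongly non-representable by quadratures. -/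

import Mathlib

open Filter Topology

noncomputable section

/-! ### Holomorphic functions and germs on the Riemann sphere -/

/-- The Riemann sphere. -/
abbrev Sphere : Type := OnePoint ℂ

/-- The local coordinate `w = 1 / z` at `∞`: it sends `0` to `∞` and `w ≠ 0` to `1 / w`. -/
def invChart (w : ℂ) : Sphere :=
  if w = 0 then OnePoint.infty else ((w⁻¹ : ℂ) : Sphere)

/-- The (everywhere defined) function `h` is holomorphic near the point `x` of the sphere.
At `∞` this is tested in the coordinate `1 / z`. -/
def HolomorphicAt (h : Sphere → ℂ) (x : Sphere) : Prop :=
  x.elim (AnalyticAt ℂ (fun w : ℂ => h (invChart w)) 0)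
    (fun z => AnalyticAt ℂ (fun w : ℂ => h (w : Sphere)) z)

/-- A regular germ: a point of the Riemann sphere together with the germ at that point of a
holomorphic complex-valued function (so a pole is not a regular point). -/
structure RegularGerm where
  /-- the point at which the germ lives -/
  pt : Sphere
  /-- the germ -/
  germ : Germ (𝓝 pt) ℂ
  /-- the germ is holomorphic -/
  regular : ∃ h : Sphere → ℂ, germ = (h : Germ (𝓝 pt) ℂ) ∧ HolomorphicAt h pt

/-- `p` is the germ of the function `h` at the point `p.pt`. -/
def RegularGerm.IsGermOf (p : RegularGerm) (h : Sphere → ℂ) : Prop :=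
  p.germ = (h : Germ (𝓝 p.pt) ℂ)

/-- The topology of the espace étalé of the sheaf of holomorphic functions on the sphere: the
germs, at the points of an open set `U`, of a holomorphic function on `U` form an open set. -/
instance : TopologicalSpace RegularGerm :=
  TopologicalSpace.generateFrom
    {s | ∃ (U : Set Sphere) (h : Sphere → ℂ), IsOpen U ∧ (∀ x ∈ U, HolomorphicAt h x) ∧
      s = {p : RegularGerm | p.pt ∈ U ∧ p.IsGermOf h}}

/-! ### Analytic continuation, multivalued functions -/

/-- The germ `q` is obtained from the germ `p` by analytic continuation along the path `γ`. -/
def ContinuesTo {a b : Sphere} (γ : Path a b) (p q : RegularGerm) : Prop :=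
  ∃ Γ : Path p q, ∀ t, (Γ t).pt = γ t

theorem ContinuesTo.refl {a : Sphere} {p : RegularGerm} (h : p.pt = a) :
    ContinuesTo (Path.refl a) p p :=
  ⟨Path.refl p, fun _ => h⟩

theorem ContinuesTo.symm {a b : Sphere} {γ : Path a b} {p q : RegularGerm}
    (h : ContinuesTo γ p q) : ContinuesTo γ.symm q p := by
  obtain ⟨Γ, hΓ⟩ := h
  exact ⟨Γ.symm, fun _ => hΓ _⟩

theorem ContinuesTo.trans {a b c : Sphere} {γ : Path a b} {δ : Path b c} {p q r : RegularGerm}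
    (h : ContinuesTo γ p q) (h₁ : ContinuesTo δ q r) : ContinuesTo (γ.trans δ) p r := by
  obtain ⟨Γ, hΓ⟩ := h
  obtain ⟨Δ, hΔ⟩ := h₁
  refine ⟨Γ.trans Δ, fun t => ?_⟩
  rw [Path.trans_apply, Path.trans_apply]
  split_ifs
  · exact hΓ _
  · exact hΔ _

/-- The germ `p` has an analytic continuation along the truncated path `γ : [0, τ] → S²`. -/
def ContinuesUpTo {a b : Sphere} (γ : Path a b) (p : RegularGerm) (τ : unitInterval) : Prop :=
  ∃ Γ : unitInterval → RegularGerm, ContinuousOn Γ (Set.Icc 0 τ) ∧ Γ 0 = p ∧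
    ∀ t ∈ Set.Icc 0 τ, (Γ t).pt = γ t

/-- `b` is a singular point for the germ `p`. -/
def IsSingularPoint (p : RegularGerm) (b : Sphere) : Prop :=
  ∃ γ : Path p.pt b, ¬ ContinuesUpTo γ p 1 ∧ ∀ τ : unitInterval, τ < 1 → ContinuesUpTo γ p τ

/-- A multivalued analytic function: an equivalence class of regular germs, where two germs are
equivalent if one is an analytic continuation of the other along some path, i.e. if they are
joined by a path in the space of germs. -/
abbrev MultivaluedFunction : Type := ZerothHomotopy RegularGerm

namespace MultivaluedFunction

/-- The multivalued function generated by a germ. -/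
def generatedBy (p : RegularGerm) : MultivaluedFunction := ZerothHomotopy.mk p

/-- `p` is one of the regular germs of `f`. -/
def HasGerm (f : MultivaluedFunction) (p : RegularGerm) : Prop := generatedBy p = f

/-- The set of singular points of a multivalued function. -/
def singularSet (f : MultivaluedFunction) : Set Sphere :=
  {b | ∃ p, f.HasGerm p ∧ IsSingularPoint p b}

/-- `𝒮`-functions: each regular germ has an at most countable set of singular points. -/
def IsSFunction (f : MultivaluedFunction) : Prop :=
  ∀ p, f.HasGerm p → {b | IsSingularPoint p b}.Countable

/-- Single-valued functions: at most one germ at each point. -/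
def IsSingleValued (f : MultivaluedFunction) : Prop :=
  ∀ p q, f.HasGerm p → f.HasGerm q → p.pt = q.pt → p = q

/-! ### The monodromy group -/

/-- The set of all germs of `f` at the point `x₀`. -/
abbrev Fiber (f : MultivaluedFunction) (x₀ : Sphere) : Type :=
  {p : RegularGerm // f.HasGerm p ∧ p.pt = x₀}

/-- The permutation `σ` of the germs of `f` at `x₀` is the one induced by analytic continuation
along the loop `γ`. -/
def IsInducedBy (f : MultivaluedFunction) {x₀ : Sphere} (γ : Path x₀ x₀)
    (σ : Equiv.Perm (f.Fiber x₀)) : Prop :=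
  ∀ y, ContinuesTo γ y.1 (σ y).1

/-- The monodromy group of `f` with base point `x₀`: all permutations of the set of germs of `f`
at `x₀` that are induced by loops based at `x₀` in the complement of the singular set. -/
def monodromyGroup (f : MultivaluedFunction) (x₀ : Sphere) (hx₀ : x₀ ∉ f.singularSet) :
    Subgroup (Equiv.Perm (f.Fiber x₀)) where
  carrier := {σ | ∃ γ : Path x₀ x₀, (∀ t, γ t ∉ f.singularSet) ∧ f.IsInducedBy γ σ}
  one_mem' := ⟨Path.refl x₀, fun _ => hx₀, fun y => ContinuesTo.refl y.2.2⟩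
  mul_mem' := by
    rintro σ τ ⟨γ, hγ, hσ⟩ ⟨δ, hδ, hτ⟩
    refine ⟨δ.trans γ, fun t => ?_, fun y => (hτ y).trans (hσ (τ y))⟩
    rw [Path.trans_apply]
    split_ifs
    · exact hδ _
    · exact hγ _
  inv_mem' := by
    rintro σ ⟨γ, hγ, hσ⟩
    refine ⟨γ.symm, fun t => hγ _, fun y => ?_⟩
    have h := hσ (σ⁻¹ y)
    rw [show σ (σ⁻¹ y) = y from σ.apply_symm_apply y] at h
    exact h.symm

/-- The monodromy group is solvable (for all choices of the base point outside the singular set;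
different choices give isomorphic groups). -/
def HasSolvableMonodromyGroup (f : MultivaluedFunction) : Prop :=
  ∀ (x₀ : Sphere) (hx₀ : x₀ ∉ f.singularSet), Group.IsSolvable (f.monodromyGroup x₀ hx₀)

end MultivaluedFunction

open MultivaluedFunction

/-! ### Operations on germs and on multivalued functions -/

/-- The derivative with respect to the independent variable `z`.  If `h` is holomorphic at `∞`
then `h'(z)` tends to `0` as `z → ∞`, which is the value of the derivative at `∞`. -/
def sphereDeriv (h : Sphere → ℂ) (x : Sphere) : ℂ :=
  x.elim 0 (fun z => deriv (fun w : ℂ => h (w : Sphere)) z)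

/-- The germ `q` is the derivative of the germ `p`. -/
def IsGermDerivative (q p : RegularGerm) : Prop :=
  q.pt = p.pt ∧ ∃ h : Sphere → ℂ, p.IsGermOf h ∧ q.IsGermOf (sphereDeriv h)

/-- The germ `r` is the composition `q ∘ p`, where `q` is a germ at the value of `p`. -/
def IsGermComposition (r q p : RegularGerm) : Prop :=
  r.pt = p.pt ∧ ∃ h k : Sphere → ℂ, p.IsGermOf h ∧ q.pt = ((h p.pt : ℂ) : Sphere) ∧
    q.IsGermOf k ∧ r.IsGermOf (fun x => k ((h x : ℂ) : Sphere))

/-- Near `v` the meromorphic function `F` of `n` variables is the quotient `P / Q` of holomorphic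
functions.  (No condition is put on the values of `F` at the zeros of `Q`.) -/
def IsLocalQuotient {n : ℕ} (F P Q : (Fin n → ℂ) → ℂ) (v : Fin n → ℂ) : Prop :=
  AnalyticAt ℂ P v ∧ AnalyticAt ℂ Q v ∧ (¬ ∀ᶠ y in 𝓝 v, Q y = 0) ∧
    ∀ᶠ y in 𝓝 v, Q y ≠ 0 → F y = P y / Q y

/-- `F` is (the totalization of) a meromorphic function of `n` complex variables: everywhere
locally a quotient of holomorphic functions with a denominator that is not identically zero. -/
def IsMeromorphicFunction {n : ℕ} (F : (Fin n → ℂ) → ℂ) : Prop :=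
  ∀ v, ∃ P Q, IsLocalQuotient F P Q v

/-- The regular germ `q` is `F(p₁, …, pₙ)`: if `F = P / Q` near the point `(p₁, …, pₙ)(a)`, with
`Q(p₁, …, pₙ)` not identically zero near `a`, then `q` is the quotient of `P(p₁, …, pₙ)` by
`Q(p₁, …, pₙ)`. -/
def IsGermMeromorphicOp {n : ℕ} (F : (Fin n → ℂ) → ℂ) (q : RegularGerm)
    (p : Fin n → RegularGerm) : Prop :=
  ∃ (h : Fin n → Sphere → ℂ) (k : Sphere → ℂ) (P Q : (Fin n → ℂ) → ℂ),
    (∀ i, (p i).pt = q.pt ∧ (p i).IsGermOf (h i)) ∧ q.IsGermOf k ∧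
    IsLocalQuotient F P Q (fun i => h i q.pt) ∧
    (¬ ∀ᶠ x in 𝓝 q.pt, Q (fun i => h i x) = 0) ∧
    ∀ᶠ x in 𝓝 q.pt, k x * Q (fun i => h i x) = P (fun i => h i x)

/-- `φ` is representable as the derivative of `f`. -/
def IsDerivativeOf (φ f : MultivaluedFunction) : Prop :=
  ∃ q p, φ.HasGerm q ∧ f.HasGerm p ∧ IsGermDerivative q p

/-- `φ` is representable as an integral of `f`, i.e. it solves `φ' = f`. -/
def IsIntegralOf (φ f : MultivaluedFunction) : Prop :=
  IsDerivativeOf f φ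

/-- `φ` is representable as the composition `g ∘ f`. -/
def IsCompositionOf (φ g f : MultivaluedFunction) : Prop :=
  ∃ r q p, φ.HasGerm r ∧ g.HasGerm q ∧ f.HasGerm p ∧ IsGermComposition r q p

/-- `φ` is representable as `F(f₁, …, fₙ)`. -/
def IsMeromorphicOpOf {n : ℕ} (F : (Fin n → ℂ) → ℂ) (φ : MultivaluedFunction)
    (f : Fin n → MultivaluedFunction) : Prop :=
  ∃ (q : RegularGerm) (p : Fin n → RegularGerm),
    φ.HasGerm q ∧ (∀ i, (f i).HasGerm (p i)) ∧ IsGermMeromorphicOp F q p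

/-- The class `C` is stable under composition. -/
def StableUnderComposition (C : Set MultivaluedFunction) : Prop :=
  ∀ g ∈ C, ∀ f ∈ C, ∀ φ, IsCompositionOf φ g f → φ ∈ C

/-- The class `C` is stable under all meromorphic operations, in any number of variables. -/
def StableUnderMeromorphicOperations (C : Set MultivaluedFunction) : Prop :=
  ∀ (n : ℕ) (F : (Fin n → ℂ) → ℂ), IsMeromorphicFunction F →
    ∀ f : Fin n → MultivaluedFunction, (∀ i, f i ∈ C) →
      ∀ φ, IsMeromorphicOpOf F φ f → φ ∈ C

/-- The class `C` is stable under integration. -/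
def StableUnderIntegration (C : Set MultivaluedFunction) : Prop :=
  ∀ f ∈ C, ∀ φ, IsIntegralOf φ f → φ ∈ C

/-- The class `C` is stable under differentiation. -/
def StableUnderDifferentiation (C : Set MultivaluedFunction) : Prop :=
  ∀ f ∈ C, ∀ φ, IsDerivativeOf φ f → φ ∈ C

/-- The class of all `𝒮`-functions with a solvable monodromy group. -/
def SolvableSFunctions : Set MultivaluedFunction :=
  {f | f.IsSFunction ∧ f.HasSolvableMonodromyGroup}

/-! ### Basic elementary functions and representability by quadratures -/

/-- `f` is the multivalued function generated by a holomorphic germ, at a finite point, of the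
function `h` of a complex variable. -/
def IsGeneratedByFunction (h : ℂ → ℂ) (f : MultivaluedFunction) : Prop :=
  ∃ (p : RegularGerm) (z : ℂ), f.HasGerm p ∧ p.pt = (z : Sphere) ∧
    p.IsGermOf (fun x => x.elim 0 h)

/-- `f` is a multivalued inverse of the function `T`: it is generated by a germ `k`, at a finite
point, with `T (k (w)) = w`. -/
def IsInverseFunctionOf (T : ℂ → ℂ) (f : MultivaluedFunction) : Prop :=
  ∃ (p : RegularGerm) (z : ℂ) (k : Sphere → ℂ), f.HasGerm p ∧ p.pt = (z : Sphere) ∧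
    p.IsGermOf k ∧ ∀ᶠ w : ℂ in 𝓝 z, T (k (w : Sphere)) = w

/-- The list of basic elementary functions. -/
inductive IsBasicElementary : MultivaluedFunction → Prop
  | const (c : ℂ) (f) : IsGeneratedByFunction (fun _ => c) f → IsBasicElementary f
  | var (f) : IsGeneratedByFunction (fun z => z) f → IsBasicElementary f
  | exp (f) : IsGeneratedByFunction Complex.exp f → IsBasicElementary f
  | log (f) : IsGeneratedByFunction Complex.log f → IsBasicElementary f
  | pow (α : ℂ) (f) : IsGeneratedByFunction (fun z => z ^ α) f → IsBasicElementary f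
  | sin (f) : IsGeneratedByFunction Complex.sin f → IsBasicElementary f
  | cos (f) : IsGeneratedByFunction Complex.cos f → IsBasicElementary f
  | tan (f) : IsGeneratedByFunction Complex.tan f → IsBasicElementary f
  | cot (f) : IsGeneratedByFunction Complex.cot f → IsBasicElementary f
  | arcsin (f) : IsInverseFunctionOf Complex.sin f → IsBasicElementary f
  | arccos (f) : IsInverseFunctionOf Complex.cos f → IsBasicElementary f
  | arctan (f) : IsInverseFunctionOf Complex.tan f → IsBasicElementary f
  | arccot (f) : IsInverseFunctionOf Complex.cot f → IsBasicElementary f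

/-- The class of functions with basic functions: the basic elementary functions and all
single-valued `𝒮`-functions; and admissible operations: compositions, meromorphic operations,
differentiation and integration. -/
inductive InExtendedQuadratureClass : MultivaluedFunction → Prop
  | elementary (f) : IsBasicElementary f → InExtendedQuadratureClass f
  | singleValued (f) : f.IsSFunction → f.IsSingleValued → InExtendedQuadratureClass f
  | composition (φ g f) : InExtendedQuadratureClass g → InExtendedQuadratureClass f →
      IsCompositionOf φ g f → InExtendedQuadratureClass φ
  | meromorphic {n : ℕ} (F : (Fin n → ℂ) → ℂ) (φ) (f : Fin n → MultivaluedFunction) :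
      IsMeromorphicFunction F → (∀ i, InExtendedQuadratureClass (f i)) →
      IsMeromorphicOpOf F φ f → InExtendedQuadratureClass φ
  | differentiation (φ f) : InExtendedQuadratureClass f → IsDerivativeOf φ f →
      InExtendedQuadratureClass φ
  | integration (φ f) : InExtendedQuadratureClass f → IsIntegralOf φ f →
      InExtendedQuadratureClass φ

/-- `f` is strongly non-representable by quadratures. -/
def StronglyNonRepresentableByQuadratures (f : MultivaluedFunction) : Prop :=
  ¬ InExtendedQuadratureClass f

end

noncomputable section

open MultivaluedFunction RegularGerm
open scoped commutatorElement

/-! Part (2) follows from part (1): the basic functions have solvable monodromy, and an induction on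
`InExtendedQuadratureClass` then places the whole class inside `SolvableSFunctions`. The work is in
part (1).

The singular set of the result of an operation is hard to determine, so it is replaced by any
countable set `A` off which continuation is possible. Two facts make this harmless. Singular points
automatically lie in `A` (`IsSingularPoint.mem_of_continuableOff`). And in any space locally
homeomorphic to the sphere, paths can be pushed off the preimage of `A`
(`IsLocalHomeomorph.joinedIn_notMem`), because the plane minus a countable set is path connected.
Applied to the space of finite tuples of germs over a common point, the second fact replaces a loop
by one off `A` with the same action on finitely many germs. No homotopy of loops is involved, and
`A` need not be closed.

Solvability is therefore expressed through loops: for some `n`, the products of `n`-fold iterated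
commutators of loops off `A` (`DerivedLoop`) fix the germs. `exists_derivedLoop_trivial` extracts
such an `n` from a solvable monodromy group, and `mem_solvableSFunctions_of_derivedLoop` goes back.

An operation acting continuously on tuples of germs needs only the largest depth of its arguments
(`generatedBy_mem_of_continuousAt`); this covers differentiation and meromorphic operations.
Integration costs one more commutator, since a loop fixing the integrand adds a constant to the
integral and constants commute. In a composition the depths add: commutators of the depth of the
inner function lift to closed paths of its germs, whose values are loops for the outer function.

New exceptional points arise from isolated bad germs. The Poincaré–Volterra theorem
(`IsLocalHomeomorph.secondCountableTopology`) shows that there are countably many. For a meromorphic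
operation, a local quotient `P / Q` may be unreduced, with `Q` vanishing identically along the curve
of arguments. The value of `F` is therefore defined intrinsically, as a limit along generic lines;
`hasGenericLimit_dichotomy` shows that along a holomorphic curve this value is meromorphic or
nowhere defined near a point, apart from the point itself. -/

theorem isLocalHomeomorph_of_injOn_of_nhds_le {X Y : Type*} [TopologicalSpace X]
    [TopologicalSpace Y] {f : X → Y} (hf : Continuous f) (hinj : ∀ x, ∃ N ∈ 𝓝 x, Set.InjOn f N)
    (hop : ∀ x, ∀ V ∈ 𝓝 x, ∀ᶠ y in 𝓝 (f x), ∃ z ∈ V, f z = y) : IsLocalHomeomorph f := by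
  have hopen : IsOpenMap f := IsOpenMap.of_nhds_le fun x V hV => by
    filter_upwards [hop x _ hV] with y ⟨z, hz, hzy⟩ using hzy ▸ hz
  refine isLocalHomeomorph_iff_isOpenEmbedding_restrict.2 fun x => ?_
  obtain ⟨N, hN, hi⟩ := hinj x
  obtain ⟨U, hUN, hU, hxU⟩ := mem_nhds_iff.1 hN
  exact ⟨U, hU.mem_nhds hxU, .of_continuous_injective_isOpenMap hf.continuousOn.domRestrict
    (Set.injOn_iff_injective.1 (hi.mono hUN)) (hopen.domRestrict hU)⟩

/-! ### Charts of the sphere -/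

theorem invChart_zero : invChart 0 = OnePoint.infty := if_pos rfl

theorem invChart_of_ne {w : ℂ} (hw : w ≠ 0) : invChart w = ((w⁻¹ : ℂ) : Sphere) := if_neg hw

theorem invChart_eventuallyEq {w : ℂ} (hw : w ≠ 0) :
    invChart =ᶠ[𝓝 w] fun w => ((w⁻¹ : ℂ) : Sphere) := by
  filter_upwards [isOpen_ne.mem_nhds hw] with v hv using invChart_of_ne hv

/-- Inversion exchanges the punctured neighbourhoods of 0 with the cobounded filter, which is the
trace of `𝓝 ∞` on the plane. The equality of filters gives continuity and openness of the chart
together. -/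
theorem map_invChart_nhds (w : ℂ) : map invChart (𝓝 w) = 𝓝 (invChart w) := by
  by_cases hw : w = 0
  · subst hw
    rw [invChart_zero, OnePoint.nhds_infty_eq, ← nhdsNE_sup_pure, map_sup, map_pure, invChart_zero]
    congr 1
    have : map invChart (𝓝[≠] 0) = map (fun w : ℂ => ((w⁻¹ : ℂ) : Sphere)) (𝓝[≠] 0) :=
      map_congr (by filter_upwards [self_mem_nhdsWithin] with v hv using invChart_of_ne hv)
    rw [this, coclosedCompact_eq_cocompact, ← Metric.cobounded_eq_cocompact,
      ← Filter.inv_nhdsNE_zero]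
    rfl
  · rw [map_congr (invChart_eventuallyEq hw), invChart_of_ne hw, OnePoint.nhds_coe_eq,
      nhds_inv₀ hw]
    rfl

theorem invChart_injective : Function.Injective invChart := by
  intro v w h
  by_cases hv : v = 0 <;> by_cases hw : w = 0
  · rw [hv, hw]
  · rw [hv, invChart_zero, invChart_of_ne hw] at h
    exact absurd h.symm (OnePoint.coe_ne_infty _)
  · rw [hw, invChart_zero, invChart_of_ne hv] at h
    exact absurd h (OnePoint.coe_ne_infty _)
  · rw [invChart_of_ne hv, invChart_of_ne hw] at h
    exact inv_injective (OnePoint.coe_injective h)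

theorem isOpenEmbedding_invChart : IsOpenEmbedding invChart :=
  .of_continuous_injective_isOpenMap
    (continuous_iff_continuousAt.2 fun w => (map_invChart_nhds w).le) invChart_injective
    (IsOpenMap.of_nhds_le fun w => (map_invChart_nhds w).ge)

/-- Holomorphic charts of the sphere. -/
structure IsSphereChart (e : ℂ → Sphere) : Prop where
  isOpenEmbedding : IsOpenEmbedding e
  holomorphicAt_iff : ∀ (h : Sphere → ℂ) (w : ℂ),
    HolomorphicAt h (e w) ↔ AnalyticAt ℂ (fun v => h (e v)) w

theorem holomorphicAt_coe {h : Sphere → ℂ} {z : ℂ} :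
    HolomorphicAt h (z : Sphere) ↔ AnalyticAt ℂ (fun w : ℂ => h (w : Sphere)) z := Iff.rfl

theorem isSphereChart_coe : IsSphereChart ((↑) : ℂ → Sphere) :=
  ⟨OnePoint.isOpenEmbedding_coe, fun _ _ => Iff.rfl⟩

theorem isSphereChart_invChart : IsSphereChart invChart := by
  refine ⟨isOpenEmbedding_invChart, fun h w => ?_⟩
  by_cases hw : w = 0
  · subst hw
    rw [invChart_zero]
    rfl
  · have hE : (fun v => h (invChart v)) =ᶠ[𝓝 w] fun v : ℂ => h ((v⁻¹ : ℂ) : Sphere) := by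
      filter_upwards [invChart_eventuallyEq hw] with v hv
      rw [hv]
    rw [analyticAt_congr hE, invChart_of_ne hw, holomorphicAt_coe]
    constructor
    · intro H
      exact H.comp (f := fun v : ℂ => v⁻¹) (analyticAt_inv hw)
    · intro H
      have H' : AnalyticAt ℂ (fun v : ℂ => h ((v⁻¹ : ℂ) : Sphere)) (w⁻¹)⁻¹ := by rwa [inv_inv]
      simpa [Function.comp_def] using
        H'.comp (f := fun v : ℂ => v⁻¹) (analyticAt_inv (inv_ne_zero hw))

theorem exists_isSphereChart (x : Sphere) : ∃ e : ℂ → Sphere, ∃ w, IsSphereChart e ∧ e w = x := by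
  induction x using OnePoint.rec with
  | infty => exact ⟨_, 0, isSphereChart_invChart, invChart_zero⟩
  | coe z => exact ⟨_, z, isSphereChart_coe, rfl⟩

theorem IsSphereChart.eventually_iff {e : ℂ → Sphere} (he : IsSphereChart e) {w : ℂ}
    {P : Sphere → Prop} : (∀ᶠ x in 𝓝 (e w), P x) ↔ ∀ᶠ v in 𝓝 w, P (e v) := by
  rw [← he.isOpenEmbedding.map_nhds_eq, eventually_map]

theorem eventually_nhds_coe {z : ℂ} {P : Sphere → Prop} :
    (∀ᶠ x in 𝓝 (z : Sphere), P x) ↔ ∀ᶠ w : ℂ in 𝓝 z, P w :=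
  isSphereChart_coe.eventually_iff

theorem HolomorphicAt.eventually {h : Sphere → ℂ} {x : Sphere} (hx : HolomorphicAt h x) :
    ∀ᶠ y in 𝓝 x, HolomorphicAt h y := by
  obtain ⟨e, w, he, rfl⟩ := exists_isSphereChart x
  rw [he.eventually_iff]
  filter_upwards [((he.holomorphicAt_iff h w).1 hx).eventually_analyticAt] with v hv
  exact (he.holomorphicAt_iff h v).2 hv

theorem HolomorphicAt.congr {h k : Sphere → ℂ} {x : Sphere} (hx : HolomorphicAt h x)
    (hk : h =ᶠ[𝓝 x] k) : HolomorphicAt k x := by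
  obtain ⟨e, w, he, rfl⟩ := exists_isSphereChart x
  rw [he.holomorphicAt_iff] at hx ⊢
  exact AnalyticAt.congr hx (he.eventually_iff.1 hk)

theorem HolomorphicAt.continuousAt {h : Sphere → ℂ} {x : Sphere} (hx : HolomorphicAt h x) :
    ContinuousAt h x := by
  obtain ⟨e, w, he, rfl⟩ := exists_isSphereChart x
  rw [he.holomorphicAt_iff] at hx
  exact he.isOpenEmbedding.continuousAt_iff.1 hx.continuousAt

theorem holomorphicAt_const (c : ℂ) (x : Sphere) : HolomorphicAt (fun _ => c) x := by
  obtain ⟨e, w, he, rfl⟩ := exists_isSphereChart x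
  exact (he.holomorphicAt_iff _ _).2 analyticAt_const

theorem HolomorphicAt.eventually_eq_or_eventually_ne {h k : Sphere → ℂ} {x : Sphere}
    (hh : HolomorphicAt h x) (hk : HolomorphicAt k x) :
    (∀ᶠ y in 𝓝 x, h y = k y) ∨ ∀ᶠ y in 𝓝[≠] x, h y ≠ k y := by
  obtain ⟨e, w, he, rfl⟩ := exists_isSphereChart x
  rw [he.holomorphicAt_iff] at hh hk
  refine (hh.eventually_eq_or_eventually_ne hk).imp he.eventually_iff.2 fun H => ?_
  rw [eventually_nhdsWithin_iff] at H ⊢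
  rw [he.eventually_iff]
  filter_upwards [H] with v hv hne
  exact hv fun h' => hne (congrArg e h')

/-! ### The space of germs -/

namespace RegularGerm

theorem exists_isGermOf (p : RegularGerm) :
    ∃ h : Sphere → ℂ, p.IsGermOf h ∧ HolomorphicAt h p.pt := p.regular

theorem IsGermOf.congr {p : RegularGerm} {h k : Sphere → ℂ} (hp : p.IsGermOf h)
    (hk : h =ᶠ[𝓝 p.pt] k) : p.IsGermOf k :=
  Eq.trans hp (Germ.coe_eq.2 hk)

theorem IsGermOf.eventuallyEq {p : RegularGerm} {h k : Sphere → ℂ} (hp : p.IsGermOf h)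
    (hk : p.IsGermOf k) : h =ᶠ[𝓝 p.pt] k :=
  Germ.coe_eq.1 (Eq.trans hp.symm hk)

theorem IsGermOf.holomorphicAt {p : RegularGerm} {h : Sphere → ℂ} (hp : p.IsGermOf h) :
    HolomorphicAt h p.pt := by
  obtain ⟨k, hk, hk'⟩ := p.exists_isGermOf
  exact hk'.congr (hk.eventuallyEq hp)

theorem IsGermOf.ext {p q : RegularGerm} {h : Sphere → ℂ} (hp : p.IsGermOf h)
    (hq : q.IsGermOf h) (hpt : p.pt = q.pt) : p = q := by
  obtain ⟨x, g, hg⟩ := p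
  obtain ⟨y, g', hg'⟩ := q
  obtain rfl : x = y := hpt
  obtain rfl : g = g' := Eq.trans hp hq.symm
  rfl

open Classical in
/-- The germ at `x` of `h`; by convention the zero germ if `h` is not holomorphic at `x`. -/
def ofFun (h : Sphere → ℂ) (x : Sphere) : RegularGerm :=
  if H : HolomorphicAt h x then ⟨x, h, h, rfl, H⟩
  else ⟨x, ((fun _ => 0 : Sphere → ℂ) : Germ (𝓝 x) ℂ), _, rfl, holomorphicAt_const 0 x⟩

@[simp] theorem ofFun_pt (h : Sphere → ℂ) (x : Sphere) : (ofFun h x).pt = x := by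
  unfold ofFun
  split_ifs <;> rfl

theorem isGermOf_ofFun {h : Sphere → ℂ} {x : Sphere} (H : HolomorphicAt h x) :
    (ofFun h x).IsGermOf h := by
  unfold ofFun
  rw [dif_pos H]
  rfl

theorem eq_ofFun {p : RegularGerm} {h : Sphere → ℂ} (hp : p.IsGermOf h) : p = ofFun h p.pt :=
  hp.ext (isGermOf_ofFun hp.holomorphicAt) (ofFun_pt _ _).symm

theorem isOpen_sheet {U : Set Sphere} {h : Sphere → ℂ} (hU : IsOpen U)
    (hh : ∀ x ∈ U, HolomorphicAt h x) : IsOpen {p : RegularGerm | p.pt ∈ U ∧ p.IsGermOf h} :=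
  TopologicalSpace.isOpen_generateFrom_of_mem ⟨U, h, hU, hh, rfl⟩

/-- Near `p` the étalé space consists of the germs of one fixed representative. Continuity of a map
into germs thereby reduces to continuity of base points and a locally constant choice of
representative. -/
theorem nhds_eq {p : RegularGerm} {h : Sphere → ℂ} (hp : p.IsGermOf h) :
    𝓝 p = comap pt (𝓝 p.pt) ⊓ 𝓟 {q | q.IsGermOf h} := by
  apply le_antisymm
  · refine le_inf ?_ ?_
    · rw [← tendsto_iff_comap]
      intro V hV
      obtain ⟨U, hUV, hU, hpU⟩ := mem_nhds_iff.1 (inter_mem hV hp.holomorphicAt.eventually)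
      exact mem_map.2 (mem_of_superset
        ((isOpen_sheet hU fun x hx => (hUV hx).2).mem_nhds ⟨hpU, hp⟩) fun q hq => (hUV hq.1).1)
    · rw [le_principal_iff]
      obtain ⟨U, hUV, hU, hpU⟩ := mem_nhds_iff.1 hp.holomorphicAt.eventually
      refine mem_of_superset ((isOpen_sheet hU fun x hx => (hUV hx)).mem_nhds ⟨hpU, hp⟩) ?_
      exact fun q hq => hq.2
  · rw [TopologicalSpace.nhds_generateFrom]
    refine le_iInf₂ ?_
    rintro s ⟨hps, U, k, hU, hk, rfl⟩
    rw [le_principal_iff, mem_inf_principal]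
    have h1 := hp.eventuallyEq hps.2
    have h2 := hU.mem_nhds hps.1
    filter_upwards [preimage_mem_comap (h1.eventually_nhds), preimage_mem_comap h2] with q hq hqU hqh
    exact ⟨hqU, hqh.congr hq⟩

theorem tendsto_iff {α : Type*} {l : Filter α} {Φ : α → RegularGerm} {p : RegularGerm}
    {h : Sphere → ℂ} (hp : p.IsGermOf h) :
    Tendsto Φ l (𝓝 p) ↔
      Tendsto (fun a => (Φ a).pt) l (𝓝 p.pt) ∧ ∀ᶠ a in l, (Φ a).IsGermOf h := by
  rw [nhds_eq hp, tendsto_inf, tendsto_comap_iff, tendsto_principal]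
  rfl

theorem continuous_pt : Continuous pt := by
  refine continuous_iff_continuousAt.2 fun p => ?_
  obtain ⟨h, hp, -⟩ := p.exists_isGermOf
  exact ((tendsto_iff hp).1 tendsto_id).1

theorem IsGermOf.eventually {p : RegularGerm} {h : Sphere → ℂ} (hp : p.IsGermOf h) :
    ∀ᶠ q in 𝓝 p, q.IsGermOf h :=
  ((tendsto_iff hp).1 tendsto_id).2

theorem continuousAt_of_isGermOf {X : Type*} [TopologicalSpace X] {Φ : X → RegularGerm} {x : X}
    {k : Sphere → ℂ} (hpt : ContinuousAt (fun y => (Φ y).pt) x)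
    (hk : ∀ᶠ y in 𝓝 x, (Φ y).IsGermOf k) : ContinuousAt Φ x :=
  (tendsto_iff hk.self_of_nhds).2 ⟨hpt, hk⟩

theorem tendsto_ofFun {p : RegularGerm} {h : Sphere → ℂ} (hp : p.IsGermOf h) :
    Tendsto (ofFun h) (𝓝 p.pt) (𝓝 p) := by
  refine (tendsto_iff hp).2 ⟨by simp only [ofFun_pt]; exact tendsto_id, ?_⟩
  filter_upwards [hp.holomorphicAt.eventually] with x hx using isGermOf_ofFun hx

/-- This is the identity theorem: if two representatives at one point differ on a punctured
neighbourhood, their sheets over it cannot share a germ. Uniqueness of analytic continuation rests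
on it. -/
instance : T2Space RegularGerm := by
  refine ⟨fun p q hpq => ?_⟩
  by_cases hpt : p.pt = q.pt
  · obtain ⟨h, hp, hh⟩ := p.exists_isGermOf
    obtain ⟨k, hq, hk⟩ := q.exists_isGermOf
    rw [← hpt] at hk
    rcases hh.eventually_eq_or_eventually_ne hk with H | H
    · exact absurd ((hp.congr H).ext hq hpt) hpq
    · obtain ⟨V, hVH, hV, hpV⟩ := mem_nhds_iff.1 (eventually_nhdsWithin_iff.1 H)
      have hp' : ∀ᶠ r in 𝓝 p, r.IsGermOf h ∧ r.pt ∈ V :=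
        hp.eventually.and (continuous_pt.continuousAt.eventually (hV.mem_nhds hpV))
      obtain ⟨S, hS, hSo, hpS⟩ := mem_nhds_iff.1 hp'
      obtain ⟨T, hT, hTo, hqT⟩ := mem_nhds_iff.1 hq.eventually
      refine ⟨S, T, hSo, hTo, hpS, hqT, Set.disjoint_left.2 fun r hrS hrT => ?_⟩
      have hrh := (hS hrS).1
      have hrk : r.IsGermOf k := hT hrT
      by_cases hr : r.pt = p.pt
      · have := hrh.eventuallyEq hrk
        rw [hr] at this
        exact hpq ((hp.congr this).ext hq hpt)
      · exact hVH (hS hrS).2 hr (hrh.eventuallyEq hrk).self_of_nhds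
  · obtain ⟨U, V, hU, hV, h1, h2, h3⟩ := t2_separation hpt
    exact ⟨_, _, hU.preimage continuous_pt, hV.preimage continuous_pt, h1, h2, h3.preimage _⟩

theorem isLocalHomeomorph_pt : IsLocalHomeomorph pt := by
  refine isLocalHomeomorph_of_injOn_of_nhds_le continuous_pt (fun p => ?_) fun p V hV => ?_
  · obtain ⟨h, hp, -⟩ := p.exists_isGermOf
    exact ⟨_, hp.eventually, fun q hq r hr hqr => IsGermOf.ext hq hr hqr⟩
  · obtain ⟨h, hp, -⟩ := p.exists_isGermOf
    filter_upwards [(tendsto_ofFun hp).eventually hV] with x hx using ⟨_, hx, ofFun_pt _ _⟩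

/-- The value of a germ at its base point. -/
def val (p : RegularGerm) : ℂ := p.germ.value

theorem IsGermOf.val_eq {p : RegularGerm} {h : Sphere → ℂ} (hp : p.IsGermOf h) :
    p.val = h p.pt := by
  rw [val, show p.germ = (h : Germ (𝓝 p.pt) ℂ) from hp, Germ.value_ofFun]

theorem continuous_val : Continuous val := by
  refine continuous_iff_continuousAt.2 fun p => ?_
  obtain ⟨h, hp, hh⟩ := p.exists_isGermOf
  have : val =ᶠ[𝓝 p] fun q => h q.pt := by
    filter_upwards [hp.eventually] with q hq using IsGermOf.val_eq hq
  exact (hh.continuousAt.comp continuous_pt.continuousAt).congr this.symm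

end RegularGerm

/-! ### Local homeomorphisms to the sphere -/

section LocalHomeomorph

variable {X : Type*} [TopologicalSpace X] {π : X → Sphere}

/-- A small disc in a chart is reparametrized by the entire plane through `univBall`, so that facts
about complements of countable subsets of `ℂ` apply in arbitrarily small neighbourhoods. -/
theorem IsLocalHomeomorph.exists_plane_chart (hπ : IsLocalHomeomorph π) (x : X) {O : Set X}
    (hO : O ∈ 𝓝 x) : ∃ e : ℂ → X, IsOpenEmbedding e ∧ x ∈ Set.range e ∧ Set.range e ⊆ O ∧
      IsOpenEmbedding (π ∘ e) := by
  obtain ⟨e₀, w, he₀, hw⟩ := exists_isSphereChart (π x)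
  set C : OpenPartialHomeomorph ℂ X :=
    (he₀.isOpenEmbedding.toOpenPartialHomeomorph e₀).trans (hπ.localInverseAt (x := x)) with hC
  have hCapp : ∀ v, C v = hπ.localInverseAt (x := x) (e₀ v) := fun v => rfl
  have hCw : C w = x := by rw [hCapp, hw, hπ.localInverseAt_apply_self]
  have hwC : w ∈ C.source := by simp [hC, hw]
  have hS : C.source ∩ C ⁻¹' O ∈ 𝓝 w :=
    inter_mem (C.open_source.mem_nhds hwC) (C.continuousAt hwC (by rwa [hCw]))
  obtain ⟨r, hr, hball⟩ := Metric.mem_nhds_iff.1 hS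
  set B := OpenPartialHomeomorph.univBall w r
  have hB : ∀ v, B v ∈ Metric.ball w r := fun v => by
    rw [← OpenPartialHomeomorph.univBall_target w hr]
    exact B.map_source (by simp [B])
  have hBe : IsOpenEmbedding B := B.isOpenEmbedding (by simp [B])
  have hπC : ∀ v ∈ C.source, π (C v) = e₀ v := fun v hv => by
    rw [hCapp]
    exact hπ.apply_localInverseAt_of_mem (by simpa [hC] using hv)
  refine ⟨C ∘ B, ?_, ⟨0, ?_⟩, ?_, ?_⟩
  · refine (B.trans C).isOpenEmbedding ?_
    rw [OpenPartialHomeomorph.trans_source]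
    refine Set.eq_univ_of_forall fun v => ⟨by simp [B], (hball (hB v)).1⟩
  · simp [B, hCw]
  · rintro _ ⟨v, rfl⟩
    exact (hball (hB v)).2
  · have : π ∘ C ∘ B = e₀ ∘ B := funext fun v => hπC _ (hball (hB v)).1
    rw [this]
    exact he₀.isOpenEmbedding.comp hBe

theorem IsLocalHomeomorph.eventually_joinedIn (hπ : IsLocalHomeomorph π) (x : X) {O : Set X}
    (hO : O ∈ 𝓝 x) : ∀ᶠ y in 𝓝 x, JoinedIn O x y := by
  obtain ⟨e, he, ⟨v, rfl⟩, heO, -⟩ := hπ.exists_plane_chart x hO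
  filter_upwards [he.isOpen_range.mem_nhds ⟨v, rfl⟩]
  rintro _ ⟨w, rfl⟩
  exact ((isPathConnected_range he.continuous).joinedIn _ ⟨v, rfl⟩ _ ⟨w, rfl⟩).mono heO

/-- In a plane chart the preimage of `A` is countable, and its complement is path connected because
the real dimension exceeds one. -/
theorem IsLocalHomeomorph.exists_nhds_joinedIn (hπ : IsLocalHomeomorph π) {A : Set Sphere}
    (hA : A.Countable) (x : X) {O : Set X} (hO : O ∈ 𝓝 x) :
    ∃ W, IsOpen W ∧ x ∈ W ∧ (∀ y ∈ W, π y ∉ A → ∀ z ∈ W, π z ∉ A →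
      JoinedIn (O ∩ {y | π y ∉ A}) y z) := by
  obtain ⟨e, he, hx, heO, hπe⟩ := hπ.exists_plane_chart x hO
  refine ⟨_, he.isOpen_range, hx, ?_⟩
  rintro _ ⟨v, rfl⟩ hv _ ⟨w, rfl⟩ hw
  have hc : ((π ∘ e) ⁻¹' A).Countable := hA.preimage hπe.injective
  have hpc := hc.isPathConnected_compl_of_one_lt_rank (by simp)
  obtain ⟨γ, hγ⟩ := hpc.joinedIn v hv w hw
  exact ⟨γ.map he.continuous, fun t => ⟨heO ⟨_, rfl⟩, hγ t⟩⟩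

theorem IsLocalHomeomorph.frequently_notMem (hπ : IsLocalHomeomorph π) {A : Set Sphere}
    (hA : A.Countable) (x : X) : ∃ᶠ y in 𝓝 x, π y ∉ A := by
  rw [frequently_iff]
  intro O hO
  obtain ⟨e, he, hx, heO, hπe⟩ := hπ.exists_plane_chart x hO
  have hc : ((π ∘ e) ⁻¹' A).Countable := hA.preimage hπe.injective
  obtain ⟨v, hv⟩ := (hc.isPathConnected_compl_of_one_lt_rank (E := ℂ) (by simp)).nonempty
  exact ⟨e v, heO ⟨v, rfl⟩, hv⟩

/-- Paths may be pushed off a countable set. -/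
theorem IsLocalHomeomorph.joinedIn_notMem (hπ : IsLocalHomeomorph π) {A : Set Sphere}
    (hA : A.Countable) {O : Set X} (hO : IsOpen O) {x y : X} (hxy : JoinedIn O x y)
    (hx : π x ∉ A) (hy : π y ∉ A) : JoinedIn (O ∩ {y | π y ∉ A}) x y := by
  obtain ⟨γ, hγ⟩ := hxy
  set S := O ∩ {y | π y ∉ A}
  -- The path itself may meet the forbidden set, so the clopen argument tests the admissible points
  -- near `γ t` and not `γ t`.
  set P : Set unitInterval := {t | ∀ᶠ z in 𝓝 (γ t), π z ∉ A → JoinedIn S x z} with hP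
  have key : ∀ t, ∃ W, IsOpen W ∧ γ t ∈ W ∧ (∀ y ∈ W, π y ∉ A → ∀ z ∈ W, π z ∉ A →
      JoinedIn S y z) := fun t => hπ.exists_nhds_joinedIn hA _ (hO.mem_nhds (hγ t))
  have hclopen : IsClopen P := by
    constructor
    · rw [← isOpen_compl_iff, isOpen_iff_mem_nhds]
      intro t ht
      obtain ⟨W, hW, htW, hj⟩ := key t
      filter_upwards [γ.continuous.continuousAt (hW.mem_nhds htW)] with s hs hPs
      obtain ⟨z, hz, hzP, hzW⟩ :=
        ((hπ.frequently_notMem hA (γ s)).and_eventually (hPs.and (hW.mem_nhds hs))).exists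
      refine ht ?_
      filter_upwards [hW.mem_nhds htW] with z' hz' hz'A
      exact (hzP hz).trans (hj _ hzW hz _ hz' hz'A)
    · rw [isOpen_iff_mem_nhds]
      intro t ht
      exact γ.continuous.continuousAt.eventually (eventually_eventually_nhds.2 ht)
  have h0 : (0 : unitInterval) ∈ P := by
    obtain ⟨W, hW, htW, hj⟩ := key 0
    filter_upwards [hW.mem_nhds htW] with z hz hzA
    rw [γ.source] at htW
    exact hj x htW hx z hz hzA
  have h1 : (1 : unitInterval) ∈ P := by
    rw [hclopen.eq_univ ⟨0, h0⟩]
    trivial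
  have := Eventually.self_of_nhds h1
  rw [γ.target] at this
  exact this hy

end LocalHomeomorph

theorem isLocalHomeomorph_id_sphere : IsLocalHomeomorph (id : Sphere → Sphere) :=
  IsOpenEmbedding.id.isLocalHomeomorph

theorem isPathConnected_univ_sphere : IsPathConnected (Set.univ : Set Sphere) := by
  refine ⟨OnePoint.infty, trivial, fun {x} _ => ?_⟩
  have h0 : ∀ z : ℂ, JoinedIn Set.univ ((0 : ℂ) : Sphere) z := fun z =>
    ((isPathConnected_range OnePoint.continuous_coe).joinedIn _ ⟨0, rfl⟩ _ ⟨z, rfl⟩).mono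
      (Set.subset_univ _)
  have h1 : JoinedIn Set.univ (OnePoint.infty : Sphere) ((1 : ℂ) : Sphere) :=
    ((isPathConnected_range isOpenEmbedding_invChart.continuous).joinedIn _ ⟨0, invChart_zero⟩ _
      ⟨1, by simp [invChart_of_ne]⟩).mono (Set.subset_univ _)
  induction x using OnePoint.rec with
  | infty => exact JoinedIn.refl trivial
  | coe z => exact h1.trans ((h0 1).symm.trans (h0 z))

theorem exists_path_notMem {A : Set Sphere} (hA : A.Countable) {x y : Sphere} (hx : x ∉ A)
    (hy : y ∉ A) : ∃ γ : Path x y, ∀ t, γ t ∉ A := by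
  obtain ⟨γ, hγ⟩ := isLocalHomeomorph_id_sphere.joinedIn_notMem hA isOpen_univ
    (isPathConnected_univ_sphere.joinedIn x trivial y trivial) hx hy
  exact ⟨γ, fun t => (hγ t).2⟩

/-! ### The Poincaré–Volterra theorem -/

instance : SecondCountableTopology Sphere := by
  have h : ∀ {e : ℂ → Sphere}, IsOpenEmbedding e → SecondCountableTopology (Set.range e) :=
    fun he => he.isEmbedding.toHomeomorph.symm.isEmbedding.secondCountableTopology
  have : ∀ i : Bool, SecondCountableTopology
      ((Bool.rec (Set.range invChart) (Set.range ((↑) : ℂ → Sphere)) i : Set Sphere)) := by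
    rintro (_ | _)
    · exact h isOpenEmbedding_invChart
    · exact h OnePoint.isOpenEmbedding_coe
  refine TopologicalSpace.secondCountableTopology_of_countable_cover
    (U := fun i : Bool => (Bool.rec (Set.range invChart) (Set.range ((↑) : ℂ → Sphere)) i)) ?_ ?_
  · rintro (_ | _)
    · exact isOpenEmbedding_invChart.isOpen_range
    · exact OnePoint.isOpenEmbedding_coe.isOpen_range
  · refine Set.eq_univ_of_forall fun x => ?_
    induction x using OnePoint.rec with
    | infty => exact Set.mem_iUnion.2 ⟨false, 0, invChart_zero⟩
    | coe z => exact Set.mem_iUnion.2 ⟨true, z, rfl⟩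

theorem exists_countable_preconnected_basis_sphere :
    ∃ B : Set (Set Sphere), B.Countable ∧ (∀ b ∈ B, IsOpen b ∧ IsPreconnected b) ∧
      TopologicalSpace.IsTopologicalBasis B := by
  have : TopologicalSpace.IsTopologicalBasis {b : Set Sphere | IsOpen b ∧ IsPreconnected b} := by
    refine TopologicalSpace.isTopologicalBasis_of_isOpen_of_nhds (fun b hb => hb.1) fun x O hx hO => ?_
    obtain ⟨e, he, hxe, heO, -⟩ :=
      isLocalHomeomorph_id_sphere.exists_plane_chart x (hO.mem_nhds hx)
    exact ⟨_, ⟨he.isOpen_range, isPreconnected_range he.continuous⟩, hxe, heO⟩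
  obtain ⟨B, hB, hBc, hB'⟩ := this.exists_countable
  exact ⟨B, hBc, fun b hb => hB hb, hB'⟩

section Sheets

variable {X : Type*} [TopologicalSpace X]

/-- `W` is an open set that the map `π` sends homeomorphically onto `b`. -/
def IsSheet (π : X → Sphere) (b : Set Sphere) (W : Set X) : Prop :=
  IsOpen W ∧ ∃ σ : Sphere → X, ContinuousOn σ b ∧ (∀ y ∈ b, π (σ y) = y) ∧ W = σ '' b

variable {π : X → Sphere} {b : Set Sphere} {W W' : Set X}

/-- Two sections over a connected set that agree at one point agree everywhere. Hence at most one
sheet over a given basic set passes through a given point, which drives the counting below. -/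
theorem IsSheet.eq [T2Space X] (hπ : IsLocalHomeomorph π) (hb : IsPreconnected b)
    (hW : IsSheet π b W) (hW' : IsSheet π b W') {x : X} (hx : x ∈ W) (hx' : x ∈ W') : W = W' := by
  obtain ⟨-, σ, hσ, hσπ, rfl⟩ := hW
  obtain ⟨-, τ, hτ, hτπ, rfl⟩ := hW'
  obtain ⟨y, hy, rfl⟩ := hx
  obtain ⟨z, hz, hzy⟩ := hx'
  have hyz : z = y := by rw [← hτπ z hz, hzy, hσπ y hy]
  subst hyz
  exact Set.image_congr ((T2Space.isSeparatedMap π).eqOn_of_comp_eqOn hπ.isLocallyInjective hb hσ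
    hτ (fun u hu => by simp [hσπ u hu, hτπ u hu]) hy hzy.symm)

theorem IsSheet.exists_countable_dense (hb : IsOpen b) (hW : IsSheet π b W) :
    ∃ D : Set X, D.Countable ∧ ∀ V, IsOpen V → (W ∩ V).Nonempty → (W ∩ V ∩ D).Nonempty := by
  obtain ⟨-, σ, hσ, hσπ, rfl⟩ := hW
  obtain ⟨D, hD, hDd⟩ := TopologicalSpace.exists_countable_dense Sphere
  refine ⟨σ '' D, hD.image _, ?_⟩
  rintro V hV ⟨_, ⟨y, hy, rfl⟩, hyV⟩
  obtain ⟨z, ⟨hzb, hzV⟩, hzD⟩ :=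
    hDd.inter_open_nonempty _ (hσ.isOpen_inter_preimage hb hV) ⟨y, hy, hyV⟩
  exact ⟨σ z, ⟨⟨z, hzb, rfl⟩, hzV⟩, ⟨z, hzD, rfl⟩⟩

theorem IsSheet.secondCountable (hπ : IsLocalHomeomorph π) (hW : IsSheet π b W) :
    SecondCountableTopology W := by
  obtain ⟨hWo, σ, -, hσπ, rfl⟩ := hW
  have : IsOpenEmbedding (fun w : (σ '' b : Set X) => π w) := by
    refine (hπ.comp hWo.isOpenEmbedding_subtypeVal.isLocalHomeomorph).isOpenEmbedding_of_injective ?_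
    rintro ⟨_, y, hy, rfl⟩ ⟨_, z, hz, rfl⟩ h
    simp only [Function.comp_apply, hσπ y hy, hσπ z hz] at h
    simp [h]
  exact this.isEmbedding.secondCountableTopology

theorem IsLocalHomeomorph.exists_isSheet (hπ : IsLocalHomeomorph π) {B : Set (Set Sphere)}
    (hB : TopologicalSpace.IsTopologicalBasis B) (x : X) : ∃ b ∈ B, ∃ W, IsSheet π b W ∧ x ∈ W := by
  set s := hπ.localInverseAt (x := x)
  obtain ⟨b, hb, hxb, hbs⟩ := hB.exists_subset_of_mem_open
    (show π x ∈ s.source from hπ.apply_self_mem_localInverseAt_source) s.open_source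
  refine ⟨b, hb, s '' b, ⟨s.isOpen_image_of_subset_source (hB.isOpen hb) hbs, s,
    s.continuousOn.mono hbs, fun y hy => hπ.apply_localInverseAt_of_mem (hbs hy), rfl⟩, π x, hxb, ?_⟩
  exact hπ.localInverseAt_apply_self

/-- The Poincaré–Volterra theorem. -/
theorem IsLocalHomeomorph.secondCountableTopology [T2Space X] [PreconnectedSpace X]
    (hπ : IsLocalHomeomorph π) : SecondCountableTopology X := by
  rcases isEmpty_or_nonempty X with _ | ⟨⟨x₀⟩⟩
  · infer_instance
  obtain ⟨B, hBc, hBb, hB⟩ := exists_countable_preconnected_basis_sphere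
  obtain ⟨b₀, hb₀, W₀, hW₀, hxW₀⟩ := hπ.exists_isSheet hB x₀
  -- Chains of sheets: each generation consists of the sheets over basic sets that meet a sheet of
  -- the preceding one, starting from `W₀`.
  let next : Set (Set X) → Set (Set X) :=
    fun F => ⋃ b ∈ B, ⋃ W ∈ F, {W' | IsSheet π b W' ∧ (W ∩ W').Nonempty}
  let G : ℕ → Set (Set X) := fun n => next^[n] {W₀}
  have hGsucc : ∀ n, G (n + 1) = next (G n) := fun n => Function.iterate_succ_apply' _ _ _
  have hsheet : ∀ n, ∀ W ∈ G n, ∃ b ∈ B, IsSheet π b W := by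
    rintro (_ | n) W hW
    · obtain rfl : W = W₀ := hW
      exact ⟨b₀, hb₀, hW₀⟩
    · rw [hGsucc] at hW
      simp only [next, Set.mem_iUnion] at hW
      obtain ⟨b, hb, _, _, hW, _⟩ := hW
      exact ⟨b, hb, hW⟩
  have hcount : ∀ n, (G n).Countable := by
    intro n
    induction n with
    | zero => exact Set.countable_singleton W₀
    | succ n ih =>
      rw [hGsucc]
      refine hBc.biUnion fun b hb => ih.biUnion fun W hW => ?_
      obtain ⟨c, hc, hWc⟩ := hsheet n W hW
      obtain ⟨D, hD, hDW⟩ := hWc.exists_countable_dense (hB.isOpen hc)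
      -- Every new sheet contains a point of the countable dense part `D` of `W`, and over `b` such
      -- a point determines the sheet.
      refine (hD.biUnion (t := fun d _ => {W' | IsSheet π b W' ∧ d ∈ W'}) fun d _ =>
        Set.Subsingleton.countable ?_).mono ?_
      · rintro W₁ ⟨h₁, hd₁⟩ W₂ ⟨h₂, hd₂⟩
        exact h₁.eq hπ (hBb b hb).2 h₂ hd₁ hd₂
      · rintro W' ⟨hW', hne⟩
        obtain ⟨d, ⟨-, hdW'⟩, hdD⟩ := hDW W' hW'.1 hne
        exact Set.mem_biUnion hdD ⟨hW', hdW'⟩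
  set H : Set (Set X) := ⋃ n, G n
  have hHc : H.Countable := Set.countable_iUnion hcount
  have hHs : ∀ W ∈ H, ∃ b ∈ B, IsSheet π b W := fun W hW => by
    obtain ⟨n, hn⟩ := Set.mem_iUnion.1 hW
    exact hsheet n W hn
  have hUo : IsOpen (⋃₀ H) := isOpen_sUnion fun W hW => by
    obtain ⟨b, _, h⟩ := hHs W hW
    exact h.1
  -- A sheet around a limit point meets some sheet already reached, hence belongs to the next
  -- generation.
  have hUc : IsClosed (⋃₀ H) := by
    refine isClosed_of_closure_subset fun x hx => ?_
    obtain ⟨b, hb, W', hW', hxW'⟩ := hπ.exists_isSheet hB x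
    obtain ⟨y, hyW', W, hWH, hyW⟩ := mem_closure_iff.1 hx W' hW'.1 hxW'
    obtain ⟨n, hn⟩ := Set.mem_iUnion.1 hWH
    refine ⟨W', Set.mem_iUnion.2 ⟨n + 1, ?_⟩, hxW'⟩
    rw [hGsucc]
    simp only [next, Set.mem_iUnion]
    exact ⟨b, hb, W, hn, hW', y, hyW, hyW'⟩
  have huniv : ⋃₀ H = Set.univ := IsClopen.eq_univ ⟨hUc, hUo⟩
    ⟨x₀, W₀, Set.mem_iUnion.2 ⟨0, rfl⟩, hxW₀⟩
  have : Countable H := hHc.to_subtype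
  have : ∀ W : H, SecondCountableTopology (W : Set X) := fun W => by
    obtain ⟨b, _, h⟩ := hHs W W.2
    exact h.secondCountable hπ
  refine TopologicalSpace.secondCountableTopology_of_countable_cover
    (U := fun W : H => (W : Set X)) (fun W => ?_) ?_
  · obtain ⟨b, _, h⟩ := hHs W W.2
    exact h.1
  · rw [← Set.sUnion_eq_iUnion, huniv]

theorem IsLocalHomeomorph.isOpen_pathComponent (hπ : IsLocalHomeomorph π) (x : X) :
    IsOpen (pathComponent x) := by
  refine isOpen_iff_mem_nhds.2 fun y hy => ?_
  filter_upwards [hπ.eventually_joinedIn y univ_mem] with z hz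
  exact Joined.trans hy hz.joined

theorem IsLocalHomeomorph.secondCountable_pathComponent [T2Space X] (hπ : IsLocalHomeomorph π)
    (x : X) : SecondCountableTopology (pathComponent x) := by
  have : PreconnectedSpace (pathComponent x) :=
    Subtype.preconnectedSpace isPathConnected_pathComponent.isConnected.isPreconnected
  exact (hπ.comp
    (hπ.isOpen_pathComponent x).isOpenEmbedding_subtypeVal.isLocalHomeomorph).secondCountableTopology

/-- A locally countable subset of a path component is countable. -/
theorem IsLocalHomeomorph.countable_of_locally [T2Space X] (hπ : IsLocalHomeomorph π) {x : X}
    {Z : Set X} (hZ : Z ⊆ pathComponent x) (hloc : ∀ z ∈ Z, ∃ N ∈ 𝓝 z, (Z ∩ N).Countable) :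
    Z.Countable := by
  have := hπ.secondCountable_pathComponent x
  choose! N hN hZN using hloc
  set Z' : Set (pathComponent x) := (↑) ⁻¹' Z
  obtain ⟨t, htZ, htc, ht⟩ := TopologicalSpace.countable_cover_nhdsWithin
    (f := fun z : pathComponent x => ((↑) ⁻¹' N z : Set (pathComponent x))) (s := Z')
    fun z hz => mem_nhdsWithin_of_mem_nhds
      (continuous_subtype_val.continuousAt.preimage_mem_nhds (hN z hz))
  refine (htc.biUnion fun z hz => hZN z (htZ hz)).mono fun z hz => ?_
  obtain ⟨y, hy, hzy⟩ := Set.mem_iUnion₂.1 (ht (show (⟨z, hZ hz⟩ : pathComponent x) ∈ Z' from hz))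
  exact Set.mem_biUnion hy ⟨hz, hzy⟩

end Sheets

/-! ### Analytic continuation -/

namespace RegularGerm

theorem lift_eqOn {T : Type*} [TopologicalSpace T] {s : Set T} (hs : IsPreconnected s)
    {G H : T → RegularGerm} (hG : ContinuousOn G s) (hH : ContinuousOn H s)
    (hpt : ∀ t ∈ s, (G t).pt = (H t).pt) {a : T} (ha : a ∈ s) (hGH : G a = H a) :
    s.EqOn G H :=
  (T2Space.isSeparatedMap pt).eqOn_of_comp_eqOn isLocalHomeomorph_pt.isLocallyInjective hs hG hH
    hpt ha hGH

theorem continuousAt_ofFun {h : Sphere → ℂ} {x : Sphere} (hx : HolomorphicAt h x) :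
    ContinuousAt (ofFun h) x := by
  have := tendsto_ofFun (isGermOf_ofFun hx)
  rwa [ofFun_pt] at this

/-- The germs of `h` along the family form a second lift of the same base points, so unique lifting
identifies it with `G`. -/
theorem isGermOf_of_isPreconnected {T : Type*} [TopologicalSpace T] {s : Set T}
    (hs : IsPreconnected s) {G : T → RegularGerm} (hG : ContinuousOn G s) {h : Sphere → ℂ}
    (hh : ∀ t ∈ s, HolomorphicAt h (G t).pt) {a : T} (ha : a ∈ s) (hGa : (G a).IsGermOf h)
    {t : T} (ht : t ∈ s) : (G t).IsGermOf h := by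
  have : s.EqOn G (fun t => ofFun h (G t).pt) := by
    refine lift_eqOn hs hG (fun u hu => ?_) (fun u _ => (ofFun_pt _ _).symm) ha (eq_ofFun hGa)
    exact ContinuousAt.comp_continuousWithinAt (f := fun t => (G t).pt)
      (continuousAt_ofFun (hh u hu)) (continuous_pt.continuousAt.comp_continuousWithinAt (hG u hu))
  rw [this ht]
  exact isGermOf_ofFun (hh t ht)

theorem isGermOf_of_joinedIn {U : Set Sphere} {h : Sphere → ℂ} (hh : ∀ x ∈ U, HolomorphicAt h x)
    {p q : RegularGerm} (hpq : JoinedIn (pt ⁻¹' U) p q) (hp : p.IsGermOf h) : q.IsGermOf h := by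
  obtain ⟨Γ, hΓ⟩ := hpq
  have := isGermOf_of_isPreconnected (t := 1) isPreconnected_univ Γ.continuous.continuousOn
    (fun t _ => hh _ (hΓ t)) (Set.mem_univ 0) (by rwa [Γ.source]) trivial
  rwa [Γ.target] at this

end RegularGerm

open RegularGerm

theorem continuesTo_of_continuous {a b : Sphere} (γ : Path a b) {G : unitInterval → RegularGerm}
    (hG : Continuous G) (hpt : ∀ t, (G t).pt = γ t) : ContinuesTo γ (G 0) (G 1) :=
  ⟨⟨⟨G, hG⟩, rfl, rfl⟩, hpt⟩

theorem ContinuesTo.pt_eq_left {a b : Sphere} {γ : Path a b} {p q : RegularGerm}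
    (h : ContinuesTo γ p q) : p.pt = a := by
  obtain ⟨Γ, hΓ⟩ := h
  have := hΓ 0
  rwa [Γ.source, γ.source] at this

theorem ContinuesTo.pt_eq_right {a b : Sphere} {γ : Path a b} {p q : RegularGerm}
    (h : ContinuesTo γ p q) : q.pt = b := h.symm.pt_eq_left

theorem ContinuesTo.unique {a b : Sphere} {γ : Path a b} {p q r : RegularGerm}
    (h : ContinuesTo γ p q) (h' : ContinuesTo γ p r) : q = r := by
  obtain ⟨Γ, hΓ⟩ := h
  obtain ⟨Δ, hΔ⟩ := h'
  have := lift_eqOn (a := 0) isPreconnected_univ Γ.continuous.continuousOn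
    Δ.continuous.continuousOn (fun t _ => (hΓ t).trans (hΔ t).symm) trivial
    (Γ.source.trans Δ.source.symm) (Set.mem_univ 1)
  rwa [Γ.target, Δ.target] at this

theorem ContinuesTo.generatedBy_eq {a b : Sphere} {γ : Path a b} {p q : RegularGerm}
    (h : ContinuesTo γ p q) : generatedBy p = generatedBy q := by
  obtain ⟨Γ, -⟩ := h
  exact Quotient.sound ⟨Γ⟩

theorem joined_of_generatedBy_eq {p q : RegularGerm} (h : generatedBy p = generatedBy q) :
    Joined p q := Quotient.exact h

theorem continuesUpTo_one_iff {a b : Sphere} {γ : Path a b} {p : RegularGerm} :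
    ContinuesUpTo γ p 1 ↔ ∃ q, ContinuesTo γ p q := by
  constructor
  · rintro ⟨Γ, hΓ, h0, hpt⟩
    have : Set.Icc (0 : unitInterval) 1 = Set.univ := Set.eq_univ_of_forall fun t => ⟨t.2.1, t.2.2⟩
    rw [this, continuousOn_univ] at hΓ
    exact ⟨Γ 1, h0 ▸ continuesTo_of_continuous γ hΓ fun t => hpt t ⟨t.2.1, t.2.2⟩⟩
  · rintro ⟨q, Γ, hΓ⟩
    exact ⟨Γ, Γ.continuous.continuousOn, Γ.source, fun t _ => hΓ t⟩

theorem ContinuesUpTo.mono {a b : Sphere} {γ : Path a b} {p : RegularGerm} {σ τ : unitInterval}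
    (h : ContinuesUpTo γ p τ) (hστ : σ ≤ τ) : ContinuesUpTo γ p σ := by
  obtain ⟨Γ, hΓ, h0, hpt⟩ := h
  have : Set.Icc 0 σ ⊆ Set.Icc 0 τ := Set.Icc_subset_Icc_right hστ
  exact ⟨Γ, hΓ.mono this, h0, fun t ht => hpt t (this ht)⟩

theorem continuesUpTo_zero {a b : Sphere} {γ : Path a b} {p : RegularGerm} (hp : p.pt = a) :
    ContinuesUpTo γ p 0 := by
  refine ⟨fun _ => p, continuousOn_const, rfl, fun t ht => ?_⟩
  rw [Set.Icc_self] at ht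
  rw [ht, γ.source, hp]

theorem continuesUpTo_extend {a b : Sphere} {γ : Path a b} {p : RegularGerm} {t τ : unitInterval}
    {Γ : unitInterval → RegularGerm} (hΓ : ContinuousOn Γ (Set.Icc 0 t)) (h0 : Γ 0 = p)
    (hpt : ∀ s ∈ Set.Icc 0 t, (Γ s).pt = γ s) (htτ : t ≤ τ) {k : Sphere → ℂ}
    (hk : ∀ s ∈ Set.Icc t τ, HolomorphicAt k (γ s)) (hΓk : (Γ t).IsGermOf k) :
    ContinuesUpTo γ p τ := by
  classical
  set G : unitInterval → RegularGerm := fun s => if s ≤ t then Γ s else ofFun k (γ s) with hG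
  have h1 : (Set.Icc 0 t).EqOn G Γ := fun s hs => if_pos hs.2
  have h2 : (Set.Icc t τ).EqOn G (fun s => ofFun k (γ s)) := fun s hs => by
    rcases hs.1.eq_or_lt with rfl | h
    · rw [h1 ⟨t.2.1, le_rfl⟩]
      exact (eq_ofFun hΓk).trans (by rw [hpt t ⟨t.2.1, le_rfl⟩])
    · exact if_neg h.not_ge
  refine ⟨G, ?_, (h1 ⟨le_rfl, t.2.1⟩).trans h0, fun s hs => ?_⟩
  · rw [← Set.Icc_union_Icc_eq_Icc (show 0 ≤ t from t.2.1) htτ]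
    refine ContinuousOn.union_of_isClosed (hΓ.congr h1) (ContinuousOn.congr ?_ h2) isClosed_Icc
      isClosed_Icc
    exact fun s hs => ((continuousAt_ofFun (hk s hs)).comp
      γ.continuous.continuousAt).continuousWithinAt
  · rcases le_total s t with h | h
    · rw [h1 ⟨hs.1, h⟩, hpt s ⟨hs.1, h⟩]
    · rw [h2 ⟨h, hs.2⟩]
      exact ofFun_pt _ _

theorem ContinuesUpTo.eventually {a b : Sphere} {γ : Path a b} {p : RegularGerm}
    {t : unitInterval} (h : ContinuesUpTo γ p t) : ∀ᶠ τ in 𝓝 t, ContinuesUpTo γ p τ := by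
  obtain ⟨Γ, hΓ, h0, hpt⟩ := h
  obtain ⟨k, hk, hkh⟩ := (Γ t).exists_isGermOf
  rw [hpt t ⟨t.2.1, le_rfl⟩] at hkh
  obtain ⟨I, hI, hIo, htI, hIk⟩ : ∃ I : Set unitInterval, I.OrdConnected ∧ IsOpen I ∧ t ∈ I ∧
      ∀ s ∈ I, HolomorphicAt k (γ s) := by
    have := γ.continuous.continuousAt.eventually hkh.eventually
    obtain ⟨ε, hε, H⟩ := Metric.eventually_nhds_iff_ball.1 this
    refine ⟨Metric.ball t ε, ⟨fun x hx y hy z hz => ?_⟩, Metric.isOpen_ball,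
      Metric.mem_ball_self hε, H⟩
    rw [Metric.mem_ball, Subtype.dist_eq, Real.dist_eq, abs_lt] at *
    have h1 : (x : ℝ) ≤ z := hz.1
    have h2 : (z : ℝ) ≤ y := hz.2
    constructor <;> linarith [hx.1, hy.2]
  filter_upwards [hIo.mem_nhds htI] with τ hτ
  rcases le_total τ t with h | h
  · exact ContinuesUpTo.mono ⟨Γ, hΓ, h0, hpt⟩ h
  · exact continuesUpTo_extend hΓ h0 hpt h (fun s hs => hIk s (hI.out htI hτ hs)) hk

/-- The set of times up to which a germ continues contains 0 and is open
(`ContinuesUpTo.eventually`), so only passage to a limit from the left has to be supplied. -/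
theorem continuesUpTo_one_of_closed {a b : Sphere} {γ : Path a b} {p : RegularGerm}
    (hp : p.pt = a) (hcl : ∀ τ : unitInterval, 0 < τ → (∀ σ < τ, ContinuesUpTo γ p σ) →
      ContinuesUpTo γ p τ) : ContinuesUpTo γ p 1 := by
  have : IsClopen {τ | ContinuesUpTo γ p τ} := by
    constructor
    · refine isClosed_of_closure_subset fun τ hτ => ?_
      rcases eq_or_ne τ 0 with rfl | h0
      · exact continuesUpTo_zero hp
      · refine hcl τ (lt_of_le_of_ne τ.2.1 h0.symm) fun σ hσ => ?_
        obtain ⟨s, hs, hs'⟩ := mem_closure_iff.1 hτ (Set.Ioi σ) isOpen_Ioi hσ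
        exact ContinuesUpTo.mono hs' (le_of_lt hs)
    · exact isOpen_iff_mem_nhds.2 fun τ hτ => ContinuesUpTo.eventually hτ
  have h1 : (1 : unitInterval) ∈ {τ | ContinuesUpTo γ p τ} := by
    rw [this.eq_univ ⟨0, continuesUpTo_zero hp⟩]
    trivial
  exact h1

/-- A germ continues along every path that avoids its singular points. -/
theorem continuesUpTo_one_of_forall_not_isSingularPoint {p : RegularGerm} {b : Sphere}
    (γ : Path p.pt b) (hγ : ∀ t, ¬ IsSingularPoint p (γ t)) : ContinuesUpTo γ p 1 := by
  refine continuesUpTo_one_of_closed rfl fun τ hτ hσ => by_contra fun hn => hγ τ ?_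
  have hτ' : (0 : ℝ) < τ := hτ
  -- The first obstructed time `τ` is turned into an obstruction at the end of a path by rescaling
  -- `[0, τ]` to the unit interval.
  let δ : Path p.pt (γ τ) := ⟨⟨fun s => γ (τ * s), by fun_prop⟩, by simp, by simp⟩
  refine ⟨δ, fun h => hn ?_, fun s hs => ?_⟩
  · obtain ⟨G, hG, h0, hpt⟩ := h
    let ρ : unitInterval → unitInterval := fun t => ⟨min (t / τ) 1, le_min (by
      exact div_nonneg t.2.1 hτ'.le) zero_le_one, min_le_right _ _⟩
    have hρ : Continuous ρ := by
      refine Continuous.subtype_mk ?_ _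
      fun_prop
    have hρτ : ∀ t ≤ τ, τ * ρ t = t := fun t ht => by
      ext
      have : (t : ℝ) / τ ≤ 1 := (div_le_one hτ').2 ht
      simp only [Set.Icc.coe_mul, ρ, min_eq_left this]
      field_simp
    refine ⟨G ∘ ρ, hG.comp hρ.continuousOn fun t _ => ⟨(ρ t).2.1, (ρ t).2.2⟩, ?_, fun t ht => ?_⟩
    · have : ρ 0 = 0 := by ext; simp [ρ]
      simp [this, h0]
    · rw [Function.comp_apply, hpt _ ⟨(ρ t).2.1, (ρ t).2.2⟩]
      change γ (τ * ρ t) = γ t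
      rw [hρτ t ht.2]
  · have hlt : τ * s < τ := by
      rw [← Subtype.coe_lt_coe, Set.Icc.coe_mul]
      exact mul_lt_of_lt_one_right hτ' hs
    obtain ⟨Γ, hΓ, h0, hpt⟩ := hσ _ hlt
    have hm : ∀ u ∈ Set.Icc 0 s, τ * u ∈ Set.Icc 0 (τ * s) := fun u hu => by
      refine ⟨(τ * u).2.1, ?_⟩
      rw [← Subtype.coe_le_coe, Set.Icc.coe_mul, Set.Icc.coe_mul]
      exact mul_le_mul_of_nonneg_left hu.2 hτ'.le
    exact ⟨fun u => Γ (τ * u), hΓ.comp (by fun_prop) hm, by simpa using h0,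
      fun u hu => hpt _ (hm u hu)⟩

/-! ### Singular points lie in every countable forbidden set -/

/-- Infinite concatenation with the `n`-th path run over `[n, n + 1]`; it serves to approach a point
through shrinking neighbourhoods. -/
theorem exists_continuousOn_concat {Y : Type*} [TopologicalSpace Y] (y : ℕ → Y) (S : ℕ → Set Y)
    (h : ∀ n, JoinedIn (S n) (y n) (y (n + 1))) :
    ∃ β : ℝ → Y, ContinuousOn β (Set.Ici 0) ∧ (∀ n : ℕ, β n = y n) ∧
      ∀ n : ℕ, ∀ t ∈ Set.Icc (n : ℝ) (n + 1), β t ∈ S n := by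
  choose P hP using h
  set β : ℝ → Y := fun t => (P ⌊t⌋₊).extend (t - ⌊t⌋₊) with hβ
  have hβn : ∀ n : ℕ, β n = y n := fun n => by simp [hβ]
  have hβI : ∀ n : ℕ, ∀ t ∈ Set.Icc (n : ℝ) (n + 1), β t = (P n).extend (t - n) := by
    intro n t ht
    rcases ht.2.lt_or_eq with h | h
    · have : ⌊t⌋₊ = n := (Nat.floor_eq_iff (n.cast_nonneg.trans ht.1)).2 ⟨ht.1, h⟩
      change (P ⌊t⌋₊).extend (t - ⌊t⌋₊) = _
      rw [this]
    · have : t = ((n + 1 : ℕ) : ℝ) := by rw [h]; push_cast; rfl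
      rw [this, hβn]
      push_cast
      rw [add_sub_cancel_left, Path.extend_one]
  refine ⟨β, ?_, hβn, fun n t ht => ?_⟩
  · have hcov : Set.Ici (0 : ℝ) ⊆ ⋃ n : ℕ, Set.Icc (n : ℝ) (n + 1) := fun t ht =>
      Set.mem_iUnion.2 ⟨⌊t⌋₊, Nat.floor_le ht, (Nat.lt_floor_add_one t).le⟩
    refine ContinuousOn.mono (LocallyFinite.continuousOn_iUnion ?_ (fun n => isClosed_Icc)
      fun n => ?_) hcov
    · intro t
      refine ⟨Metric.ball t 1, Metric.ball_mem_nhds t one_pos, ?_⟩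
      refine (Set.finite_Iic (⌊t⌋₊ + 2)).subset ?_
      rintro n ⟨s, hs, hst⟩
      rw [Metric.mem_ball, Real.dist_eq, abs_lt] at hst
      have h1 := Nat.lt_floor_add_one t
      have : (n : ℝ) < ((⌊t⌋₊ + 2 : ℕ) : ℝ) := by
        push_cast
        linarith [hs.1]
      exact (Nat.cast_lt.1 this).le
    · refine ContinuousOn.congr ?_ (hβI n)
      exact ((P n).continuous_extend.comp (continuous_id.sub continuous_const)).continuousOn
  · rw [hβI n t ht, Path.extend_apply _ ⟨by linarith [ht.1], by linarith [ht.2]⟩]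
    exact hP n _

/-- The germ `p` continues along every path that avoids `A`. -/
def ContinuableOff (A : Set Sphere) (p : RegularGerm) : Prop :=
  ∀ ⦃b : Sphere⦄ (γ : Path p.pt b), (∀ t, γ t ∉ A) → ContinuesUpTo γ p 1

theorem unitInterval.isPathConnected_Icc {s t : unitInterval} (h : s ≤ t) :
    IsPathConnected (Set.Icc s t) := by
  have h' : (s : ℝ) ≤ t := h
  have := ((convex_Icc (s : ℝ) t).isPathConnected ⟨s, le_rfl, h'⟩).image
    (continuous_projIcc (a := (0 : ℝ)) (b := 1) (h := zero_le_one))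
  convert this
  ext u
  constructor
  · intro hu
    exact ⟨u, hu, Set.projIcc_val _ u⟩
  · rintro ⟨v, hv, rfl⟩
    rw [Set.projIcc_of_mem zero_le_one ⟨s.2.1.trans hv.1, hv.2.trans t.2.2⟩]
    exact hv

/-- Continuations up to different times agree by uniqueness, so their diagonal is a single
continuation on `[0, 1)`. -/
theorem exists_lift_Iio {a b : Sphere} {γ : Path a b} {p : RegularGerm}
    (h : ∀ τ : unitInterval, τ < 1 → ContinuesUpTo γ p τ) :
    ∃ Γ : unitInterval → RegularGerm, (∀ τ < 1, ContinuousOn Γ (Set.Icc 0 τ)) ∧ Γ 0 = p ∧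
      ∀ t < 1, (Γ t).pt = γ t := by
  have : Nonempty RegularGerm := ⟨p⟩
  choose! G hG hG0 hGpt using h
  have key : ∀ τ < 1, (Set.Icc 0 τ).EqOn (fun t => G t t) (G τ) := by
    intro τ hτ t ht
    have ht1 : t < 1 := ht.2.trans_lt hτ
    have hsub : Set.Icc 0 t ⊆ Set.Icc 0 τ := Set.Icc_subset_Icc_right ht.2
    exact lift_eqOn (unitInterval.isPathConnected_Icc ht.1).isConnected.isPreconnected
      (hG t ht1) ((hG τ hτ).mono hsub)
      (fun u hu => (hGpt t ht1 u hu).trans (hGpt τ hτ u (hsub hu)).symm)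
      (Set.left_mem_Icc.2 ht.1) ((hG0 t ht1).trans (hG0 τ hτ).symm) (Set.right_mem_Icc.2 ht.1)
  exact ⟨fun t => G t t, fun τ hτ => (hG τ hτ).congr (key τ hτ), hG0 0 (by norm_num),
    fun t ht => hGpt t ht t (Set.right_mem_Icc.2 t.2.1)⟩

/-- If `b ∉ A`, the obstructed path is replaced by one off `A` that runs through the same shrinking
neighbourhoods of `b`, with germs joined to the original ones inside them. The new path continues up
to `b`, so a single function holomorphic near `b` represents its late germs, hence also the original
ones, and the original continuation extends to `b`. -/
theorem IsSingularPoint.mem_of_continuableOff {A : Set Sphere} (hA : A.Countable)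
    {p : RegularGerm} (hp : p.pt ∉ A) (hc : ContinuableOff A p) {b : Sphere}
    (hb : IsSingularPoint p b) : b ∈ A := by
  obtain ⟨γ, hγ1, hγ⟩ := hb
  by_contra hbA
  obtain ⟨Γ, hΓ, hΓ0, hΓpt⟩ := exists_lift_Iio hγ
  obtain ⟨V, hV⟩ := (𝓝 b).exists_antitone_basis
  -- Stage 0 is the whole sphere, which allows the new path to start at `p` itself.
  let D : ℕ → Set Sphere := fun n => Nat.casesOn n Set.univ fun m => interior (V m)
  have hDo : ∀ n, IsOpen (D n) := by
    rintro (_ | n)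
    exacts [isOpen_univ, isOpen_interior]
  have hDb : ∀ n, b ∈ D n := by
    rintro (_ | n)
    exacts [trivial, mem_interior_iff_mem_nhds.2 (hV.1.mem_of_mem trivial)]
  have hDanti : Antitone D := by
    refine antitone_nat_of_succ_le ?_
    rintro (_ | n)
    exacts [Set.subset_univ _, interior_mono (hV.2 n.le_succ)]
  have hDsmall : ∀ O ∈ 𝓝 b, ∃ N, D N ⊆ O := fun O hO => by
    obtain ⟨n, -, hn⟩ := hV.1.mem_iff.1 hO
    exact ⟨n + 1, interior_subset.trans hn⟩
  have ht : ∀ n, ∃ t : unitInterval, t < 1 ∧ (n = 0 → t = 0) ∧ ∀ s, t ≤ s → γ s ∈ D n := by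
    rintro (_ | n)
    · exact ⟨0, by norm_num, fun _ => rfl, fun s _ => trivial⟩
    · have h1 : γ ⁻¹' D (n + 1) ∈ 𝓝 (1 : unitInterval) :=
        γ.continuous.continuousAt.preimage_mem_nhds
          (by rw [γ.target]; exact (hDo (n + 1)).mem_nhds (hDb (n + 1)))
      obtain ⟨t, ht, hts⟩ := exists_Ioc_subset_of_mem_nhds h1 ⟨0, by norm_num⟩
      obtain ⟨t', htt', ht'⟩ := exists_between ht
      exact ⟨t', ht', fun h => by simp at h, fun s hs => hts ⟨htt'.trans_le hs, s.2.2⟩⟩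
  choose t ht1 ht0 htD using ht
  -- The point `γ (t n)` may lie in `A`, so a nearby germ over a point off `A` is taken as the
  -- `n`-th node.
  have hy : ∀ n, ∃ y : RegularGerm, y.pt ∉ A ∧ (n = 0 → y = p) ∧
      JoinedIn (pt ⁻¹' D n) (Γ (t n)) y := by
    rintro (_ | n)
    · refine ⟨p, hp, fun _ => rfl, ?_⟩
      rw [ht0 0 rfl, hΓ0]
      exact JoinedIn.refl trivial
    · have hO : pt ⁻¹' D (n + 1) ∈ 𝓝 (Γ (t (n + 1))) :=
        continuous_pt.continuousAt.preimage_mem_nhds ((hDo (n + 1)).mem_nhds (by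
          rw [hΓpt _ (ht1 (n + 1))]
          exact htD (n + 1) _ le_rfl))
      obtain ⟨y, hyA, hy⟩ := ((isLocalHomeomorph_pt.frequently_notMem hA _).and_eventually
        (isLocalHomeomorph_pt.eventually_joinedIn _ hO)).exists
      exact ⟨y, hyA, fun h => by simp at h, hy⟩
  choose y hyA hy0 hyΓ using hy
  have hΓj : ∀ n, ∀ s s' : unitInterval, s < 1 → s' < 1 → (∀ u, s ≤ u → γ u ∈ D n) → s ≤ s' →
      JoinedIn (pt ⁻¹' D n) (Γ s) (Γ s') := by
    intro n s s' hs hs' hD hss'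
    have hsub : Set.Icc s s' ⊆ Set.Icc 0 s' := Set.Icc_subset_Icc_left s.2.1
    refine (((unitInterval.isPathConnected_Icc hss').image' ((hΓ s' hs').mono hsub)).joinedIn _
      ⟨s, Set.left_mem_Icc.2 hss', rfl⟩ _ ⟨s', Set.right_mem_Icc.2 hss', rfl⟩).mono ?_
    rintro _ ⟨u, hu, rfl⟩
    rw [Set.mem_preimage, hΓpt u (hu.2.trans_lt hs')]
    exact hD u hu.1
  have hstep : ∀ n, JoinedIn (pt ⁻¹' D n ∩ {q | q.pt ∉ A}) (y n) (y (n + 1)) := by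
    intro n
    have hsub : pt ⁻¹' D (n + 1) ⊆ pt ⁻¹' D n := Set.preimage_mono (hDanti n.le_succ)
    refine isLocalHomeomorph_pt.joinedIn_notMem hA ((hDo n).preimage continuous_pt)
      ((hyΓ n).symm.trans (JoinedIn.trans ?_ ((hyΓ (n + 1)).mono hsub))) (hyA _) (hyA _)
    rcases le_total (t n) (t (n + 1)) with h | h
    · exact hΓj n _ _ (ht1 _) (ht1 _) (htD n) h
    · exact ((hΓj (n + 1) _ _ (ht1 _) (ht1 _) (htD (n + 1)) h).mono hsub).symm
  obtain ⟨β, hβ, hβy, hβD⟩ := exists_continuousOn_concat y _ hstep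
  -- This maps `[0, 1)` onto `[0, ∞)`. The value at 1 is the junk value of division by zero, which
  -- is why `g` treats that point separately.
  let ρ : unitInterval → ℝ := fun s => s / (1 - s)
  have hρ0 : ∀ s, 0 ≤ ρ s := fun s => div_nonneg s.2.1 (sub_nonneg.2 s.2.2)
  have hβD' : ∀ n : ℕ, ∀ v : ℝ, n ≤ v → β v ∈ pt ⁻¹' D n ∩ {q | q.pt ∉ A} := fun n v hv => by
    have h0 : 0 ≤ v := n.cast_nonneg.trans hv
    have := hβD ⌊v⌋₊ v ⟨Nat.floor_le h0, (Nat.lt_floor_add_one v).le⟩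
    exact ⟨hDanti (Nat.le_floor hv) this.1, this.2⟩
  have hρc : ContinuousOn ρ (Set.Iio 1) := by
    refine ContinuousOn.div (by fun_prop) (by fun_prop) fun s hs => ?_
    exact (sub_pos.2 (show (s : ℝ) < 1 from hs)).ne'
  have hβρ : ContinuousOn (β ∘ ρ) (Set.Iio 1) := hβ.comp hρc fun s _ => hρ0 s
  have hρlim : ∀ n : ℕ, ∀ᶠ s in 𝓝 (1 : unitInterval), s ≠ 1 → (n : ℝ) ≤ ρ s := by
    intro n
    have : ∀ᶠ s : unitInterval in 𝓝 1, (n : ℝ) * (1 - s) < s := by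
      refine ContinuousAt.eventually_lt (f := fun s : unitInterval => (n : ℝ) * (1 - s))
        (g := fun s : unitInterval => (s : ℝ)) (by fun_prop) (by fun_prop) (by simp)
    filter_upwards [this] with s hs hs1
    have : (0 : ℝ) < 1 - s := sub_pos.2 (lt_of_le_of_ne s.2.2 fun h => hs1 (Subtype.ext h))
    exact (le_div_iff₀ this).2 hs.le
  classical
  let g : unitInterval → Sphere := fun s => if s = 1 then b else (β (ρ s)).pt
  have hg1 : g 1 = b := if_pos rfl
  have hgne : ∀ s, s ≠ 1 → g s = (β (ρ s)).pt := fun s hs => if_neg hs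
  have hgc : Continuous g := by
    refine continuous_iff_continuousAt.2 fun s => ?_
    by_cases hs : s = 1
    · subst hs
      rw [ContinuousAt, hg1]
      intro O hO
      obtain ⟨N, hN⟩ := hDsmall O hO
      rw [mem_map]
      filter_upwards [hρlim N] with s hs
      by_cases hs1 : s = 1
      · rw [Set.mem_preimage, hs1, hg1]
        exact mem_of_mem_nhds hO
      · rw [Set.mem_preimage, hgne s hs1]
        exact hN (hβD' N _ (hs hs1)).1
    · have hs' : s < 1 := lt_of_le_of_ne s.2.2 hs
      have : (fun u => (β (ρ u)).pt) =ᶠ[𝓝 s] g := by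
        filter_upwards [isOpen_ne.mem_nhds hs] with u hu using (hgne u hu).symm
      refine ContinuousAt.congr ?_ this
      exact continuous_pt.continuousAt.comp (hβρ.continuousAt (isOpen_Iio.mem_nhds hs'))
  have hβ0 : β 0 = p := by
    have := hβy 0
    rw [Nat.cast_zero] at this
    rw [this, hy0 0 rfl]
  have h01 : (0 : unitInterval) ≠ 1 := by norm_num
  let γ' : Path p.pt b := ⟨⟨g, hgc⟩, by
    change g 0 = p.pt
    rw [hgne 0 h01]
    simp [ρ, hβ0], hg1⟩
  have hγ'A : ∀ s, γ' s ∉ A := fun s => by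
    change g s ∉ A
    by_cases hs : s = 1
    · rwa [hs, hg1]
    · rw [hgne s hs]
      exact (hβD' 0 _ (by simpa using hρ0 s)).2
  obtain ⟨q, G, hG⟩ := continuesUpTo_one_iff.1 (hc γ' hγ'A)
  have hGβ : (Set.Iio 1).EqOn G (β ∘ ρ) := by
    refine lift_eqOn isPreconnected_Iio G.continuous.continuousOn hβρ (fun s hs => ?_)
      (a := 0) (by norm_num) ?_
    · rw [hG s]
      exact hgne s (ne_of_lt hs)
    · rw [G.source]
      simp [ρ, hβ0]
  obtain ⟨h, hqh, hh⟩ := q.exists_isGermOf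
  have hqb : q.pt = b := by
    have := hG 1
    rwa [G.target, γ'.target] at this
  rw [hqb] at hh
  obtain ⟨N, hN⟩ := hDsmall _ hh.eventually
  have hGh : ∀ᶠ s in 𝓝 (1 : unitInterval), (G s).IsGermOf h := by
    refine (G.continuous.continuousAt (x := 1)).eventually (p := fun q => q.IsGermOf h) ?_
    rw [G.target]
    exact hqh.eventually
  obtain ⟨s, hs1, hsh, hsN⟩ : ∃ s : unitInterval, s < 1 ∧ (G s).IsGermOf h ∧ (N : ℝ) ≤ ρ s := by
    have hne : (𝓝[<] (1 : unitInterval)).NeBot := nhdsLT_neBot_of_exists_lt ⟨0, by norm_num⟩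
    obtain ⟨s, hs, hs1⟩ := (((hGh.and (hρlim N)).filter_mono nhdsWithin_le_nhds).and
      (self_mem_nhdsWithin (s := Set.Iio (1 : unitInterval)))).exists
    exact ⟨s, hs1, hs.1, hs.2 (ne_of_lt hs1)⟩
  -- The representative `h` at `b` is carried back along the new path to the node `y N` and from
  -- there to `Γ (t N)`, all inside the region where `h` is holomorphic.
  have hyN : (y N).IsGermOf h := by
    have hsub : Set.Icc (N : ℝ) (ρ s) ⊆ Set.Ici 0 := fun v hv => N.cast_nonneg.trans hv.1
    rw [← hβy N]
    refine isGermOf_of_isPreconnected isPreconnected_Icc (hβ.mono hsub) (fun v hv => ?_)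
      (Set.right_mem_Icc.2 hsN) ?_ (Set.left_mem_Icc.2 hsN)
    · exact hN (hβD' N v hv.1).1
    · have := hGβ hs1
      rw [Function.comp_apply] at this
      rwa [← this]
  have hΓN : (Γ (t N)).IsGermOf h :=
    isGermOf_of_joinedIn (U := D N) (fun x hx => hN hx) (hyΓ N).symm hyN
  exact hγ1 (continuesUpTo_extend (hΓ _ (ht1 N)) hΓ0
    (fun u hu => hΓpt u (hu.2.trans_lt (ht1 N))) (t N).2.2 (fun u hu => hN (htD N u hu.1)) hΓN)

/-! ### Tuples of germs at a common point -/

/-- Families of germs at a common point of the sphere. -/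
abbrev GermTuple (ι : Type*) : Type _ :=
  {τ : Sphere × (ι → RegularGerm) // ∀ i, (τ.2 i).pt = τ.1}

namespace GermTuple

variable {ι : Type*}

/-- The common base point. -/
def base (τ : GermTuple ι) : Sphere := τ.1.1

/-- The germs of the family. -/
def germ (τ : GermTuple ι) (i : ι) : RegularGerm := τ.1.2 i

theorem germ_pt (τ : GermTuple ι) (i : ι) : (τ.germ i).pt = τ.base := τ.2 i

theorem continuous_base : Continuous (base (ι := ι)) := continuous_fst.comp continuous_subtype_val

theorem continuous_germ (i : ι) : Continuous fun τ : GermTuple ι => τ.germ i :=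
  (continuous_apply i).comp (continuous_snd.comp continuous_subtype_val)

theorem ext {τ τ' : GermTuple ι} (hb : τ.base = τ'.base) (h : ∀ i, τ.germ i = τ'.germ i) :
    τ = τ' := Subtype.ext (Prod.ext hb (funext h))

theorem tendsto_iff {α : Type*} {l : Filter α} {Φ : α → GermTuple ι} {τ : GermTuple ι} :
    Tendsto Φ l (𝓝 τ) ↔ Tendsto (fun a => (Φ a).base) l (𝓝 τ.base) ∧
      ∀ i, Tendsto (fun a => (Φ a).germ i) l (𝓝 (τ.germ i)) := by
  rw [tendsto_subtype_rng, Prod.tendsto_iff, tendsto_pi_nhds]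
  rfl

theorem continuous_mk {α : Type*} [TopologicalSpace α] {b : α → Sphere} {g : α → ι → RegularGerm}
    (hb : Continuous b) (hg : ∀ i, Continuous fun a => g a i) (h : ∀ a i, (g a i).pt = b a) :
    Continuous fun a => (⟨(b a, g a), h a⟩ : GermTuple ι) :=
  Continuous.subtype_mk (hb.prodMk (continuous_pi hg)) _

/-- Finiteness of `ι` provides one neighbourhood on which all the representatives remain valid. This
is why loops can be pushed off a set for finitely many germs at a time. -/
theorem isLocalHomeomorph_base [Finite ι] : IsLocalHomeomorph (base (ι := ι)) := by
  refine isLocalHomeomorph_of_injOn_of_nhds_le continuous_base (fun τ => ?_) fun τ V hV => ?_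
  · choose h hτ hh using fun i => (τ.germ i).exists_isGermOf
    refine ⟨{σ | ∀ i, (σ.germ i).IsGermOf (h i)}, ?_, fun σ hσ ρ hρ hb => ?_⟩
    · exact eventually_all.2 fun i => (continuous_germ i).continuousAt.eventually (hτ i).eventually
    · exact ext hb fun i => (hσ i).ext (hρ i) (by rw [germ_pt, germ_pt, hb])
  · choose h hτ hh using fun i => (τ.germ i).exists_isGermOf
    let s : Sphere → GermTuple ι := fun x => ⟨(x, fun i => ofFun (h i) x), fun i => ofFun_pt _ _⟩
    have hs : Tendsto s (𝓝 τ.base) (𝓝 τ) := by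
      refine tendsto_iff.2 ⟨tendsto_id, fun i => ?_⟩
      have := tendsto_ofFun (hτ i)
      rwa [germ_pt] at this
    filter_upwards [hs.eventually hV] with x hx using ⟨_, hx, rfl⟩

theorem exists_path {a b : Sphere} {γ : Path a b} {τ τ' : GermTuple ι} (hτ : τ.base = a)
    (hτ' : τ'.base = b) (h : ∀ i, ContinuesTo γ (τ.germ i) (τ'.germ i)) :
    ∃ P : Path τ τ', ∀ t, (P t).base = γ t := by
  choose Γ hΓ using h
  refine ⟨⟨⟨fun t => ⟨(γ t, fun i => Γ i t), fun i => hΓ i t⟩,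
    continuous_mk γ.continuous (fun i => (Γ i).continuous) _⟩, ?_, ?_⟩, fun t => rfl⟩
  · exact ext (γ.source.trans hτ.symm) fun i => (Γ i).source
  · exact ext (γ.target.trans hτ'.symm) fun i => (Γ i).target

theorem continuesTo_of_path {τ τ' : GermTuple ι} (P : Path τ τ') (i : ι) :
    ContinuesTo (P.map continuous_base) (τ.germ i) (τ'.germ i) :=
  ⟨P.map (continuous_germ i), fun t => (P t).germ_pt i⟩

end GermTuple

/-! ### Iterated commutators of loops -/

/-- Loops in `C` that are products of `n`-fold iterated commutators. -/
inductive DerivedLoop {Y : Type*} [TopologicalSpace Y] (C : Set Y) {y : Y} :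
    ℕ → Path y y → Prop
  | loop {γ : Path y y} : (∀ t, γ t ∈ C) → DerivedLoop C 0 γ
  | refl (n : ℕ) : y ∈ C → DerivedLoop C n (Path.refl y)
  | trans {n : ℕ} {γ δ : Path y y} : DerivedLoop C n γ → DerivedLoop C n δ →
      DerivedLoop C n (γ.trans δ)
  | symm {n : ℕ} {γ : Path y y} : DerivedLoop C n γ → DerivedLoop C n γ.symm
  | commutator {n : ℕ} {γ δ : Path y y} : DerivedLoop C n γ → DerivedLoop C n δ →
      DerivedLoop C (n + 1) ((γ.trans δ).trans (γ.symm.trans δ.symm))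

theorem Path.trans_mem {Y : Type*} [TopologicalSpace Y] {C : Set Y} {x y z : Y} {γ : Path x y}
    {δ : Path y z} (hγ : ∀ t, γ t ∈ C) (hδ : ∀ t, δ t ∈ C) (t : unitInterval) :
    γ.trans δ t ∈ C := by
  rw [Path.trans_apply]
  split_ifs
  exacts [hγ _, hδ _]

namespace DerivedLoop

variable {Y : Type*} [TopologicalSpace Y] {C C' : Set Y} {y : Y} {n : ℕ} {γ : Path y y}

theorem mem (h : DerivedLoop C n γ) : ∀ t, γ t ∈ C := by
  induction h with
  | loop h => exact h
  | refl n h => exact fun _ => h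
  | trans _ _ h h' => exact Path.trans_mem h h'
  | symm _ h => exact fun t => h _
  | commutator _ _ h h' =>
    exact Path.trans_mem (Path.trans_mem h h') (Path.trans_mem (fun t => h _) fun t => h' _)

theorem mono_set (h : DerivedLoop C n γ) (hC : C ⊆ C') : DerivedLoop C' n γ := by
  induction h with
  | loop h => exact loop fun t => hC (h t)
  | refl n h => exact refl n (hC h)
  | trans _ _ h h' => exact trans h h'
  | symm _ h => exact symm h
  | commutator _ _ h h' => exact commutator h h'

theorem of_succ (h : DerivedLoop C (n + 1) γ) : DerivedLoop C n γ := by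
  generalize hm : n + 1 = m at h
  induction h with
  | loop h => simp at hm
  | refl _ h => exact refl n h
  | trans _ _ h h' => exact trans (h hm) (h' hm)
  | symm _ h => exact symm (h hm)
  | commutator h h' _ _ =>
    obtain rfl : n = _ := Nat.succ.inj hm
    exact trans (trans h h') (trans (symm h) (symm h'))

theorem anti {m : ℕ} (hmn : m ≤ n) (h : DerivedLoop C n γ) : DerivedLoop C m γ := by
  induction hmn with
  | refl => exact h
  | step _ ih => exact ih h.of_succ

end DerivedLoop

/-! ### Monodromy -/

/-- The obstructed path from `q` is preceded by the base points of a path of germs from `p` to `q`;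
continuation along the first half arrives at `q`, so the obstruction is the same. All germs of a
function thus have the same singular points. -/
theorem isSingularPoint_of_joined {p q : RegularGerm} (hpq : Joined p q) {b : Sphere}
    (hb : IsSingularPoint q b) : IsSingularPoint p b := by
  obtain ⟨Δ⟩ := hpq
  obtain ⟨γ, hγ1, hγ⟩ := hb
  set δ := Δ.map continuous_pt with hδ
  refine ⟨δ.trans γ, fun h => hγ1 ?_, fun τ hτ => ?_⟩
  · obtain ⟨r, R, hR⟩ := continuesUpTo_one_iff.1 h
    let u : unitInterval → unitInterval := fun t => ⟨t / 2, by
      constructor <;> linarith [t.2.1, t.2.2]⟩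
    let v : unitInterval → unitInterval := fun t => ⟨(1 + t) / 2, by
      constructor <;> linarith [t.2.1, t.2.2]⟩
    have hu : Continuous u := Continuous.subtype_mk (by fun_prop) _
    have hv : Continuous v := Continuous.subtype_mk (by fun_prop) _
    have hδu : ∀ t, δ.trans γ (u t) = δ t := fun t => by
      rw [Path.trans_apply, dif_pos (show (u t : ℝ) ≤ 1 / 2 by
        simp only [u]; linarith [t.2.2])]
      congr 1
      ext
      simp only [u]
      ring
    have hγv : ∀ t, δ.trans γ (v t) = γ t := fun t => by
      have : v t = ⟨((1 + t) / 2 : ℝ), (v t).2⟩ := rfl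
      rcases t.2.1.eq_or_lt with h0 | h0
      · have h00 : t = 0 := Subtype.ext h0.symm
        have : v t = u 1 := by ext; simp [u, v, h00]
        rw [this, hδu, h00, δ.target, γ.source]
      · rw [Path.trans_apply, dif_neg (show ¬ (v t : ℝ) ≤ 1 / 2 by
          simp only [v]; linarith)]
        congr 1
        ext
        simp only [v]
        ring
    have h1 : Set.univ.EqOn (R ∘ u) Δ := by
      refine lift_eqOn isPreconnected_univ (R.continuous.comp hu).continuousOn
        Δ.continuous.continuousOn (fun t _ => ?_) (Set.mem_univ 0) ?_
      · rw [Function.comp_apply, hR, hδu]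
        rfl
      · have : u 0 = 0 := by ext; simp [u]
        rw [Function.comp_apply, this, R.source, Δ.source]
    have h2 : R (v 0) = q := by
      have : v 0 = u 1 := by ext; simp [u, v]
      rw [this, ← Δ.target]
      exact h1 trivial
    exact ⟨R ∘ v, (R.continuous.comp hv).continuousOn, h2, fun t _ => by
      rw [Function.comp_apply, hR, hγv]⟩
  -- The time on `γ` that corresponds to time `τ` on the concatenation, clamped to 0 during the
  -- first half.
  · set σ : unitInterval := ⟨max (2 * τ - 1) 0, le_max_right _ _, by
      have : (τ : ℝ) < 1 := hτ
      exact max_le (by linarith) zero_le_one⟩ with hσ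
    have hσ1 : σ < 1 := by
      have : (τ : ℝ) < 1 := hτ
      exact Subtype.coe_lt_coe.1
        (show max (2 * (τ : ℝ) - 1) 0 < 1 from max_lt (by linarith) zero_lt_one)
    obtain ⟨G, hG, hG0, hGpt⟩ := hγ σ hσ1
    have hmin : ∀ t : unitInterval, min t σ ∈ Set.Icc 0 σ := fun t =>
      ⟨le_min t.2.1 σ.2.1, min_le_right _ _⟩
    let P : Path q (G σ) := ⟨⟨fun t => G (min t σ), hG.comp_continuous (by fun_prop) hmin⟩, by
      change G (min 0 σ) = q
      rw [min_eq_left (show 0 ≤ σ from σ.2.1), hG0], by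
      change G (min 1 σ) = G σ
      rw [min_eq_right (show σ ≤ 1 from σ.2.2)]⟩
    refine ⟨Δ.trans P, (Δ.trans P).continuous.continuousOn, (Δ.trans P).source, fun t ht => ?_⟩
    rw [Path.trans_apply, Path.trans_apply]
    split_ifs with h
    · rfl
    · change (G (min _ σ)).pt = _
      rw [min_eq_left, hGpt _ ⟨?_, ?_⟩]
      · exact Subtype.coe_le_coe.1 (show (0 : ℝ) ≤ 2 * t - 1 by linarith [not_le.1 h])
      · have : (t : ℝ) ≤ τ := ht.2
        exact Subtype.coe_le_coe.1
          ((show 2 * (t : ℝ) - 1 ≤ 2 * τ - 1 by linarith).trans (le_max_left _ _))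
      · have : (t : ℝ) ≤ τ := ht.2
        exact Subtype.coe_le_coe.1
          ((show 2 * (t : ℝ) - 1 ≤ 2 * τ - 1 by linarith).trans (le_max_left _ _))

namespace MultivaluedFunction

variable {f : MultivaluedFunction}

theorem exists_hasGerm (f : MultivaluedFunction) : ∃ p, f.HasGerm p := Quotient.exists_rep f

theorem HasGerm.joined {p q : RegularGerm} (hp : f.HasGerm p) (hq : f.HasGerm q) : Joined p q :=
  joined_of_generatedBy_eq (hp.trans hq.symm)

theorem HasGerm.of_joined {p q : RegularGerm} (hp : f.HasGerm p) (hpq : Joined p q) :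
    f.HasGerm q := (Quotient.sound hpq.symm : generatedBy q = generatedBy p).trans hp

theorem HasGerm.of_continuesTo {a b : Sphere} {γ : Path a b} {p q : RegularGerm}
    (hp : f.HasGerm p) (h : ContinuesTo γ p q) : f.HasGerm q := h.generatedBy_eq.symm.trans hp

theorem HasGerm.singularSet_eq {p : RegularGerm} (hp : f.HasGerm p) :
    f.singularSet = {b | IsSingularPoint p b} := by
  ext b
  constructor
  · rintro ⟨q, hq, hb⟩
    exact isSingularPoint_of_joined (hp.joined hq) hb
  · exact fun hb => ⟨p, hp, hb⟩

theorem IsSFunction.countable_singularSet (hf : f.IsSFunction) : f.singularSet.Countable := by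
  obtain ⟨p, hp⟩ := f.exists_hasGerm
  rw [hp.singularSet_eq]
  exact hf p hp

theorem HasGerm.exists_continuesTo {p : RegularGerm} (hp : f.HasGerm p) {a b : Sphere}
    (γ : Path a b) (hpa : p.pt = a) (hγ : ∀ t, γ t ∉ f.singularSet) :
    ∃ q, f.HasGerm q ∧ ContinuesTo γ p q := by
  subst hpa
  obtain ⟨q, hq⟩ := continuesUpTo_one_iff.1
    (continuesUpTo_one_of_forall_not_isSingularPoint γ fun t ht => hγ t ⟨p, hp, ht⟩)
  exact ⟨q, hp.of_continuesTo hq, hq⟩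

theorem exists_isInducedBy {x₀ : Sphere} (γ : Path x₀ x₀) (hγ : ∀ t, γ t ∉ f.singularSet) :
    ∃ σ : Equiv.Perm (f.Fiber x₀), f.IsInducedBy γ σ := by
  choose F hF using fun y : f.Fiber x₀ => y.2.1.exists_continuesTo γ y.2.2 hγ
  choose G hG using fun y : f.Fiber x₀ => y.2.1.exists_continuesTo γ.symm y.2.2 fun t => hγ _
  exact ⟨⟨fun y => ⟨F y, (hF y).1, (hF y).2.pt_eq_right⟩,
    fun y => ⟨G y, (hG y).1, (hG y).2.pt_eq_right⟩,
    fun y => Subtype.ext ((hG _).2.unique (hF y).2.symm),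
    fun y => Subtype.ext ((hF _).2.unique (by simpa using (hG y).2.symm))⟩, fun y => (hF y).2⟩

theorem IsInducedBy.trans {x₀ : Sphere} {γ δ : Path x₀ x₀} {σ τ : Equiv.Perm (f.Fiber x₀)}
    (h : f.IsInducedBy γ σ) (h' : f.IsInducedBy δ τ) : f.IsInducedBy (γ.trans δ) (τ * σ) :=
  fun y => (h y).trans (h' (σ y))

theorem IsInducedBy.symm {x₀ : Sphere} {γ : Path x₀ x₀} {σ : Equiv.Perm (f.Fiber x₀)}
    (h : f.IsInducedBy γ σ) : f.IsInducedBy γ.symm σ⁻¹ := fun y => by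
  have := h (σ⁻¹ y)
  rw [show σ (σ⁻¹ y) = y from σ.apply_symm_apply y] at this
  exact this.symm

theorem exists_mem_derivedSeries {x₀ : Sphere} (hx₀ : x₀ ∉ f.singularSet) {n : ℕ}
    {γ : Path x₀ x₀} (hγ : DerivedLoop f.singularSetᶜ n γ) :
    ∃ σ ∈ derivedSeries (f.monodromyGroup x₀ hx₀) n, f.IsInducedBy γ σ.1 := by
  induction hγ with
  | @loop γ h =>
    obtain ⟨σ, hσ⟩ := exists_isInducedBy γ h
    exact ⟨⟨σ, γ, h, hσ⟩, trivial, hσ⟩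
  | refl n h => exact ⟨1, one_mem _, fun y => ContinuesTo.refl y.2.2⟩
  | trans _ _ h h' =>
    obtain ⟨σ, hσ, hσ'⟩ := h
    obtain ⟨τ, hτ, hτ'⟩ := h'
    exact ⟨τ * σ, mul_mem hτ hσ, hσ'.trans hτ'⟩
  | symm _ h =>
    obtain ⟨σ, hσ, hσ'⟩ := h
    exact ⟨σ⁻¹, inv_mem hσ, hσ'.symm⟩
  | commutator _ _ h h' =>
    obtain ⟨σ, hσ, hσ'⟩ := h
    obtain ⟨τ, hτ, hτ'⟩ := h'
    -- Concatenation of loops induces products in reverse order, so the commutator loop induces `τ⁻¹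
    -- * σ⁻¹ * (τ * σ)`.
    refine ⟨⁅τ⁻¹, σ⁻¹⁆, Subgroup.commutator_mem_commutator (inv_mem hτ) (inv_mem hσ), ?_⟩
    have := (hσ'.trans hτ').trans (hσ'.symm.trans hτ'.symm)
    convert! this using 1

/-- Continuation along the loop `γ` at `x₀`, transported along `δ`, sends `y` to `y'`. -/
def ActsVia {x₁ x₀ : Sphere} (δ : Path x₁ x₀) (γ : Path x₀ x₀) (y y' : RegularGerm) : Prop :=
  ∃ z z', ContinuesTo δ y z ∧ ContinuesTo δ y' z' ∧ ContinuesTo γ z z'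

theorem ActsVia.trans {x₁ x₀ : Sphere} {δ : Path x₁ x₀} {γ γ' : Path x₀ x₀} {y y' y'' : RegularGerm}
    (h : ActsVia δ γ y y') (h' : ActsVia δ γ' y' y'') : ActsVia δ (γ.trans γ') y y'' := by
  obtain ⟨z, z', h1, h2, h3⟩ := h
  obtain ⟨w, w', h4, h5, h6⟩ := h'
  obtain rfl := h2.unique h4
  exact ⟨z, w', h1, h5, h3.trans h6⟩

theorem ActsVia.symm {x₁ x₀ : Sphere} {δ : Path x₁ x₀} {γ : Path x₀ x₀} {y y' : RegularGerm}
    (h : ActsVia δ γ y y') : ActsVia δ γ.symm y' y := by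
  obtain ⟨z, z', h1, h2, h3⟩ := h
  exact ⟨z', z, h2, h1, h3.symm⟩

/-- Loops may be pushed off a countable set without changing their action on finitely many
germs. -/
theorem exists_derivedLoop_of_mem_derivedSeries {A : Set Sphere} (hA : A.Countable)
    {x₀ x₁ : Sphere} (hx₁ : x₁ ∉ f.singularSet) (hx₀ : x₀ ∉ A) (δ : Path x₁ x₀)
    (hδ : ∀ t, δ t ∉ f.singularSet) {n : ℕ} {σ : f.monodromyGroup x₁ hx₁}
    (hσ : σ ∈ derivedSeries (f.monodromyGroup x₁ hx₁) n) {S : Set (f.Fiber x₁)} (hS : S.Finite) :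
    ∃ γ : Path x₀ x₀, DerivedLoop Aᶜ n γ ∧ ∀ y ∈ S, ActsVia δ γ y.1 (σ.1 y).1 := by
  have htr : ∀ y : f.Fiber x₁, ∃ z, ContinuesTo δ y.1 z := fun y => by
    obtain ⟨z, -, hz⟩ := y.2.1.exists_continuesTo δ y.2.2 hδ
    exact ⟨z, hz⟩
  induction n generalizing σ S with
  | zero =>
    obtain ⟨σ, c, hc, hσc⟩ := σ
    choose z hz using htr
    have := hS.to_subtype
    -- Back along `δ`, around `c` and forth along `δ` is a path of tuples from `τ` to `τ'`; pushing
    -- that path off `A` handles all germs of `S` with one loop.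
    let τ : GermTuple S := ⟨(x₀, fun y => z y), fun y => (hz y).pt_eq_right⟩
    let τ' : GermTuple S := ⟨(x₀, fun y => z (σ y)), fun y => (hz _).pt_eq_right⟩
    obtain ⟨P, -⟩ := GermTuple.exists_path (γ := (δ.symm.trans c).trans δ) (τ := τ) (τ' := τ')
      rfl rfl fun y => ((hz y).symm.trans (hσc y)).trans (hz (σ y))
    obtain ⟨Q, hQ⟩ := GermTuple.isLocalHomeomorph_base.joinedIn_notMem hA isOpen_univ
      (joinedIn_univ.2 ⟨P⟩) hx₀ hx₀
    exact ⟨Q.map GermTuple.continuous_base, .loop fun t => (hQ t).2, fun y hy =>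
      ⟨z y, z (σ y), hz y, hz (σ y), GermTuple.continuesTo_of_path Q ⟨y, hy⟩⟩⟩
  | succ n ih =>
    rw [derivedSeries_succ, Subgroup.commutator_def] at hσ
    induction hσ using Subgroup.closure_induction generalizing S with
    | mem σ hσ =>
      obtain ⟨a, ha, b, hb, rfl⟩ := hσ
      -- The loops `β` and `α` realize `b⁻¹` and `a⁻¹`, because the first loop run applies the
      -- rightmost factor. Reversed loops are controlled by where their traversal ends, so the
      -- finite sets contain the intermediate and final images of `S`.
      obtain ⟨α, hα, hαS⟩ := ih (inv_mem ha)
        ((hS.image fun y => b.1⁻¹ y).union (hS.image fun y => (a * b * a⁻¹ * b⁻¹).1 y))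
      obtain ⟨β, hβ, hβS⟩ := ih (inv_mem hb)
        (hS.union (hS.image fun y => (b * a⁻¹ * b⁻¹).1 y))
      refine ⟨_, .commutator hβ hα, fun y hy => ?_⟩
      have hinv : ∀ (e : Equiv.Perm (f.Fiber x₁)) (u), e⁻¹ (e u) = u :=
        fun e u => e.symm_apply_apply u
      have h1 := hβS y (Or.inl hy)
      have h2 := hαS (b.1⁻¹ y) (Or.inl ⟨y, hy, rfl⟩)
      have h3 := hβS _ (Or.inr ⟨y, hy, rfl⟩)
      have h4 := hαS _ (Or.inr ⟨y, hy, rfl⟩)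
      simp only [InvMemClass.coe_inv, MulMemClass.coe_mul, Equiv.Perm.mul_apply,
        hinv] at h1 h2 h3 h4
      have h5 := (h1.trans h2).trans (h3.symm.trans h4.symm)
      simpa only [commutatorElement_def, InvMemClass.coe_inv, MulMemClass.coe_mul,
        Equiv.Perm.mul_apply] using h5
    | one =>
      refine ⟨Path.refl x₀, .refl _ hx₀, fun y hy => ?_⟩
      obtain ⟨z, hz⟩ := htr y
      exact ⟨z, z, hz, hz, ContinuesTo.refl hz.pt_eq_right⟩
    | mul σ τ _ _ hσ hτ =>
      obtain ⟨β, hβ, hβS⟩ := hτ hS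
      obtain ⟨α, hα, hαS⟩ := hσ (hS.image fun y => τ.1 y)
      exact ⟨_, .trans hβ hα, fun y hy => (hβS y hy).trans (hαS _ ⟨y, hy, rfl⟩)⟩
    | inv σ _ hσ =>
      obtain ⟨α, hα, hαS⟩ := hσ (hS.image fun y => σ.1⁻¹ y)
      refine ⟨_, .symm hα, fun y hy => ?_⟩
      have := hαS _ ⟨y, hy, rfl⟩
      rw [show σ.1 (σ.1⁻¹ y) = y from σ.1.apply_symm_apply y] at this
      exact this.symm

theorem exists_notMem_of_countable {A : Set Sphere} (hA : A.Countable) : ∃ x, x ∉ A :=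
  (isLocalHomeomorph_id_sphere.frequently_notMem hA OnePoint.infty).exists

/-- The derived length is read off at one base point. At any other base point the permutation
induced by the loop is realized, on one chosen germ, by an iterated commutator at the first base
point, and there it acts trivially. Thus `n` is uniform in the base point. -/
theorem exists_derivedLoop_trivial (hf : f ∈ SolvableSFunctions) :
    ∃ n, ∀ (x₀ : Sphere) (γ : Path x₀ x₀), DerivedLoop f.singularSetᶜ n γ →
      ∀ p, f.HasGerm p → p.pt = x₀ → ContinuesTo γ p p := by
  have hc := hf.1.countable_singularSet
  obtain ⟨x₀, hx₀⟩ := exists_notMem_of_countable hc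
  obtain ⟨⟨n, hn⟩⟩ := hf.2 x₀ hx₀
  refine ⟨n, fun x₁ γ hγ p hp hpx => ?_⟩
  have hx₁ : x₁ ∉ f.singularSet := by simpa using hγ.mem 0
  obtain ⟨δ, hδ⟩ := exists_path_notMem hc hx₁ hx₀
  obtain ⟨σ, hσ, hσγ⟩ := exists_mem_derivedSeries hx₁ hγ
  obtain ⟨γ', hγ', hact⟩ := exists_derivedLoop_of_mem_derivedSeries hc hx₁ hx₀ δ hδ hσ
    (Set.finite_singleton (⟨p, hp, hpx⟩ : f.Fiber x₁))
  obtain ⟨z, z', h1, h2, h3⟩ := hact _ rfl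
  obtain ⟨τ, hτ, hτγ⟩ := exists_mem_derivedSeries hx₀ hγ'
  rw [hn, Subgroup.mem_bot] at hτ
  subst hτ
  have h4 := hτγ ⟨z, hp.of_continuesTo h1, h1.pt_eq_right⟩
  obtain rfl : z' = z := h3.unique h4
  have h5 := hσγ ⟨p, hp, hpx⟩
  rwa [← h1.symm.unique h2.symm] at h5

/-- A criterion for membership in the class of `𝒮`-functions with solvable monodromy group. -/
theorem mem_solvableSFunctions_of_derivedLoop {A : Set Sphere} (hA : A.Countable)
    {q : RegularGerm} (hq : q.pt ∉ A) (hc : ContinuableOff A q) (n : ℕ)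
    (h : ∀ γ : Path q.pt q.pt, DerivedLoop Aᶜ n γ → ∀ r, JoinedIn {r | r.pt ∉ A} q r →
      r.pt = q.pt → ContinuesTo γ r r) : generatedBy q ∈ SolvableSFunctions := by
  have hgq : (generatedBy q).HasGerm q := rfl
  have hsub : (generatedBy q).singularSet ⊆ A := by
    rw [hgq.singularSet_eq]
    exact fun b hb => hb.mem_of_continuableOff hA hq hc
  have hcount := hA.mono hsub
  refine ⟨fun p hp => hp.singularSet_eq ▸ hcount, fun x₁ hx₁ => ⟨n, ?_⟩⟩
  rw [Subgroup.eq_bot_iff_forall]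
  intro σ hσ
  obtain ⟨δ, hδ⟩ := exists_path_notMem hcount hx₁ (fun hx => hq (hsub hx))
  refine Subtype.ext (Equiv.ext fun y => Subtype.ext ?_)
  obtain ⟨γ, hγ, hact⟩ := exists_derivedLoop_of_mem_derivedSeries hA hx₁ hq δ hδ hσ
    (Set.finite_singleton y)
  obtain ⟨z, z', h1, h2, h3⟩ := hact y rfl
  -- The hypothesis speaks only of germs reached off `A`; pushing paths off `A` shows that `z` is
  -- such a germ.
  have hz : JoinedIn {r | r.pt ∉ A} q z :=
    (isLocalHomeomorph_pt.joinedIn_notMem hA isOpen_univ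
      (joinedIn_univ.2 (hgq.joined (y.2.1.of_continuesTo h1))) hq
      (by rwa [h1.pt_eq_right])).mono Set.inter_subset_right
  obtain rfl := h3.unique (h γ hγ z hz h1.pt_eq_right)
  exact h2.symm.unique h1.symm

end MultivaluedFunction

/-! ### Operations that are continuous on germs -/

namespace RegularGerm

theorem IsGermOf.eventually_generatedBy {p : RegularGerm} {h : Sphere → ℂ} (hp : p.IsGermOf h) :
    ∀ᶠ x in 𝓝 p.pt, (ofFun h x).IsGermOf h ∧ generatedBy (ofFun h x) = generatedBy p := by
  filter_upwards [hp.holomorphicAt.eventually,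
    (tendsto_ofFun hp).eventually (isLocalHomeomorph_pt.eventually_joinedIn p univ_mem)] with x hx hj
  exact ⟨isGermOf_ofFun hx, Quotient.sound hj.joined.symm⟩

end RegularGerm

theorem exists_notMem_of_eventually {A : Set Sphere} (hA : A.Countable) {x : Sphere}
    {P : Sphere → Prop} (h : ∀ᶠ y in 𝓝 x, P y) : ∃ y, y ∉ A ∧ P y :=
  ((isLocalHomeomorph_id_sphere.frequently_notMem hA x).and_eventually h).exists

theorem joinedIn_generatedBy {A : Set Sphere} {q r : RegularGerm}
    (h : JoinedIn {r | r.pt ∉ A} q r) :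
    ∃ δ : Path q.pt r.pt, (∀ t, δ t ∉ A) ∧ ContinuesTo δ q r := by
  obtain ⟨R, hR⟩ := h
  exact ⟨R.map continuous_pt, hR, R, fun _ => rfl⟩

/-- Applying `Φ` to a continuation of the argument tuple continues the result, so a loop that fixes
every argument fixes the result. Finiteness of `ι` bounds the depths of the arguments by a common
one. -/
theorem generatedBy_mem_of_continuousAt {ι : Type*} [Finite ι] {f : ι → MultivaluedFunction}
    (hf : ∀ i, f i ∈ SolvableSFunctions) {A : Set Sphere} (hA : A.Countable)
    (hfA : ∀ i, (f i).singularSet ⊆ A) {τ₀ : GermTuple ι} (hτ₀ : ∀ i, (f i).HasGerm (τ₀.germ i))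
    (hτ₀A : τ₀.base ∉ A) {Φ : GermTuple ι → RegularGerm}
    (hΦ : ∀ τ, Joined τ₀ τ → τ.base ∉ A → ContinuousAt Φ τ ∧ (Φ τ).pt = τ.base) :
    generatedBy (Φ τ₀) ∈ SolvableSFunctions := by
  have hpush : ∀ {a b : Sphere} (γ : Path a b), (∀ t, γ t ∉ A) → ∀ τ τ' : GermTuple ι,
      Joined τ₀ τ → τ.base = a → τ'.base = b →
      (∀ i, ContinuesTo γ (τ.germ i) (τ'.germ i)) → ContinuesTo γ (Φ τ) (Φ τ') := by
    intro a b γ hγ τ τ' hτ ha hb h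
    obtain ⟨P, hP⟩ := GermTuple.exists_path ha hb h
    have hj : ∀ t, Joined τ₀ (P t) := fun t => hτ.trans ⟨(P.truncateOfLE (t₀ := 0) (t₁ := t)
      t.2.1).cast (by simp) (by simp)⟩
    have hΦP : ∀ t, ContinuousAt Φ (P t) ∧ (Φ (P t)).pt = (P t).base := fun t =>
      hΦ _ (hj t) (by rw [hP]; exact hγ t)
    have := continuesTo_of_continuous γ (G := Φ ∘ P) (continuous_iff_continuousAt.2 fun t =>
      (hΦP t).1.comp P.continuous.continuousAt) fun t => (hΦP t).2.trans (hP t)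
    simpa using this
  have hlift : ∀ {a b : Sphere} (γ : Path a b), (∀ t, γ t ∉ A) → ∀ τ : GermTuple ι,
      Joined τ₀ τ → τ.base = a → ∃ τ' : GermTuple ι, Joined τ₀ τ' ∧ τ'.base = b ∧
        ContinuesTo γ (Φ τ) (Φ τ') := by
    intro a b γ hγ τ hτ ha
    have hg : ∀ i, (f i).HasGerm (τ.germ i) := fun i =>
      (hτ₀ i).of_joined (hτ.map (GermTuple.continuous_germ i))
    choose z hz hγz using fun i => (hg i).exists_continuesTo γ ((τ.germ_pt i).trans ha)
      fun t ht => hγ t (hfA i ht)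
    let τ' : GermTuple ι := ⟨(b, z), fun i => (hγz i).pt_eq_right⟩
    obtain ⟨P, -⟩ := GermTuple.exists_path (τ := τ) (τ' := τ') ha rfl hγz
    exact ⟨τ', hτ.trans ⟨P⟩, rfl, hpush γ hγ τ τ' hτ ha rfl hγz⟩
  have h0 := (hΦ τ₀ (Joined.refl _) hτ₀A).2
  choose n hn using fun i => exists_derivedLoop_trivial (hf i)
  obtain ⟨N, hN⟩ := (Set.finite_range n).bddAbove
  refine mem_solvableSFunctions_of_derivedLoop hA (h0 ▸ hτ₀A) (fun b γ hγ => ?_) N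
    fun γ hγ r hr hrpt => ?_
  · obtain ⟨τ', -, -, h⟩ := hlift γ hγ τ₀ (Joined.refl _) h0.symm
    exact continuesUpTo_one_iff.2 ⟨_, h⟩
  · obtain ⟨δ, hδ, hqr⟩ := joinedIn_generatedBy hr
    obtain ⟨τ', hτ', hb, h⟩ := hlift δ hδ τ₀ (Joined.refl _) h0.symm
    obtain rfl := h.unique hqr
    refine hpush γ hγ.mem τ' τ' hτ' (hb.trans hrpt) (hb.trans hrpt) fun i => ?_
    exact hn i _ γ ((hγ.anti (hN ⟨i, rfl⟩)).mono_set (Set.compl_subset_compl.2 (hfA i))) _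
      ((hτ₀ i).of_joined (hτ'.map (GermTuple.continuous_germ i)))
      ((τ'.germ_pt i).trans (hb.trans hrpt))

/-! ### Differentiation -/

theorem exists_coe_eq {x : Sphere} (hx : x ≠ OnePoint.infty) : ∃ z : ℂ, x = z := by
  obtain ⟨z, hz⟩ := OnePoint.ne_infty_iff_exists.1 hx
  exact ⟨z, hz.symm⟩

theorem sphereDeriv_coe (h : Sphere → ℂ) (z : ℂ) :
    sphereDeriv h z = deriv (fun w : ℂ => h (w : Sphere)) z := rfl

theorem HolomorphicAt.sphereDeriv {h : Sphere → ℂ} {x : Sphere} (hx : x ≠ OnePoint.infty)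
    (hh : HolomorphicAt h x) : HolomorphicAt (sphereDeriv h) x := by
  obtain ⟨z, rfl⟩ := exists_coe_eq hx
  exact AnalyticAt.deriv hh

theorem sphereDeriv_congr {h k : Sphere → ℂ} {x : Sphere} (hx : x ≠ OnePoint.infty)
    (hhk : h =ᶠ[𝓝 x] k) : sphereDeriv h =ᶠ[𝓝 x] sphereDeriv k := by
  obtain ⟨z, rfl⟩ := exists_coe_eq hx
  refine eventually_nhds_coe.2 ?_
  filter_upwards [(eventually_nhds_coe.1 hhk).eventually_nhds] with w hw
  exact EventuallyEq.deriv_eq hw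

namespace RegularGerm

/-- A function representing the germ. -/
def rep (p : RegularGerm) : Sphere → ℂ := p.exists_isGermOf.choose

theorem isGermOf_rep (p : RegularGerm) : p.IsGermOf p.rep := p.exists_isGermOf.choose_spec.1

/-- The derivative of a germ at a finite point. -/
def derivGerm (p : RegularGerm) : RegularGerm := ofFun (sphereDeriv p.rep) p.pt

@[simp] theorem derivGerm_pt (p : RegularGerm) : p.derivGerm.pt = p.pt := ofFun_pt _ _

theorem IsGermOf.derivGerm {p : RegularGerm} {h : Sphere → ℂ} (hp : p.IsGermOf h)
    (hpt : p.pt ≠ OnePoint.infty) : p.derivGerm.IsGermOf (sphereDeriv h) := by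
  refine IsGermOf.congr (isGermOf_ofFun (p.isGermOf_rep.holomorphicAt.sphereDeriv hpt)) ?_
  rw [derivGerm_pt]
  exact sphereDeriv_congr hpt (p.isGermOf_rep.eventuallyEq hp)

theorem continuousAt_derivGerm {p : RegularGerm} (hpt : p.pt ≠ OnePoint.infty) :
    ContinuousAt RegularGerm.derivGerm p := by
  refine continuousAt_of_isGermOf (k := sphereDeriv p.rep) ?_ ?_
  · simpa only [derivGerm_pt] using continuous_pt.continuousAt
  · have : ∀ᶠ q : RegularGerm in 𝓝 p, q.pt ≠ OnePoint.infty :=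
      continuous_pt.continuousAt.eventually (isOpen_ne.mem_nhds hpt)
    filter_upwards [p.isGermOf_rep.eventually, this] with q hq hqpt
    exact hq.derivGerm hqpt

end RegularGerm

/-- Infinity joins the forbidden set so that differentiation and integration are carried out at
finite points only. -/
theorem countable_singularSet_union_infty {f : MultivaluedFunction} (hf : f ∈ SolvableSFunctions) :
    (f.singularSet ∪ {OnePoint.infty}).Countable :=
  hf.1.countable_singularSet.union (Set.countable_singleton _)

/-- The relation of being a derivative may be tested at generic finite germs. -/
theorem IsDerivativeOf.exists_derivGerm {φ f : MultivaluedFunction} (h : IsDerivativeOf φ f)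
    {A : Set Sphere} (hA : A.Countable) (hAinf : OnePoint.infty ∈ A) :
    ∃ p, f.HasGerm p ∧ φ.HasGerm p.derivGerm ∧ p.pt ∉ A := by
  obtain ⟨q, p, hq, hp, hpt, h, hph, hqh⟩ := h
  obtain ⟨x, hxA, ⟨h1, h2⟩, h3, h4⟩ := exists_notMem_of_eventually hA
    (hph.eventually_generatedBy.and (hpt ▸ hqh.eventually_generatedBy))
  refine ⟨ofFun h x, h2.trans hp, ?_, by simpa using hxA⟩
  have : (ofFun h x).derivGerm = ofFun (sphereDeriv h) x := by
    refine (h1.derivGerm ?_).ext h3 (by simp)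
    rw [ofFun_pt]
    exact fun hx => hxA (hx ▸ hAinf)
  rw [this]
  exact h4.trans hq

theorem stableUnderDifferentiation_solvableSFunctions :
    StableUnderDifferentiation SolvableSFunctions := by
  intro f hf φ hφ
  have hA := countable_singularSet_union_infty hf
  obtain ⟨p, hp, hφp, hpA⟩ := hφ.exists_derivGerm hA (Or.inr rfl)
  rw [← show generatedBy p.derivGerm = φ from hφp]
  let τ₀ : GermTuple Unit := ⟨(p.pt, fun _ => p), fun _ => rfl⟩
  refine generatedBy_mem_of_continuousAt (τ₀ := τ₀) (f := fun _ : Unit => f) (fun _ => hf) hA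
    (fun _ => Set.subset_union_left) (fun _ => hp) hpA (Φ := fun τ => (τ.germ ()).derivGerm)
    fun τ _ hτ => ⟨?_, ?_⟩
  · refine ContinuousAt.comp (g := RegularGerm.derivGerm) (continuousAt_derivGerm fun h => hτ ?_)
      (GermTuple.continuous_germ ()).continuousAt
    rw [← τ.germ_pt (), h]
    exact Or.inr rfl
  · rw [derivGerm_pt, τ.germ_pt]

/-! ### Integration -/

theorem HolomorphicAt.exists_primitive {k : Sphere → ℂ} {x : Sphere} (hx : x ≠ OnePoint.infty)
    (hk : HolomorphicAt k x) : ∃ (U : Set Sphere) (H : Sphere → ℂ), IsOpen U ∧ x ∈ U ∧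
      OnePoint.infty ∉ U ∧ ∀ y ∈ U, HolomorphicAt H y ∧ _root_.sphereDeriv H =ᶠ[𝓝 y] k := by
  obtain ⟨z, rfl⟩ := exists_coe_eq hx
  obtain ⟨r, hr, hball⟩ := Metric.eventually_nhds_iff_ball.1 (eventually_nhds_coe.1 hk.eventually)
  have hd : DifferentiableOn ℂ (fun w : ℂ => k w) (Metric.ball z r) := fun w hw =>
    (show AnalyticAt ℂ (fun w : ℂ => k w) w from hball w hw).differentiableAt.differentiableWithinAt
  obtain ⟨g, hg⟩ := hd.isExactOn_ball
  refine ⟨(↑) '' Metric.ball z r, fun y => y.elim 0 g, OnePoint.isOpen_image_coe.2 Metric.isOpen_ball,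
    ⟨z, Metric.mem_ball_self hr, rfl⟩, OnePoint.infty_notMem_image_coe, ?_⟩
  rintro _ ⟨w, hw, rfl⟩
  have hgd : DifferentiableOn ℂ g (Metric.ball z r) := fun v hv =>
    (hg v hv).differentiableAt.differentiableWithinAt
  refine ⟨hgd.analyticAt (Metric.isOpen_ball.mem_nhds hw), eventually_nhds_coe.2 ?_⟩
  filter_upwards [Metric.isOpen_ball.mem_nhds hw] with v hv using (hg v hv).deriv

namespace RegularGerm

/-- The sum of a germ and a constant. -/
def addConst (c : ℂ) (p : RegularGerm) : RegularGerm := ofFun (fun x => p.rep x + c) p.pt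

@[simp] theorem addConst_pt (c : ℂ) (p : RegularGerm) : (p.addConst c).pt = p.pt := ofFun_pt _ _

theorem _root_.HolomorphicAt.add_const {h : Sphere → ℂ} {x : Sphere} (hh : HolomorphicAt h x)
    (c : ℂ) : HolomorphicAt (fun y => h y + c) x := by
  obtain ⟨e, w, he, rfl⟩ := exists_isSphereChart x
  rw [he.holomorphicAt_iff] at hh ⊢
  exact hh.add analyticAt_const

theorem IsGermOf.addConst {p : RegularGerm} {h : Sphere → ℂ} (hp : p.IsGermOf h) (c : ℂ) :
    (p.addConst c).IsGermOf (fun x => h x + c) := by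
  refine IsGermOf.congr (isGermOf_ofFun (p.isGermOf_rep.holomorphicAt.add_const c)) ?_
  rw [addConst_pt]
  filter_upwards [p.isGermOf_rep.eventuallyEq hp] with x hx
  rw [hx]

theorem continuous_addConst (c : ℂ) : Continuous (RegularGerm.addConst c) := by
  refine continuous_iff_continuousAt.2 fun p => continuousAt_of_isGermOf ?_ ?_
      (k := fun x => p.rep x + c)
  · simpa only [addConst_pt] using continuous_pt.continuousAt
  · filter_upwards [p.isGermOf_rep.eventually] with q hq using hq.addConst c

theorem addConst_addConst (c d : ℂ) (p : RegularGerm) :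
    (p.addConst c).addConst d = p.addConst (c + d) := by
  refine ((p.isGermOf_rep.addConst c).addConst d).ext
    ((p.isGermOf_rep.addConst (c + d)).congr ?_) (by simp)
  exact Eventually.of_forall fun x => (add_assoc _ _ _).symm

theorem exists_eq_addConst {p q : RegularGerm} (hpq : p.pt = q.pt) (hpt : p.pt ≠ OnePoint.infty)
    (h : p.derivGerm = q.derivGerm) : ∃ c, q = p.addConst c := by
  obtain ⟨z, hz⟩ := exists_coe_eq hpt
  have hp := p.isGermOf_rep.holomorphicAt
  have hq := q.isGermOf_rep.holomorphicAt
  rw [← hpq] at hq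
  rw [hz, holomorphicAt_coe] at hp hq
  have hd : sphereDeriv p.rep =ᶠ[𝓝 p.pt] sphereDeriv q.rep := by
    have h1 := q.isGermOf_rep.derivGerm (hpq ▸ hpt)
    rw [← h] at h1
    simpa using (p.isGermOf_rep.derivGerm hpt).eventuallyEq h1
  rw [hz] at hd
  obtain ⟨r, hr, hball⟩ := Metric.eventually_nhds_iff_ball.1
    ((eventually_nhds_coe.1 hd).and (hp.eventually_analyticAt.and hq.eventually_analyticAt))
  set u : ℂ → ℂ := fun w => q.rep w - p.rep w
  have hu : ∀ w ∈ Metric.ball z r, HasDerivAt u 0 w := fun w hw => by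
    obtain ⟨h1, h2, h3⟩ := hball w hw
    have := h3.differentiableAt.hasDerivAt.sub h2.differentiableAt.hasDerivAt
    rw [sphereDeriv_coe, sphereDeriv_coe] at h1
    rwa [h1, sub_self] at this
  have hconst : ∀ w ∈ Metric.ball z r, u w = u z := fun w hw =>
    (convex_ball z r).is_const_of_fderivWithin_eq_zero (𝕜 := ℂ)
      (fun v hv => (hu v hv).differentiableAt.differentiableWithinAt)
      (fun v hv => by
        rw [fderivWithin_of_isOpen Metric.isOpen_ball hv]
        ext
        simp [(hu v hv).hasFDerivAt.fderiv]) hw (Metric.mem_ball_self hr)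
  refine ⟨u z, q.isGermOf_rep.ext ((p.isGermOf_rep.addConst (u z)).congr ?_) (by simp [hpq])⟩
  rw [addConst_pt, hz]
  refine eventually_nhds_coe.2 ?_
  filter_upwards [Metric.ball_mem_nhds z hr] with w hw
  rw [← hconst w hw]
  simp [u]

end RegularGerm

theorem ContinuesTo.addConst {a b : Sphere} {γ : Path a b} {p q : RegularGerm}
    (h : ContinuesTo γ p q) (c : ℂ) : ContinuesTo γ (p.addConst c) (q.addConst c) := by
  obtain ⟨Γ, hΓ⟩ := h
  exact ⟨Γ.map (continuous_addConst c), fun t => (addConst_pt _ _).trans (hΓ t)⟩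

theorem ContinuesTo.derivGerm {a b : Sphere} {γ : Path a b} {p q : RegularGerm}
    (h : ContinuesTo γ p q) (hγ : ∀ t, γ t ≠ OnePoint.infty) :
    ContinuesTo γ p.derivGerm q.derivGerm := by
  obtain ⟨Γ, hΓ⟩ := h
  have := continuesTo_of_continuous γ (G := fun t => (Γ t).derivGerm)
    (continuous_iff_continuousAt.2 fun t => ContinuousAt.comp (g := RegularGerm.derivGerm)
      (continuousAt_derivGerm (by rw [hΓ]; exact hγ t)) Γ.continuous.continuousAt)
    fun t => (derivGerm_pt _).trans (hΓ t)
  simpa using this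

/-- Primitives continue along every path along which the derivative does. -/
theorem ContinuesTo.exists_of_derivGerm {a b : Sphere} {γ : Path a b} {p q : RegularGerm}
    (h : ContinuesTo γ p.derivGerm q) (hγ : ∀ t, γ t ≠ OnePoint.infty) :
    ∃ r, ContinuesTo γ p r ∧ r.derivGerm = q := by
  have hpa : p.pt = a := by simpa using h.pt_eq_left
  suffices ContinuesUpTo γ p 1 by
    obtain ⟨r, hr⟩ := continuesUpTo_one_iff.1 this
    exact ⟨r, hr, (hr.derivGerm hγ).unique h⟩
  obtain ⟨Γ, hΓ⟩ := h
  refine continuesUpTo_one_of_closed hpa fun τ hτ hσ => ?_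
  obtain ⟨k, hk, hkh⟩ := (Γ τ).exists_isGermOf
  rw [hΓ] at hkh
  obtain ⟨U, H, hU, hτU, hUinf, hH⟩ := hkh.exists_primitive (hγ τ)
  have hev : ∀ᶠ s in 𝓝 τ, γ s ∈ U ∧ (Γ s).IsGermOf k :=
    (γ.continuous.continuousAt.eventually (hU.mem_nhds hτU)).and
      (Γ.continuous.continuousAt.eventually (p := fun q => q.IsGermOf k) hk.eventually)
  obtain ⟨t₀, ht₀, hts⟩ := exists_Ioc_subset_of_mem_nhds hev ⟨0, hτ⟩
  obtain ⟨t, ht₀t, htτ⟩ := exists_between ht₀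
  have htU : ∀ s ∈ Set.Icc t τ, γ s ∈ U := fun s hs => (hts ⟨ht₀t.trans_le hs.1, hs.2⟩).1
  obtain ⟨G, hG, hG0, hGpt⟩ := hσ t htτ
  have ht : t ∈ Set.Icc 0 t := ⟨t.2.1, le_rfl⟩
  have htt : t ∈ Set.Icc t τ := ⟨le_rfl, htτ.le⟩
  have hGd : (Set.Icc 0 t).EqOn (fun s => (G s).derivGerm) Γ := by
    refine lift_eqOn (unitInterval.isPathConnected_Icc t.2.1).isConnected.isPreconnected ?_
      Γ.continuous.continuousOn (fun s hs => ?_) ⟨le_rfl, t.2.1⟩ (by rw [hG0, Γ.source])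
    · exact fun s hs => ContinuousAt.comp_continuousWithinAt (g := RegularGerm.derivGerm)
        (continuousAt_derivGerm (by rw [hGpt s hs]; exact hγ s)) (hG s hs)
    · rw [derivGerm_pt, hGpt s hs, hΓ]
  have hHt := hH _ (htU t htt)
  have hd : (ofFun H (γ t)).derivGerm = (G t).derivGerm := by
    rw [show (G t).derivGerm = Γ t from hGd ht]
    refine ((isGermOf_ofFun hHt.1).derivGerm (by simpa using hγ t)).congr ?_ |>.ext
      (hts ⟨ht₀t, htτ.le⟩).2 (by simp [hΓ])
    simpa using hHt.2
  -- Just before `τ` the continued primitive and the local primitive `H` have the same derivative;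
  -- after adjusting by the constant, `H` carries the continuation up to `τ`.
  obtain ⟨c, hc⟩ := exists_eq_addConst (by simp [hGpt t ht]) (by simpa using hγ t) hd
  refine continuesUpTo_extend hG hG0 hGpt htτ.le (k := fun x => H x + c)
    (fun s hs => (hH _ (htU s hs)).1.add_const c) ?_
  rw [hc]
  exact (isGermOf_ofFun hHt.1).addConst c

/-- A loop that fixes the germ of the integrand changes the integral by an additive constant.
Translations commute, so commutators of such loops fix the integral and depth `n + 1` suffices. -/
theorem stableUnderIntegration_solvableSFunctions :
    StableUnderIntegration SolvableSFunctions := by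
  intro f hf φ hφ
  have hA := countable_singularSet_union_infty hf
  set A := f.singularSet ∪ {OnePoint.infty} with hAdef
  obtain ⟨p, hp, hfp, hpA⟩ := IsDerivativeOf.exists_derivGerm hφ hA (Or.inr rfl)
  rw [← show generatedBy p = φ from hp]
  obtain ⟨n, hn⟩ := exists_derivedLoop_trivial hf
  have hfin : ∀ {x : Sphere}, x ∉ A → x ≠ OnePoint.infty := fun hx h => hx (Or.inr h)
  have hAs : Aᶜ ⊆ f.singularSetᶜ := Set.compl_subset_compl.2 Set.subset_union_left
  have hcont : ∀ {b : Sphere} (γ : Path p.pt b), (∀ t, γ t ∉ A) → ContinuesUpTo γ p 1 := by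
    intro b γ hγ
    obtain ⟨q, -, hq⟩ := HasGerm.exists_continuesTo hfp γ (derivGerm_pt p) fun t => hAs (hγ t)
    obtain ⟨r, hr, -⟩ := hq.exists_of_derivGerm fun t => hfin (hγ t)
    exact continuesUpTo_one_iff.2 ⟨r, hr⟩
  refine mem_solvableSFunctions_of_derivedLoop hA hpA (fun b γ hγ => hcont γ hγ) (n + 1) ?_
  have key : ∀ γ : Path p.pt p.pt, DerivedLoop Aᶜ n γ → ∀ r : RegularGerm, r.pt = p.pt →
      f.HasGerm r.derivGerm → ∃ c, ContinuesTo γ r (r.addConst c) := by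
    intro γ hγ r hr hfr
    have h1 := hn _ γ (hγ.mono_set hAs) _ hfr (by simpa using hr)
    obtain ⟨s, hs, hsr⟩ := h1.exists_of_derivGerm fun t => hfin (hγ.mem t)
    obtain ⟨c, rfl⟩ := exists_eq_addConst (hr.trans hs.pt_eq_right.symm) (hr ▸ hfin hpA) hsr.symm
    exact ⟨c, hs⟩
  have key' : ∀ N, ∀ γ : Path p.pt p.pt, DerivedLoop Aᶜ N γ → N = n + 1 → ∀ r : RegularGerm,
      r.pt = p.pt → f.HasGerm r.derivGerm → ContinuesTo γ r r := by
    intro N γ hγ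
    induction hγ with
    | loop h => intro h; simp at h
    | refl _ _ => exact fun _ r hr _ => ContinuesTo.refl hr
    | trans _ _ h h' => exact fun hN r hr hfr => (h hN r hr hfr).trans (h' hN r hr hfr)
    | symm _ h => exact fun hN r hr hfr => (h hN r hr hfr).symm
    | commutator hγ hδ _ _ =>
      intro hN r hr hfr
      obtain rfl := Nat.succ.inj hN
      obtain ⟨c, hc⟩ := key _ hγ r hr hfr
      obtain ⟨d, hd⟩ := key _ hδ r hr hfr
      -- Continuation commutes with adding constants: starting from `r + c`, the loop `δ` still adds
      -- `d`, and likewise with the roles exchanged.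
      have h1 := hd.addConst c
      have h2 := (hc.addConst d).symm
      rw [addConst_addConst] at h1 h2
      rw [add_comm] at h1
      exact (hc.trans h1).trans (h2.trans hd.symm)
  intro γ hγ r hr hrp
  obtain ⟨δ, hδ, hpr⟩ := joinedIn_generatedBy hr
  exact key' _ γ hγ rfl r hrp (hfp.of_continuesTo (hpr.derivGerm fun t => hfin (hδ t)))

/-! ### Germs of functions that are holomorphic off a countable closed set -/

/-- The germs of `h` give a global section over `V`, so every loop in `V` fixes them, already at
depth 0. -/
theorem RegularGerm.IsGermOf.generatedBy_mem {p : RegularGerm} {h : Sphere → ℂ} (hp : p.IsGermOf h)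
    {V : Set Sphere} (hV : Vᶜ.Countable) (hh : ∀ x ∈ V, HolomorphicAt h x) :
    generatedBy p ∈ SolvableSFunctions := by
  obtain ⟨x, hxV, h1, h2⟩ := exists_notMem_of_eventually hV hp.eventually_generatedBy
  rw [← h2]
  have hlift : ∀ {a b : Sphere} (γ : Path a b), (∀ t, γ t ∉ Vᶜ) →
      ContinuesTo γ (ofFun h a) (ofFun h b) := fun {a b} γ hγ => by
    have := continuesTo_of_continuous γ (G := fun t => ofFun h (γ t))
      (continuous_iff_continuousAt.2 fun t => ContinuousAt.comp (g := ofFun h)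
        (continuousAt_ofFun (hh _ (not_not.1 (hγ t)))) γ.continuous.continuousAt)
      fun t => ofFun_pt _ _
    simpa using this
  refine mem_solvableSFunctions_of_derivedLoop hV (by simpa using hxV) (fun b γ hγ => ?_) 0
    fun γ hγ r hr hrx => ?_
  · have := hlift γ hγ
    rw [show ofFun h (ofFun h x).pt = ofFun h x by rw [ofFun_pt]] at this
    exact continuesUpTo_one_iff.2 ⟨_, this⟩
  · have hrh : r.IsGermOf h :=
      isGermOf_of_joinedIn (U := V) hh (hr.mono fun y hy => not_not.1 hy) h1
    have := hlift γ hγ.mem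
    rwa [show ofFun h (ofFun h x).pt = r from ((eq_ofFun hrh).trans (by rw [hrx])).symm] at this

theorem RegularGerm.IsGermOf.generatedBy_mem_of_const {p : RegularGerm} {c : ℂ}
    (hp : p.IsGermOf fun _ => c) : generatedBy p ∈ SolvableSFunctions :=
  hp.generatedBy_mem (V := Set.univ) (by simp) fun x _ => holomorphicAt_const c x

/-! ### Composition -/

namespace RegularGerm

/-- The value of a germ as a point of the sphere. -/
def sval (p : RegularGerm) : Sphere := (p.val : Sphere)

theorem continuous_sval : Continuous sval := OnePoint.continuous_coe.comp continuous_val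

theorem IsGermOf.sval_eq {p : RegularGerm} {h : Sphere → ℂ} (hp : p.IsGermOf h) :
    p.sval = ((h p.pt : ℂ) : Sphere) := by rw [sval, hp.val_eq]

/-- The composition of the germ `q` with the germ `p` at a finite point. -/
def compGerm (q p : RegularGerm) : RegularGerm := ofFun (fun x => q.rep ((p.rep x : ℂ) : Sphere)) p.pt

@[simp] theorem compGerm_pt (q p : RegularGerm) : (compGerm q p).pt = p.pt := ofFun_pt _ _

theorem _root_.HolomorphicAt.tendsto_coe {h : Sphere → ℂ} {x : Sphere} (hh : HolomorphicAt h x) :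
    Tendsto (fun y => ((h y : ℂ) : Sphere)) (𝓝 x) (𝓝 ((h x : ℂ) : Sphere)) :=
  (OnePoint.continuous_coe.tendsto _).comp hh.continuousAt

theorem _root_.HolomorphicAt.comp_coe {h k : Sphere → ℂ} {x : Sphere}
    (hk : HolomorphicAt k ((h x : ℂ) : Sphere)) (hh : HolomorphicAt h x) :
    HolomorphicAt (fun y => k ((h y : ℂ) : Sphere)) x := by
  obtain ⟨e, w, he, rfl⟩ := exists_isSphereChart x
  rw [he.holomorphicAt_iff] at hh ⊢
  exact AnalyticAt.comp (g := fun v : ℂ => k v) hk hh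

theorem IsGermOf.compGerm {p q : RegularGerm} {h k : Sphere → ℂ} (hp : p.IsGermOf h)
    (hq : q.IsGermOf k) (hpq : q.pt = p.sval) :
    (compGerm q p).IsGermOf (fun x => k ((h x : ℂ) : Sphere)) := by
  have hrep := q.isGermOf_rep.holomorphicAt
  rw [hpq, p.isGermOf_rep.sval_eq] at hrep
  refine IsGermOf.congr (isGermOf_ofFun (hrep.comp_coe p.isGermOf_rep.holomorphicAt)) ?_
  rw [compGerm_pt]
  have h1 := q.isGermOf_rep.eventuallyEq hq
  rw [hpq, hp.sval_eq] at h1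
  filter_upwards [hp.holomorphicAt.tendsto_coe.eventually h1, p.isGermOf_rep.eventuallyEq hp]
    with x h2 h3
  rw [h3, h2]

/-- The outer germ has to be continued along the path of values of the continued inner germ; this
path depends on the lift `Γ` and not on `γ` alone. -/
theorem _root_.ContinuesTo.compGerm {a b : Sphere} {γ : Path a b} {p p' q q' : RegularGerm}
    (Γ : Path p p') (hΓ : ∀ t, (Γ t).pt = γ t)
    (hq : ContinuesTo (Γ.map continuous_sval) q q') :
    ContinuesTo γ (compGerm q p) (compGerm q' p') := by
  obtain ⟨Δ, hΔ⟩ := hq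
  have := continuesTo_of_continuous γ (G := fun t => RegularGerm.compGerm (Δ t) (Γ t)) ?_
    fun t => (compGerm_pt _ _).trans (hΓ t)
  · simpa using this
  · refine continuous_iff_continuousAt.2 fun t => continuousAt_of_isGermOf
      (k := fun x => (Δ t).rep (((Γ t).rep x : ℂ) : Sphere)) ?_ ?_
    · simp only [compGerm_pt]
      exact (continuous_pt.comp Γ.continuous).continuousAt
    · filter_upwards [Γ.continuous.continuousAt.eventually (p := fun r => r.IsGermOf (Γ t).rep)
        (Γ t).isGermOf_rep.eventually,
        Δ.continuous.continuousAt.eventually (p := fun r => r.IsGermOf (Δ t).rep)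
        (Δ t).isGermOf_rep.eventually] with s h1 h2
      exact h1.compGerm h2 (hΔ s)

/-- The germs reachable from a non-constant germ at which the value lies in a countable set form a
countable set. -/
theorem countable_setOf_joined_sval_mem {p : RegularGerm} (hp : ∀ c : ℂ, ¬ p.IsGermOf fun _ => c)
    {B : Set Sphere} (hB : B.Countable) : {q | Joined p q ∧ q.sval ∈ B}.Countable := by
  have : {q | Joined p q ∧ q.sval ∈ B} ⊆ ⋃ b ∈ B, {q | Joined p q ∧ q.sval = b} := fun q hq =>
    Set.mem_biUnion hq.2 ⟨hq.1, rfl⟩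
  refine (hB.biUnion fun b _ => ?_).mono this
  refine isLocalHomeomorph_pt.countable_of_locally (x := p) (fun q hq => hq.1) fun z hz => ?_
  obtain ⟨hpz, rfl⟩ := hz
  obtain ⟨h, hzh, hh⟩ := z.exists_isGermOf
  -- Either the germ is constant near `z`, and then so is `p` by continuation, or the value at `z`
  -- is not taken again nearby and `z` is isolated in the set.
  rcases hh.eventually_eq_or_eventually_ne (holomorphicAt_const z.val z.pt) with H | H
  · exact absurd (isGermOf_of_joinedIn (U := Set.univ) (fun x _ => holomorphicAt_const z.val x)
      (joinedIn_univ.2 hpz.symm) (hzh.congr H)) (hp _)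
  · refine ⟨_, hzh.eventually.and (continuous_pt.continuousAt.eventually
      (eventually_nhdsWithin_iff.1 H)), (Set.countable_singleton z).mono ?_⟩
    rintro q ⟨⟨-, hq⟩, hqh, hqne⟩
    refine hqh.ext hzh (by_contra fun hne => hqne hne ?_)
    rw [← hqh.val_eq]
    exact OnePoint.coe_injective hq

end RegularGerm

/-- Once the loops of depth `n` lift to closed paths, the remaining `m` levels of products, inverses
and commutators can be copied upstairs, and they survive under the map `v`. -/
theorem DerivedLoop.exists_lift_map {X Y Z : Type*} [TopologicalSpace X] [TopologicalSpace Y]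
    [TopologicalSpace Z] {π : X → Y} {v : X → Z} (hv : Continuous v) {C : Set Y} {D : Set Z}
    {x : X} {y : Y} {n : ℕ}
    (hbase : ∀ γ : Path y y, DerivedLoop C n γ →
      ∃ Γ : Path x x, (∀ t, π (Γ t) = γ t) ∧ ∀ t, v (Γ t) ∈ D)
    (hx : π x = y) (hxD : v x ∈ D) {N m : ℕ} {γ : Path y y} (hγ : DerivedLoop C N γ) (hN : N = n + m) :
    ∃ Γ : Path x x, (∀ t, π (Γ t) = γ t) ∧ DerivedLoop D m (Γ.map hv) := by
  have hbase' : ∀ γ : Path y y, DerivedLoop C N γ → m = 0 →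
      ∃ Γ : Path x x, (∀ t, π (Γ t) = γ t) ∧ DerivedLoop D m (Γ.map hv) := by
    rintro γ hγ rfl
    obtain ⟨Γ, hΓ, hΓD⟩ := hbase γ (by rwa [hN] at hγ)
    exact ⟨Γ, hΓ, .loop hΓD⟩
  induction hγ generalizing m with
  | loop h => exact hbase' _ (.loop h) (by omega)
  | refl _ _ => exact ⟨Path.refl x, fun _ => hx, .refl _ hxD⟩
  | trans _ _ h h' =>
    obtain ⟨Γ, hΓ, hΓD⟩ := h hN hbase'
    obtain ⟨Δ, hΔ, hΔD⟩ := h' hN hbase'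
    refine ⟨Γ.trans Δ, fun t => ?_, by rw [Path.map_trans]; exact .trans hΓD hΔD⟩
    rw [Path.trans_apply, Path.trans_apply]
    split_ifs
    exacts [hΓ _, hΔ _]
  | symm _ h =>
    obtain ⟨Γ, hΓ, hΓD⟩ := h hN hbase'
    exact ⟨Γ.symm, fun t => hΓ _, by rw [← Path.map_symm]; exact .symm hΓD⟩
  | @commutator k γ δ hγ hδ h h' =>
    rcases m with _ | m
    · exact hbase' _ (.commutator hγ hδ) rfl
    · have hk : k = n + m := by omega
      have hb : ∀ γ : Path y y, DerivedLoop C k γ → m = 0 →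
          ∃ Γ : Path x x, (∀ t, π (Γ t) = γ t) ∧ DerivedLoop D m (Γ.map hv) := by
        rintro γ hγ rfl
        obtain ⟨Γ, hΓ, hΓD⟩ := hbase γ (by rwa [hk] at hγ)
        exact ⟨Γ, hΓ, .loop hΓD⟩
      obtain ⟨Γ, hΓ, hΓD⟩ := h hk hb
      obtain ⟨Δ, hΔ, hΔD⟩ := h' hk hb
      refine ⟨(Γ.trans Δ).trans (Γ.symm.trans Δ.symm), fun t => ?_, ?_⟩
      · simp only [Path.trans_apply]
        split_ifs
        exacts [hΓ _, hΔ _, hΓ _, hΔ _]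
      · rw [Path.map_trans, Path.map_trans, Path.map_trans, ← Path.map_symm, ← Path.map_symm]
        exact .commutator hΓD hΔD

/-- Commutators of depth `nf` lift to closed paths of germs of the inner function. By
`DerivedLoop.exists_lift_map`, a loop of depth `nf + ng` lifts to a closed path whose values form a
loop of depth `ng`, and such a loop acts trivially on the outer germ. -/
theorem stableUnderComposition_solvableSFunctions :
    StableUnderComposition SolvableSFunctions := by
  rintro g hg f hf φ ⟨r, q, p, hφr, hgq, hfp, hpt, h, k, hph, hqpt, hqk, hrk⟩
  rw [← show generatedBy r = φ from hφr]
  -- A constant inner function could sit at a singular value of `g` everywhere, so it is treated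
  -- apart; the composition is then constant.
  by_cases hconst : ∃ c : ℂ, p.IsGermOf fun _ => c
  · obtain ⟨c, hc⟩ := hconst
    refine IsGermOf.generatedBy_mem_of_const (c := k c) (hrk.congr ?_)
    rw [hpt]
    filter_upwards [hph.eventuallyEq hc] with x hx
    rw [hx]
  push Not at hconst
  -- The inner germs at which the outer function may fail to continue; their base points are
  -- forbidden as well.
  set Z := {s | Joined p s ∧ s.sval ∈ g.singularSet}
  set A := (f.singularSet ∪ {OnePoint.infty}) ∪ pt '' Z
  have hA : A.Countable := (countable_singularSet_union_infty hf).union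
    ((countable_setOf_joined_sval_mem hconst hg.1.countable_singularSet).image _)
  have hAs : Aᶜ ⊆ f.singularSetᶜ := Set.compl_subset_compl.2 fun x hx => Or.inl (Or.inl hx)
  have hgA : ∀ s : RegularGerm, Joined p s → s.pt ∉ A → s.sval ∉ g.singularSet :=
    fun s hs hsA hsg => hsA (Or.inr ⟨s, ⟨hs, hsg⟩, rfl⟩)
  have hk := hqk.eventually_generatedBy
  rw [hqpt] at hk
  rw [← show generatedBy p = f from hfp] at hf
  have hr := hrk.eventually_generatedBy
  rw [hpt] at hr
  obtain ⟨x, hxA, ⟨⟨h1, h1'⟩, h2, h2'⟩, h3, h3'⟩ := exists_notMem_of_eventually hA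
    ((hph.eventually_generatedBy.and hr).and (hph.holomorphicAt.tendsto_coe.eventually hk))
  rw [← h2']
  set p₁ := ofFun h x
  set q₁ := ofFun k ((h x : ℂ) : Sphere)
  have hp₁x : p₁.pt = x := ofFun_pt _ _
  have hq₁ : q₁.pt = p₁.sval := by rw [h1.sval_eq, ofFun_pt, ofFun_pt]
  have hr₁ : ofFun (fun x => k ((h x : ℂ) : Sphere)) x = compGerm q₁ p₁ :=
    h2.ext (h1.compGerm h3 hq₁) (by simp [p₁])
  rw [hr₁]
  have hpp₁ : Joined p p₁ := joined_of_generatedBy_eq h1'.symm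
  have hfp₁ : f.HasGerm p₁ := h1'.trans hfp
  have hgq₁ : g.HasGerm q₁ := h3'.trans hgq
  rw [show generatedBy p = f from hfp] at hf
  have hval : ∀ {s s' : RegularGerm} (Γ : Path s s'), Joined p s → (∀ t, (Γ t).pt ∉ A) →
      ∀ t, (Γ t).sval ∉ g.singularSet := fun Γ hs hΓ t =>
    hgA _ (hs.trans ⟨(Γ.truncateOfLE (t₀ := 0) (t₁ := t) t.2.1).cast (by simp) (by simp)⟩) (hΓ t)
  have hlift : ∀ {a b : Sphere} (γ : Path a b), (∀ t, γ t ∉ A) → p₁.pt = a →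
      ∃ p' q', f.HasGerm p' ∧ g.HasGerm q' ∧ q'.pt = p'.sval ∧ Joined p p' ∧ p'.pt = b ∧
        ContinuesTo γ (compGerm q₁ p₁) (compGerm q' p') := by
    intro a b γ hγ ha
    obtain ⟨p', hp', Γ, hΓ⟩ := hfp₁.exists_continuesTo γ ha fun t => hAs (hγ t)
    obtain ⟨q', hq', hqq'⟩ := hgq₁.exists_continuesTo (Γ.map continuous_sval) hq₁
      (hval Γ hpp₁ fun t => by rw [hΓ]; exact hγ t)
    refine ⟨p', q', hp', hq', hqq'.pt_eq_right, hpp₁.trans ⟨Γ⟩, ?_, .compGerm Γ hΓ hqq'⟩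
    have := hΓ 1
    rwa [Γ.target, γ.target] at this
  obtain ⟨nf, hnf⟩ := exists_derivedLoop_trivial hf
  obtain ⟨ng, hng⟩ := exists_derivedLoop_trivial hg
  have hptr : (compGerm q₁ p₁).pt = p₁.pt := compGerm_pt _ _
  refine mem_solvableSFunctions_of_derivedLoop hA (by simpa [p₁] using hxA) (fun b γ hγ => ?_)
    (nf + ng) fun γ hγ s hs hsx => ?_
  · obtain ⟨p', q', -, -, -, -, -, H⟩ := hlift γ hγ hptr.symm
    exact continuesUpTo_one_iff.2 ⟨_, H⟩
  · obtain ⟨δ, hδ, hδs⟩ := joinedIn_generatedBy hs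
    obtain ⟨p', q', hp', hq', hpq', hpp', hp'b, H⟩ := hlift δ hδ hptr.symm
    obtain rfl := H.unique hδs
    have hp'x : p'.pt = (compGerm q₁ p₁).pt := hp'b.trans hsx
    obtain ⟨Γ, hΓ, hΓD⟩ := DerivedLoop.exists_lift_map (π := pt) (x := p') continuous_sval
      (D := g.singularSetᶜ) (n := nf) (m := ng)
      (fun γ hγ => by
        obtain ⟨Γ, hΓ⟩ := hnf _ γ (hγ.mono_set hAs) p' hp' hp'x
        exact ⟨Γ, hΓ, hval Γ hpp' fun t => by rw [hΓ]; exact hγ.mem t⟩)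
      hp'x (hgA _ hpp' (by rw [hp'x]; simpa [p₁] using hxA)) hγ rfl
    exact .compGerm Γ hΓ (hng _ _ hΓD q' hq' hpq')

/-! ### Generic limits of meromorphic functions along lines -/

section GenericLimit

variable {E : Type*} [NormedAddCommGroup E] [NormedSpace ℂ E]

/-- The `k`-th derivative of `Q` at `y` in the direction `w`. -/
def directionalCoeff (Q : E → ℂ) (k : ℕ) (w y : E) : ℂ := iteratedFDeriv ℂ k Q y fun _ => w

theorem directionalCoeff_eq {Q : E → ℂ} {y : E} {p : FormalMultilinearSeries ℂ E ℂ}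
    {r : ENNReal} (hp : HasFPowerSeriesOnBall Q p y r) (k : ℕ) (w : E) :
    directionalCoeff Q k w y = (k.factorial : ℂ) * p k fun _ => w := by
  rw [directionalCoeff, ← hp.factorial_smul w k, nsmul_eq_mul]

theorem AnalyticAt.directionalCoeff {Q : E → ℂ} {y : E} (hQ : AnalyticAt ℂ Q y) (k : ℕ) (w : E) :
    AnalyticAt ℂ (directionalCoeff Q k w) y := by
  have h1 := hQ.eventually_analyticAt
  obtain ⟨s, hs, h2⟩ := eventually_iff_exists_mem.1 h1
  have h3 : AnalyticAt ℂ (iteratedFDeriv ℂ k Q) y :=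
    AnalyticOnNhd.iteratedFDeriv (s := s) (fun x hx => h2 x hx) k y (mem_of_mem_nhds hs)
  exact ((ContinuousMultilinearMap.apply ℂ (fun _ : Fin k => E) ℂ fun _ => w).analyticAt _).comp h3

theorem analyticAt_directionalCoeff_direction (Q : E → ℂ) (k : ℕ) (y w : E) :
    AnalyticAt ℂ (fun w => directionalCoeff Q k w y) w := by
  have h : AnalyticAt ℂ (fun w : E => fun _ : Fin k => w) w := analyticAt_pi_iff.2 fun _ => analyticAt_id
  exact AnalyticAt.comp (g := iteratedFDeriv ℂ k Q y) (ContinuousMultilinearMap.analyticAt _) h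

/-- Up to a factorial, the directional coefficients are the homogeneous terms of the Taylor series;
if all vanish, the series sums to zero. -/
theorem AnalyticAt.exists_directionalCoeff_ne_zero {Q : E → ℂ} {y : E} (hQ : AnalyticAt ℂ Q y)
    (h : ¬ ∀ᶠ z in 𝓝 y, Q z = 0) : ∃ k w, _root_.directionalCoeff Q k w y ≠ 0 := by
  by_contra! H
  obtain ⟨p, r, hp⟩ := hQ
  refine h ?_
  filter_upwards [hp.eventually_hasSum_sub] with z hz
  have : ∀ n, (p n fun _ => z - y) = 0 := fun n => by
    have := H n (z - y)
    rw [directionalCoeff_eq hp] at this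
    exact (mul_eq_zero.1 this).resolve_left (Nat.cast_ne_zero.2 n.factorial_ne_zero)
  simp only [this] at hz
  exact hz.unique hasSum_zero

/-- Along the line, the Taylor polynomial of order `k` reduces to its term in `s ^ k`, and the
remainder is `O(s ^ (k + 1))`. -/
theorem AnalyticAt.tendsto_div_pow {Q : E → ℂ} {y w : E} {k : ℕ} (hQ : AnalyticAt ℂ Q y)
    (h : ∀ j < k, _root_.directionalCoeff Q j w y = 0) :
    Tendsto (fun s : ℂ => Q (y + s • w) / s ^ k) (𝓝[≠] 0)
      (𝓝 (_root_.directionalCoeff Q k w y / k.factorial)) := by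
  obtain ⟨p, r, hp⟩ := hQ
  have hcoef : ∀ j, (p j fun _ => w) = _root_.directionalCoeff Q j w y / j.factorial := fun j => by
    rw [directionalCoeff_eq hp, mul_div_cancel_left₀ _ (Nat.cast_ne_zero.2 j.factorial_ne_zero)]
  set c := _root_.directionalCoeff Q k w y / k.factorial
  have h1 := hp.hasFPowerSeriesAt.isBigO_sub_partialSum_pow (k + 1)
  have h2 : Tendsto (fun s : ℂ => s • w) (𝓝 0) (𝓝 0) := by
    have : Continuous fun s : ℂ => s • w := by fun_prop
    simpa using this.tendsto 0
  have h3 := h1.comp_tendsto h2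
  have h4 : (fun s : ℂ => Q (y + s • w) - s ^ k * c) =O[𝓝 0] fun s : ℂ => s ^ (k + 1) := by
    have e1 : ((fun z : E => Q (y + z) - p.partialSum (k + 1) z) ∘ fun s : ℂ => s • w) =
        fun s : ℂ => Q (y + s • w) - s ^ k * c := by
      ext s
      simp only [Function.comp, FormalMultilinearSeries.partialSum]
      congr 1
      have : ∀ j, (p j fun _ => s • w) = s ^ j * p j fun _ => w := fun j => by
        have := (p j).map_smul_univ (fun _ => s) (fun _ => w)
        simpa using this
      rw [Finset.sum_range_succ, Finset.sum_eq_zero, this, hcoef, zero_add]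
      intro j hj
      rw [this, hcoef, h j (Finset.mem_range.1 hj), zero_div, mul_zero]
    rw [e1] at h3
    refine h3.trans (Asymptotics.IsBigO.of_bound (‖w‖ ^ (k + 1)) (Eventually.of_forall fun s => ?_))
    simp [norm_smul, mul_pow, mul_comm]
  have h5 : (fun s : ℂ => s ^ (k + 1)) =o[𝓝 0] fun s : ℂ => s ^ k :=
    Asymptotics.isLittleO_pow_pow (Nat.lt_succ_self k)
  have h6 := ((h4.trans_isLittleO h5).tendsto_div_nhds_zero.mono_left
    (nhdsWithin_le_nhds (s := {0}ᶜ))).add_const c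
  rw [zero_add] at h6
  refine h6.congr' ?_
  filter_upwards [self_mem_nhdsWithin] with s hs
  have : s ^ k ≠ 0 := pow_ne_zero _ hs
  field_simp
  ring

/-- By the identity theorem the non-zero set is open and dense. Several such conditions hold for a
common direction because the residual filter is proper, by Baire (`residual_neBot_of_complete`). -/
theorem eventually_residual_ne_zero {c : E → ℂ} (hc : ∀ w, AnalyticAt ℂ c w) {w₁ : E}
    (h : c w₁ ≠ 0) : ∀ᶠ w in residual E, c w ≠ 0 := by
  have hcont : Continuous c := continuous_iff_continuousAt.2 fun w => (hc w).continuousAt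
  refine residual_of_dense_open (isOpen_ne_fun hcont continuous_const) fun w => ?_
  by_contra hw
  have : c =ᶠ[𝓝 w] 0 := by
    filter_upwards [isClosed_closure.isOpen_compl.mem_nhds hw] with v hv
    exact not_not.1 fun hv' => hv (subset_closure hv')
  exact h (AnalyticOnNhd.eqOn_zero_of_preconnected_of_eventuallyEq_zero (U := Set.univ)
    (fun w _ => hc w) isPreconnected_univ (Set.mem_univ w) this (Set.mem_univ w₁))

/-- The function `F` tends to `m` at `y` along a generic line. -/
def HasGenericLimit (F : E → ℂ) (y : E) (m : ℂ) : Prop :=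
  ∀ᶠ w in residual E, Tendsto (fun s : ℂ => F (y + s • w)) (𝓝[≠] 0) (𝓝 m)

theorem tendsto_add_smul (y w : E) : Tendsto (fun s : ℂ => y + s • w) (𝓝[≠] 0) (𝓝 y) := by
  have : Continuous fun s : ℂ => y + s • w := by fun_prop
  simpa using (this.tendsto 0).mono_left (nhdsWithin_le_nhds (s := {0}ᶜ))

variable [CompleteSpace E]

theorem residual_neBot_of_complete {E : Type*} [NormedAddCommGroup E] [CompleteSpace E] :
    (residual E).NeBot :=
  ⟨fun h => by simpa using (dense_of_mem_residual (X := E) (s := ∅) (h ▸ mem_bot)).nonempty⟩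

theorem HasGenericLimit.unique {F : E → ℂ} {y : E} {m m' : ℂ} (h : HasGenericLimit F y m)
    (h' : HasGenericLimit F y m') : m = m' := by
  have := residual_neBot_of_complete (E := E)
  obtain ⟨w, hw, hw'⟩ := (h.and h').exists
  exact tendsto_nhds_unique hw hw'

section Quotient

variable {F P Q : E → ℂ} {y : E} {k : ℕ} {w₁ : E} {m : ℂ}

omit [CompleteSpace E] in
theorem tendsto_quotient_div_pow (hQ : AnalyticAt ℂ Q y)
    (hF : ∀ᶠ x in 𝓝 y, Q x ≠ 0 → F x = P x / Q x)
    (hlow : ∀ j < k, ∀ w, directionalCoeff Q j w y = 0) {w : E} (hw : directionalCoeff Q k w y ≠ 0) :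
    ∀ᶠ s in 𝓝[≠] (0 : ℂ), Q (y + s • w) ≠ 0 ∧ F (y + s • w) = P (y + s • w) / Q (y + s • w) := by
  have h1 := hQ.tendsto_div_pow fun j hj => hlow j hj w
  have h2 := h1.eventually_ne (div_ne_zero hw (Nat.cast_ne_zero.2 k.factorial_ne_zero))
  filter_upwards [h2, (tendsto_add_smul y w).eventually hF] with s hs hs'
  have : Q (y + s • w) ≠ 0 := fun h => hs (by rw [h, zero_div])
  exact ⟨this, hs' this⟩

omit [CompleteSpace E] in
theorem tendsto_numerator_div_pow (hQ : AnalyticAt ℂ Q y)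
    (hF : ∀ᶠ x in 𝓝 y, Q x ≠ 0 → F x = P x / Q x)
    (hlow : ∀ j < k, ∀ w, directionalCoeff Q j w y = 0) {w : E} (hw : directionalCoeff Q k w y ≠ 0)
    (h : Tendsto (fun s : ℂ => F (y + s • w)) (𝓝[≠] 0) (𝓝 m)) :
    Tendsto (fun s : ℂ => P (y + s • w) / s ^ k) (𝓝[≠] 0)
      (𝓝 (m * (directionalCoeff Q k w y / k.factorial))) := by
  refine (h.mul (hQ.tendsto_div_pow fun j hj => hlow j hj w)).congr' ?_
  filter_upwards [tendsto_quotient_div_pow hQ hF hlow hw] with s hs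
  rw [hs.2]
  field_simp [hs.1]

/-- If `P` had a lower order `i < k` in a generic direction, `P / s ^ i` would tend to a non-zero
number; but it equals `P / s ^ k` times a positive power of `s`, which tends to 0. -/
theorem HasGenericLimit.directionalCoeff_eq_zero (h : HasGenericLimit F y m)
    (hP : AnalyticAt ℂ P y) (hQ : AnalyticAt ℂ Q y)
    (hF : ∀ᶠ x in 𝓝 y, Q x ≠ 0 → F x = P x / Q x)
    (hlow : ∀ j < k, ∀ w, directionalCoeff Q j w y = 0) (hw₁ : directionalCoeff Q k w₁ y ≠ 0)
    {j : ℕ} (hj : j < k) (w : E) : directionalCoeff P j w y = 0 := by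
  by_contra hne
  have := residual_neBot_of_complete (E := E)
  obtain ⟨v, ⟨hv, hvQ⟩, hvP⟩ := ((h.and (eventually_residual_ne_zero
    (analyticAt_directionalCoeff_direction Q k y) hw₁)).and (eventually_residual_ne_zero
    (analyticAt_directionalCoeff_direction P j y) hne)).exists
  classical
  have hex : ∃ i, directionalCoeff P i v y ≠ 0 := ⟨j, hvP⟩
  have hik : Nat.find hex < k := (Nat.find_min' hex hvP).trans_lt hj
  have h1 := hP.tendsto_div_pow (w := v) fun i hi => not_not.1 (Nat.find_min hex hi)
  have h2 : Tendsto (fun s : ℂ => s ^ (k - Nat.find hex)) (𝓝[≠] 0) (𝓝 0) := by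
    have : Continuous fun s : ℂ => s ^ (k - Nat.find hex) := by fun_prop
    simpa [zero_pow (Nat.sub_pos_of_lt hik).ne'] using
      (this.tendsto 0).mono_left (nhdsWithin_le_nhds (s := {0}ᶜ))
  have h3 := (tendsto_numerator_div_pow hQ hF hlow hvQ hv).mul h2
  rw [mul_zero] at h3
  refine div_ne_zero (Nat.find_spec hex) (Nat.cast_ne_zero.2 (Nat.find hex).factorial_ne_zero)
    (tendsto_nhds_unique h1 (h3.congr' ?_))
  filter_upwards [self_mem_nhdsWithin] with s hs
  have hs0 : s ≠ 0 := hs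
  have : s ^ k = s ^ Nat.find hex * s ^ (k - Nat.find hex) := by
    rw [← pow_add, Nat.add_sub_cancel' hik.le]
  rw [this]
  field_simp

/-- In generic directions the limit of `P / s ^ k` is computed in two ways. Both sides are analytic
in the direction, so equality for generic `w` is equality for all `w`. -/
theorem HasGenericLimit.directionalCoeff_eq_mul (h : HasGenericLimit F y m)
    (hP : AnalyticAt ℂ P y) (hQ : AnalyticAt ℂ Q y)
    (hF : ∀ᶠ x in 𝓝 y, Q x ≠ 0 → F x = P x / Q x)
    (hlow : ∀ j < k, ∀ w, directionalCoeff Q j w y = 0) (hw₁ : directionalCoeff Q k w₁ y ≠ 0)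
    (w : E) : directionalCoeff P k w y = m * directionalCoeff Q k w y := by
  by_contra hne
  have := residual_neBot_of_complete (E := E)
  obtain ⟨v, ⟨hv, hvQ⟩, hvP⟩ := ((h.and (eventually_residual_ne_zero
    (analyticAt_directionalCoeff_direction Q k y) hw₁)).and (eventually_residual_ne_zero
    (c := fun w => directionalCoeff P k w y - m * directionalCoeff Q k w y)
    (fun w => (analyticAt_directionalCoeff_direction P k y w).sub
      (analyticAt_const.mul (analyticAt_directionalCoeff_direction Q k y w)))
    (sub_ne_zero.2 hne))).exists
  have h1 := hP.tendsto_div_pow fun i hi => h.directionalCoeff_eq_zero hP hQ hF hlow hw₁ hi v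
  have h2 := tendsto_nhds_unique h1 (tendsto_numerator_div_pow hQ hF hlow hvQ hv)
  have hk : (k.factorial : ℂ) ≠ 0 := Nat.cast_ne_zero.2 k.factorial_ne_zero
  refine hvP ?_
  field_simp at h2
  rw [h2, sub_self]

omit [CompleteSpace E] in
-- Converse of the two preceding results: the generic limit is `m` exactly when `P` vanishes to the
-- order `k` of `Q` and its form of degree `k` is `m` times that of `Q`.
theorem hasGenericLimit_of_directionalCoeff (hP : AnalyticAt ℂ P y) (hQ : AnalyticAt ℂ Q y)
    (hF : ∀ᶠ x in 𝓝 y, Q x ≠ 0 → F x = P x / Q x)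
    (hlow : ∀ j < k, ∀ w, directionalCoeff Q j w y = 0) (hw₁ : directionalCoeff Q k w₁ y ≠ 0)
    (hPlow : ∀ j < k, ∀ w, directionalCoeff P j w y = 0)
    (h : ∀ w, directionalCoeff P k w y = m * directionalCoeff Q k w y) : HasGenericLimit F y m := by
  filter_upwards [eventually_residual_ne_zero (analyticAt_directionalCoeff_direction Q k y) hw₁]
    with w hw
  have hk : (k.factorial : ℂ) ≠ 0 := Nat.cast_ne_zero.2 k.factorial_ne_zero
  have h1 := (hP.tendsto_div_pow fun j hj => hPlow j hj w).div
    (hQ.tendsto_div_pow fun j hj => hlow j hj w) (div_ne_zero hw hk)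
  rw [h w, mul_div_assoc, mul_div_cancel_right₀ _ (div_ne_zero hw hk)] at h1
  refine h1.congr' ?_
  filter_upwards [tendsto_quotient_div_pow hQ hF hlow hw, self_mem_nhdsWithin] with s hs hs0
  rw [hs.2, Pi.div_apply, div_div_div_cancel_right₀ (pow_ne_zero _ hs0)]

/-- Along a holomorphic curve, the generic limit of a meromorphic function either is meromorphic or
does not exist. -/
theorem hasGenericLimit_dichotomy {f : ℂ → E} {z : ℂ} (hf : AnalyticAt ℂ f z)
    (hP : AnalyticAt ℂ P (f z)) (hQ : AnalyticAt ℂ Q (f z)) (hQ0 : ¬ ∀ᶠ x in 𝓝 (f z), Q x = 0)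
    (hF : ∀ᶠ x in 𝓝 (f z), Q x ≠ 0 → F x = P x / Q x) :
    (∃ M : ℂ → ℂ, MeromorphicAt M z ∧ ∀ᶠ x in 𝓝[≠] z, HasGenericLimit F (f x) (M x)) ∨
      ∀ᶠ x in 𝓝[≠] z, ∀ m, ¬ HasGenericLimit F (f x) m := by
  have hev : ∀ᶠ x in 𝓝 z, AnalyticAt ℂ f x ∧ AnalyticAt ℂ P (f x) ∧ AnalyticAt ℂ Q (f x) ∧
      ∀ᶠ y in 𝓝 (f x), Q y ≠ 0 → F y = P y / Q y := by
    filter_upwards [hf.eventually_analyticAt,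
      hf.continuousAt.eventually hP.eventually_analyticAt,
      hf.continuousAt.eventually hQ.eventually_analyticAt,
      hf.continuousAt.eventually hF.eventually_nhds] with x h1 h2 h3 h4 using ⟨h1, h2, h3, h4⟩
  obtain ⟨δ, hδ, hU⟩ := Metric.eventually_nhds_iff_ball.1 hev
  set U := Metric.ball z δ
  have hzU : z ∈ U := Metric.mem_ball_self hδ
  have hUn : ∀ᶠ x in 𝓝[≠] z, x ∈ U := nhdsWithin_le_nhds (Metric.ball_mem_nhds z hδ)
  have halt : ∀ g : ℂ → ℂ, (∀ x ∈ U, AnalyticAt ℂ g x) →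
      (∀ᶠ x in 𝓝[≠] z, g x ≠ 0) ∨ ∀ x ∈ U, g x = 0 := fun g hg => by
    rcases (hg z hzU).eventually_eq_zero_or_eventually_ne_zero with h | h
    · exact Or.inr fun x hx => AnalyticOnNhd.eqOn_zero_of_preconnected_of_eventuallyEq_zero hg
        (convex_ball z δ).isPreconnected hzU h hx
    · exact Or.inl h
  have hPa : ∀ k w, ∀ x ∈ U, AnalyticAt ℂ (fun x => directionalCoeff P k w (f x)) x :=
    fun k w x hx => ((hU x hx).2.1.directionalCoeff k w).comp (hU x hx).1
  have hQa : ∀ k w, ∀ x ∈ U, AnalyticAt ℂ (fun x => directionalCoeff Q k w (f x)) x :=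
    fun k w x hx => ((hU x hx).2.2.1.directionalCoeff k w).comp (hU x hx).1
  classical
  -- The least such `k` is the order of vanishing of `Q` at the points of the curve near `z`, with
  -- `z` excepted.
  have hex : ∃ k, ∃ w, ∀ᶠ x in 𝓝[≠] z, directionalCoeff Q k w (f x) ≠ 0 := by
    obtain ⟨k, w, h⟩ := hQ.exists_directionalCoeff_ne_zero hQ0
    exact ⟨k, w, (halt _ (hQa k w)).resolve_right fun h0 => h (h0 z hzU)⟩
  obtain ⟨w₁, hw₁⟩ := Nat.find_spec hex
  have hlow : ∀ j < Nat.find hex, ∀ w, ∀ x ∈ U, directionalCoeff Q j w (f x) = 0 :=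
    fun j hj w => (halt _ (hQa j w)).resolve_left fun h => Nat.find_min hex hj ⟨w, h⟩
  generalize Nat.find hex = k at hw₁ hlow
  by_cases hPlow : ∀ j < k, ∀ w, ∀ x ∈ U, directionalCoeff P j w (f x) = 0
  -- Proportionality of the leading forms of `P` and `Q`. Like the vanishing of the lower terms of
  -- `P`, it is the vanishing of functions analytic in `x`; each vanishes throughout `U` or nowhere
  -- near `z` except possibly at `z`.
  · by_cases hdir : ∀ w, ∀ x ∈ U, directionalCoeff P k w (f x) * directionalCoeff Q k w₁ (f x) -
        directionalCoeff P k w₁ (f x) * directionalCoeff Q k w (f x) = 0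
    · refine Or.inl ⟨fun x => directionalCoeff P k w₁ (f x) / directionalCoeff Q k w₁ (f x),
        (hPa k w₁ z hzU).meromorphicAt.div (hQa k w₁ z hzU).meromorphicAt, ?_⟩
      filter_upwards [hUn, hw₁] with x hx hx₁
      obtain ⟨-, h1, h2, h3⟩ := hU x hx
      refine hasGenericLimit_of_directionalCoeff h1 h2 h3 (fun j hj w => hlow j hj w x hx) hx₁
        (fun j hj w => hPlow j hj w x hx) fun w => ?_
      rw [div_mul_eq_mul_div, eq_div_iff hx₁]
      exact sub_eq_zero.1 (hdir w x hx)
    · push Not at hdir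
      obtain ⟨w₂, x₂, hx₂, hne⟩ := hdir
      right
      filter_upwards [hUn, hw₁, (halt _ fun x hx => (((hPa k w₂ x hx).mul (hQa k w₁ x hx)).sub
        ((hPa k w₁ x hx).mul (hQa k w₂ x hx)))).resolve_right fun h => hne (h x₂ hx₂)]
        with x hx hx₁ hx2 m hm
      obtain ⟨-, h1, h2, h3⟩ := hU x hx
      have key := hm.directionalCoeff_eq_mul h1 h2 h3 (fun j hj w => hlow j hj w x hx) hx₁
      refine hx2 ?_
      simp only [Pi.sub_apply, Pi.mul_apply, key]
      ring
  · push Not at hPlow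
    obtain ⟨j, hj, w, x₂, hx₂, hne⟩ := hPlow
    right
    filter_upwards [hUn, hw₁, (halt _ (hPa j w)).resolve_right fun h => hne (h x₂ hx₂)]
      with x hx hx₁ hx2 m hm
    obtain ⟨-, h1, h2, h3⟩ := hU x hx
    exact hx2 (hm.directionalCoeff_eq_zero h1 h2 h3 (fun j hj w => hlow j hj w x hx) hx₁ hj w)

end Quotient

end GenericLimit

/-! ### Meromorphic operations -/

theorem eventually_nhdsNE_coe {z : ℂ} {p : Sphere → Prop} :
    (∀ᶠ x in 𝓝[≠] (z : Sphere), p x) ↔ ∀ᶠ w : ℂ in 𝓝[≠] z, p w := by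
  rw [eventually_nhdsWithin_iff, eventually_nhdsWithin_iff, eventually_nhds_coe]
  simp

instance sphere_nhdsNE_neBot (x : Sphere) : (𝓝[≠] x).NeBot := by
  have := isLocalHomeomorph_id_sphere.frequently_notMem (Set.countable_singleton x) x
  exact frequently_mem_iff_neBot.1 this

namespace GermTuple

variable {ι : Type*} [Finite ι]

/-- The values near the base point of functions representing the germs. -/
def repVal (τ : GermTuple ι) (x : Sphere) (i : ι) : ℂ := (τ.germ i).rep x

/-- Nearby tuples carry the same representatives and are determined by their base point, so
excluding the base point of `τ` excludes only `τ`. -/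
theorem eventually_nhdsNE {τ : GermTuple ι} {G : Sphere → (ι → ℂ) → Prop}
    (h : ∀ᶠ x in 𝓝[≠] τ.base, G x (τ.repVal x)) :
    ∀ᶠ σ in 𝓝[≠] τ, ∀ᶠ x in 𝓝 σ.base, G x (σ.repVal x) := by
  have h1 : ∀ᶠ σ in 𝓝 τ, ∀ i, (σ.germ i).IsGermOf (τ.germ i).rep :=
    eventually_all.2 fun i => (continuous_germ i).continuousAt.eventually
      (τ.germ i).isGermOf_rep.eventually
  have h2 := continuous_base.continuousAt.eventually (eventually_nhdsWithin_iff.1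
    (eventually_nhdsNE_eventually_nhds_iff.2 h))
  refine eventually_nhdsWithin_iff.2 ?_
  filter_upwards [h1, h2] with σ h3 h4 hne
  have h5 : ∀ᶠ x in 𝓝 σ.base, ∀ i, (σ.germ i).rep x = (τ.germ i).rep x :=
    eventually_all.2 fun i => by
      have := (σ.germ i).isGermOf_rep.eventuallyEq (h3 i)
      rwa [germ_pt] at this
  filter_upwards [h4 fun hb => hne (ext hb fun i => (h3 i).ext (τ.germ i).isGermOf_rep
    (by rw [germ_pt, germ_pt]; exact hb)), h5] with x hx hx'
  rwa [show σ.repVal x = τ.repVal x from funext hx']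

end GermTuple

/-! ### Values of a meromorphic function on tuples of germs -/

variable {n : ℕ} {F : (Fin n → ℂ) → ℂ} {τ : GermTuple (Fin n)}

/-- Near the base point of `τ`, the function `F` of the germs of `τ` is defined and holomorphic,
except possibly at the base point. -/
def IsPuncturedValue (F : (Fin n → ℂ) → ℂ) (τ : GermTuple (Fin n)) (M : Sphere → ℂ) : Prop :=
  ∀ᶠ x in 𝓝[≠] τ.base, HolomorphicAt M x ∧ HasGenericLimit F (τ.repVal x) (M x)

/-- The function `F` of the germs of `τ` extends to a holomorphic function `H`. -/
def IsRegularValue (F : (Fin n → ℂ) → ℂ) (τ : GermTuple (Fin n)) (H : Sphere → ℂ) : Prop :=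
  HolomorphicAt H τ.base ∧ IsPuncturedValue F τ H

theorem IsPuncturedValue.eventually {M : Sphere → ℂ} (h : IsPuncturedValue F τ M) :
    ∀ᶠ σ in 𝓝[≠] τ, IsRegularValue F σ M := by
  filter_upwards [GermTuple.eventually_nhdsNE
    (G := fun x v => HolomorphicAt M x ∧ HasGenericLimit F v (M x)) h] with σ hσ
  exact ⟨hσ.self_of_nhds.1, nhdsWithin_le_nhds hσ⟩

theorem IsRegularValue.eventually {H : Sphere → ℂ} (h : IsRegularValue F τ H) :
    ∀ᶠ σ in 𝓝 τ, IsRegularValue F σ H := by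
  filter_upwards [eventually_nhdsWithin_iff.1 h.2.eventually] with σ hσ
  by_cases hne : σ = τ
  · rwa [hne]
  · exact hσ hne

theorem IsRegularValue.eventuallyEq {H K : Sphere → ℂ} (h : IsRegularValue F τ H)
    (h' : IsRegularValue F τ K) : H =ᶠ[𝓝 τ.base] K := by
  refine (h.1.eventually_eq_or_eventually_ne h'.1).resolve_right fun hne => ?_
  obtain ⟨x, h1, h2, h3⟩ := (hne.and (h.2.and h'.2)).exists
  exact h1 (h2.2.unique h3.2)

theorem isPuncturedValue_or (hF : IsMeromorphicFunction F) (hτ : τ.base ≠ OnePoint.infty) :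
    (∃ M, IsPuncturedValue F τ M) ∨
      ∀ᶠ x in 𝓝[≠] τ.base, ∀ m, ¬ HasGenericLimit F (τ.repVal x) m := by
  obtain ⟨z, hz⟩ := exists_coe_eq hτ
  obtain ⟨P, Q, hP, hQ, hQ0, hPQ⟩ := hF (τ.repVal z)
  have hf : AnalyticAt ℂ (fun w : ℂ => τ.repVal w) z := analyticAt_pi_iff.2 fun i => by
    have := (τ.germ i).isGermOf_rep.holomorphicAt
    rw [τ.germ_pt, hz] at this
    exact this
  rw [hz]
  refine (hasGenericLimit_dichotomy hf hP hQ hQ0 hPQ).imp ?_ eventually_nhdsNE_coe.2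
  rintro ⟨M, hM, h⟩
  refine ⟨fun x => x.elim 0 M, ?_⟩
  rw [IsPuncturedValue, hz, eventually_nhdsNE_coe]
  filter_upwards [hM.eventually_analyticAt, h] with x h1 h2 using ⟨h1, h2⟩

/-- Both alternatives of the dichotomy propagate to neighbouring tuples, so having a punctured value
is a clopen condition along a path of tuples that avoids infinity. -/
theorem Joined.exists_isPuncturedValue (hF : IsMeromorphicFunction F) {τ₀ : GermTuple (Fin n)}
    {M : Sphere → ℂ} (hM : IsPuncturedValue F τ₀ M) (h : Joined τ₀ τ)
    (hτ₀ : τ₀.base ≠ OnePoint.infty) (hτ : τ.base ≠ OnePoint.infty) :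
    ∃ M, IsPuncturedValue F τ M := by
  obtain ⟨P, hP⟩ := GermTuple.isLocalHomeomorph_base.joinedIn_notMem
    (Set.countable_singleton OnePoint.infty) isOpen_univ (joinedIn_univ.2 h) hτ₀ hτ
  set S := {t | ∃ M, IsPuncturedValue F (P t) M}
  have hS : IsClopen S := by
    constructor
    · rw [← isOpen_compl_iff, isOpen_iff_mem_nhds]
      intro t ht
      have hbad := (isPuncturedValue_or hF (hP t).2).resolve_left ht
      filter_upwards [P.continuous.continuousAt.eventually (eventually_nhdsWithin_iff.1
        (GermTuple.eventually_nhdsNE (G := fun x v => ∀ m, ¬ HasGenericLimit F v m) hbad))]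
        with s hs ⟨M, hM⟩
      by_cases hst : P s = P t
      · exact ht ⟨M, hst ▸ hM⟩
      · obtain ⟨x, h1, h2⟩ := ((eventually_nhdsWithin_of_eventually_nhds (hs hst)).and hM).exists
        exact h1 _ h2.2
    · rw [isOpen_iff_mem_nhds]
      rintro t ⟨M, hM⟩
      filter_upwards [P.continuous.continuousAt.eventually
        (eventually_nhdsWithin_iff.1 hM.eventually)] with s hs
      by_cases hst : P s = P t
      · exact ⟨M, hst ▸ hM⟩
      · exact ⟨M, (hs hst).2⟩
  have h0 : (0 : unitInterval) ∈ S := ⟨M, by rwa [P.source]⟩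
  have h1 : (1 : unitInterval) ∈ S := hS.eq_univ ⟨0, h0⟩ ▸ Set.mem_univ _
  simpa [S] using h1

open Classical in
/-- The germ of the function `F` of the germs of `τ`. -/
def meromorphicGerm (F : (Fin n → ℂ) → ℂ) (τ : GermTuple (Fin n)) : RegularGerm :=
  ofFun (if h : ∃ H, IsRegularValue F τ H then h.choose else 0) τ.base

@[simp] theorem meromorphicGerm_pt : (meromorphicGerm F τ).pt = τ.base := ofFun_pt _ _

theorem IsRegularValue.isGermOf {H : Sphere → ℂ} (h : IsRegularValue F τ H) :
    (meromorphicGerm F τ).IsGermOf H := by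
  have hex : ∃ H, IsRegularValue F τ H := ⟨H, h⟩
  rw [meromorphicGerm, dif_pos hex]
  refine (isGermOf_ofFun hex.choose_spec.1).congr ?_
  rw [ofFun_pt]
  exact hex.choose_spec.eventuallyEq h

theorem IsRegularValue.continuousAt {H : Sphere → ℂ} (h : IsRegularValue F τ H) :
    ContinuousAt (meromorphicGerm F) τ := by
  refine continuousAt_of_isGermOf (k := H) ?_ ?_
  · simp only [meromorphicGerm_pt]
    exact GermTuple.continuous_base.continuousAt
  · filter_upwards [h.eventually] with σ hσ using hσ.isGermOf

/-- A punctured value at a tuple is a regular value at its neighbours, so the tuples without regular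
value are isolated and hence countable in number. Away from them `meromorphicGerm F` is continuous
and the general principle for continuous operations applies. -/
theorem IsRegularValue.generatedBy_mem {f : Fin n → MultivaluedFunction}
    (hf : ∀ i, f i ∈ SolvableSFunctions) (hF : IsMeromorphicFunction F)
    (hτf : ∀ i, (f i).HasGerm (τ.germ i)) (hτ : τ.base ≠ OnePoint.infty)
    {H : Sphere → ℂ} (h : IsRegularValue F τ H) :
    generatedBy (ofFun H τ.base) ∈ SolvableSFunctions := by
  set Z := {σ : GermTuple (Fin n) | Joined τ σ ∧ σ.base ≠ OnePoint.infty ∧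
    ¬ ∃ H, IsRegularValue F σ H}
  have hZ : Z.Countable := by
    refine GermTuple.isLocalHomeomorph_base.countable_of_locally (x := τ) (fun σ hσ => hσ.1)
      fun σ hσ => ?_
    obtain ⟨M, hM⟩ := hσ.1.exists_isPuncturedValue hF h.2 hτ hσ.2.1
    refine ⟨_, eventually_nhdsWithin_iff.1 hM.eventually, (Set.countable_singleton σ).mono ?_⟩
    rintro ρ ⟨hρZ, hρ⟩
    by_contra hne
    exact hρZ.2.2 ⟨M, hρ hne⟩
  set A := (⋃ i, (f i).singularSet) ∪ {OnePoint.infty} ∪ GermTuple.base '' Z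
  have hA : A.Countable := ((Set.countable_iUnion fun i =>
    (hf i).1.countable_singularSet).union (Set.countable_singleton _)).union (hZ.image _)
  obtain ⟨σ, hσA, hσ, hσH, hσg⟩ := ((GermTuple.isLocalHomeomorph_base.frequently_notMem hA τ
    ).and_eventually ((GermTuple.isLocalHomeomorph_base.eventually_joinedIn τ univ_mem).and
    (h.eventually.and (GermTuple.continuous_base.continuousAt.eventually
      ((ofFun_pt H τ.base) ▸ (isGermOf_ofFun h.1).eventually_generatedBy))))).exists
  have hτσ : Joined τ σ := hσ.joined
  rw [← hσg.2, show ofFun H σ.base = meromorphicGerm F σ from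
    hσg.1.ext hσH.isGermOf (by simp)]
  refine generatedBy_mem_of_continuousAt hf hA (fun i x hx => Or.inl (Or.inl
    (Set.mem_iUnion.2 ⟨i, hx⟩))) (fun i => (hτf i).of_joined
    (hτσ.map (GermTuple.continuous_germ i))) hσA fun ρ hρ hρA => ⟨?_, meromorphicGerm_pt⟩
  by_contra hne
  refine hρA (Or.inr ⟨ρ, ⟨hτσ.trans hρ, fun hb => hρA (Or.inl (Or.inr hb)), ?_⟩, rfl⟩)
  rintro ⟨K, hK⟩
  exact hne hK.continuousAt

theorem stableUnderMeromorphicOperations_solvableSFunctions :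
    StableUnderMeromorphicOperations SolvableSFunctions := by
  rintro n F hF f hf φ ⟨q, p, hq, hp, h, k, P, Q, hph, hqk, ⟨hP, hQ, hQ0, hPQ⟩, hQh, hk⟩
  have hh : ∀ i, HolomorphicAt (h i) q.pt := fun i => (hph i).1 ▸ (hph i).2.holomorphicAt
  have hcont : ContinuousAt (fun x i => h i x) q.pt :=
    continuousAt_pi.2 fun i => (hh i).continuousAt
  have hQhol : HolomorphicAt (fun x => Q fun i => h i x) q.pt := by
    obtain ⟨e, w, he, hew⟩ := exists_isSphereChart q.pt
    rw [← hew, he.holomorphicAt_iff]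
    rw [← hew] at hQ
    refine AnalyticAt.comp (g := Q) hQ (analyticAt_pi_iff.2 fun i => (he.holomorphicAt_iff _ _).1 ?_)
    rw [hew]
    exact hh i
  have hne := (hQhol.eventually_eq_or_eventually_ne (holomorphicAt_const 0 _)).resolve_left hQh
  -- The base point is moved to a nearby finite `x` with `Q ≠ 0` there. Near it `F` is an honest
  -- continuous quotient, so the limit exists along every line and equals `k`.
  obtain ⟨x, hxA, hx, h1, ⟨h2, h3⟩, h4, h5⟩ := exists_notMem_of_eventually
    (A := {OnePoint.infty, q.pt}) ((Set.countable_singleton _).insert _)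
    ((eventually_nhdsWithin_iff.1 hne).and
    ((eventually_all.2 fun i => (hph i).1 ▸ (hph i).2.eventually_generatedBy).and
    (hqk.eventually_generatedBy.and (hk.eventually_nhds.and
      (hcont.eventually (hPQ.eventually_nhds.and (hQ.eventually_analyticAt.and
        hP.eventually_analyticAt)))))))
  have hQx : Q (fun i => h i x) ≠ 0 := hx fun hx' => hxA (Or.inr hx')
  let τ : GermTuple (Fin n) := ⟨(x, fun i => ofFun (h i) x), fun i => ofFun_pt _ _⟩
  have hreg : IsRegularValue F τ k := by
    have hkx : HolomorphicAt k x := by simpa using h2.holomorphicAt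
    have hhx : ∀ i, HolomorphicAt (h i) x := fun i => by simpa using (h1 i).1.holomorphicAt
    refine ⟨hkx, nhdsWithin_le_nhds ?_⟩
    have hcx : ContinuousAt (fun x i => h i x) x :=
      continuousAt_pi.2 fun i => (hhx i).continuousAt
    have hrep : ∀ᶠ y in 𝓝 x, ∀ i, τ.repVal y i = h i y := eventually_all.2 fun i => by
      have := (ofFun (h i) x).isGermOf_rep.eventuallyEq (h1 i).1
      rwa [ofFun_pt] at this
    filter_upwards [hkx.eventually, h4, hrep, hcx.eventually h5.1.eventually_nhds,
      hcx.eventually (h5.2.1.continuousAt.eventually_ne hQx).eventually_nhds,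
      hcx.eventually h5.2.1.eventually_analyticAt,
      hcx.eventually h5.2.2.eventually_analyticAt] with y hy1 hy2 hy3 hy4 hy5 hy6 hy7
    refine ⟨hy1, ?_⟩
    rw [show τ.repVal y = fun i => h i y from funext hy3,
      eq_div_of_mul_eq hy5.self_of_nhds hy2]
    refine Eventually.of_forall fun w => ?_
    have hlim := (hy7.continuousAt.div hy6.continuousAt hy5.self_of_nhds).tendsto.comp
      (tendsto_add_smul (fun i => h i y) w)
    refine hlim.congr' ?_
    filter_upwards [(tendsto_add_smul (fun i => h i y) w).eventually (hy4.and hy5)] with s hs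
    exact (hs.1 hs.2).symm
  rw [← show generatedBy q = φ from hq, ← h3]
  exact hreg.generatedBy_mem (τ := τ) hf hF (fun i => (h1 i).2.trans (hp i)) fun hx' => hxA (Or.inl hx')

/-! ### Germs of functions on the plane -/

/-- The germ at `z` of the function `k` of a complex variable. -/
def planeGerm (k : ℂ → ℂ) (z : ℂ) : RegularGerm := ofFun (fun x => x.elim 0 k) z

theorem isGermOf_planeGerm {k : ℂ → ℂ} {z : ℂ} (hk : AnalyticAt ℂ k z) :
    (planeGerm k z).IsGermOf fun x => x.elim 0 k :=
  isGermOf_ofFun (h := fun x : Sphere => x.elim 0 k) (x := (z : Sphere)) hk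

@[simp] theorem planeGerm_pt (k : ℂ → ℂ) (z : ℂ) : (planeGerm k z).pt = z := ofFun_pt _ _

theorem eq_planeGerm {p : RegularGerm} {h : Sphere → ℂ} {k : ℂ → ℂ} {z : ℂ} (hp : p.IsGermOf h)
    (hpt : p.pt = z) (hk : ∀ᶠ w : ℂ in 𝓝 z, h w = k w) : AnalyticAt ℂ k z ∧ p = planeGerm k z := by
  have hk' : h =ᶠ[𝓝 p.pt] fun x => x.elim 0 k := by
    rw [hpt]
    exact eventually_nhds_coe.2 hk
  have h1 := hp.congr hk'
  have h2 := h1.holomorphicAt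
  rw [hpt] at h2
  exact ⟨h2, h1.ext (isGermOf_planeGerm h2) (by simp [hpt])⟩

theorem IsGeneratedByFunction.exists_eventually {h : ℂ → ℂ} {f : MultivaluedFunction}
    (hf : IsGeneratedByFunction h f) :
    ∃ z₀ : ℂ, ∀ᶠ z in 𝓝 z₀, AnalyticAt ℂ h z ∧ generatedBy (planeGerm h z) = f := by
  obtain ⟨p, z₀, hp, hpt, hph⟩ := hf
  have h1 := hph.eventually_generatedBy
  rw [hpt, eventually_nhds_coe] at h1
  have h2 := hph.holomorphicAt.eventually
  rw [hpt, eventually_nhds_coe] at h2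
  refine ⟨z₀, ?_⟩
  filter_upwards [h1, h2] with z hz hz' using ⟨hz', hz.2.trans hp⟩

theorem IsInverseFunctionOf.exists_eventually {T : ℂ → ℂ} {f : MultivaluedFunction}
    (hf : IsInverseFunctionOf T f) : ∃ (k : ℂ → ℂ) (z₀ : ℂ), ∀ᶠ z in 𝓝 z₀,
      AnalyticAt ℂ k z ∧ generatedBy (planeGerm k z) = f ∧ T (k z) = z := by
  obtain ⟨p, z₀, k, hp, hpt, hpk, hT⟩ := hf
  have hgen : IsGeneratedByFunction (fun z : ℂ => k z) f := ⟨p, z₀, hp, hpt, hpk.congr (by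
    rw [hpt]
    exact eventually_nhds_coe.2 (Eventually.of_forall fun _ => rfl))⟩
  have h1 := hpk.eventually_generatedBy
  rw [hpt, eventually_nhds_coe] at h1
  refine ⟨fun z => k z, z₀, ?_⟩
  filter_upwards [h1, hT] with z hz hz'
  obtain ⟨h2, h3⟩ := eq_planeGerm hz.1 (ofFun_pt _ _) (k := fun z : ℂ => k z)
    (Eventually.of_forall fun _ => rfl)
  exact ⟨h2, h3 ▸ hz.2.trans hp, hz'⟩

theorem planeGerm_congr {k k' : ℂ → ℂ} {z : ℂ} (hk : AnalyticAt ℂ k z) (h : k =ᶠ[𝓝 z] k') :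
    planeGerm k z = planeGerm k' z :=
  (eq_planeGerm (isGermOf_planeGerm hk) (planeGerm_pt _ _) h).2

theorem generatedBy_planeGerm_mem {k : ℂ → ℂ} {z : ℂ} (hk : AnalyticAt ℂ k z) {C : Set ℂ}
    (hC : C.Countable) (h : ∀ w ∉ C, AnalyticAt ℂ k w) :
    generatedBy (planeGerm k z) ∈ SolvableSFunctions := by
  refine (isGermOf_planeGerm hk).generatedBy_mem (V := (insert OnePoint.infty ((↑) '' C))ᶜ)
    (by rw [compl_compl]; exact (hC.image _).insert _) fun x hx => ?_
  obtain ⟨w, rfl⟩ := exists_coe_eq fun hx' => hx (Or.inl hx')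
  exact h w fun hw => hx (Or.inr ⟨w, hw, rfl⟩)

theorem generatedBy_planeGerm_mem_of_deriv {k : ℂ → ℂ} {z : ℂ} (hk : AnalyticAt ℂ k z)
    (h : generatedBy (planeGerm (deriv k) z) ∈ SolvableSFunctions) :
    generatedBy (planeGerm k z) ∈ SolvableSFunctions :=
  stableUnderIntegration_solvableSFunctions _ h _ ⟨_, _, rfl, rfl, by simp,
    _, isGermOf_planeGerm hk, isGermOf_planeGerm hk.deriv⟩

theorem generatedBy_planeGerm_comp_mem {g k : ℂ → ℂ} {z : ℂ} (hg : AnalyticAt ℂ g (k z))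
    (hk : AnalyticAt ℂ k z) (hgS : generatedBy (planeGerm g (k z)) ∈ SolvableSFunctions)
    (hkS : generatedBy (planeGerm k z) ∈ SolvableSFunctions) :
    generatedBy (planeGerm (fun w => g (k w)) z) ∈ SolvableSFunctions := by
  refine stableUnderComposition_solvableSFunctions _ hgS _ hkS _ ⟨_, _, _, rfl, rfl, rfl, by simp,
    _, _, isGermOf_planeGerm hk, by simp, isGermOf_planeGerm hg, ?_⟩
  refine (isGermOf_planeGerm (hg.comp hk)).congr ?_
  rw [planeGerm_pt]
  exact eventually_nhds_coe.2 (Eventually.of_forall fun _ => rfl)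

/-- Primitives of functions that are holomorphic off a countable set. -/
theorem generatedBy_planeGerm_mem_of_deriv_eq {k r : ℂ → ℂ} {z : ℂ} (hk : AnalyticAt ℂ k z)
    (hkr : deriv k =ᶠ[𝓝 z] r) {C : Set ℂ} (hC : C.Countable) (h : ∀ w ∉ C, AnalyticAt ℂ r w) :
    generatedBy (planeGerm k z) ∈ SolvableSFunctions := by
  refine generatedBy_planeGerm_mem_of_deriv hk ?_
  rw [planeGerm_congr hk.deriv hkr]
  exact generatedBy_planeGerm_mem (hk.deriv.congr hkr) hC h

/-- Solutions of first order homogeneous linear differential equations whose coefficient is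
holomorphic off a countable set. -/
theorem generatedBy_planeGerm_mem_of_linear {u r : ℂ → ℂ} {z : ℂ} (hu : AnalyticAt ℂ u z)
    (hu0 : u z ≠ 0) (hur : ∀ᶠ w in 𝓝 z, deriv u w = r w * u w) {C : Set ℂ} (hC : C.Countable)
    (h : ∀ w ∉ C, AnalyticAt ℂ r w) : generatedBy (planeGerm u z) ∈ SolvableSFunctions := by
  have hslit : ∀ᶠ w in 𝓝 z, u w / u z ∈ Complex.slitPlane :=
    (hu.continuousAt.div_const _).eventually_mem (Complex.isOpen_slitPlane.mem_nhds
      (by simp [hu0, Complex.one_mem_slitPlane]))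
  -- A local logarithm of `u`: dividing by `u z` keeps the argument near 1, away from the cut. Its
  -- derivative is `r`, and `u` is the exponential of this primitive.
  set ℓ : ℂ → ℂ := fun w => Complex.log (u w / u z) + Complex.log (u z)
  have hℓ : AnalyticAt ℂ ℓ z :=
    ((hu.div analyticAt_const hu0).clog hslit.self_of_nhds).add analyticAt_const
  have hexp : u =ᶠ[𝓝 z] fun w => Complex.exp (ℓ w) := by
    filter_upwards [hslit] with w hw
    simp only [ℓ]
    rw [Complex.exp_add, Complex.exp_log (Complex.slitPlane_ne_zero hw), Complex.exp_log hu0,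
      div_mul_cancel₀ _ hu0]
  have hderiv : deriv ℓ =ᶠ[𝓝 z] r := by
    filter_upwards [hslit, hur, hu.eventually_analyticAt, hu.continuousAt.eventually_ne hu0]
      with w hw h1 h2 h3
    have h4 := ((h2.differentiableAt.hasDerivAt.div_const (u z)).clog hw).add_const
      (Complex.log (u z))
    rw [h4.deriv, h1]
    field_simp
  rw [planeGerm_congr hu hexp]
  exact generatedBy_planeGerm_comp_mem (g := Complex.exp) analyticAt_cexp hℓ
    (generatedBy_planeGerm_mem analyticAt_cexp Set.countable_empty
      fun _ _ => analyticAt_cexp)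
    (generatedBy_planeGerm_mem_of_deriv_eq hℓ hderiv hC h)

/-- This permits moving the base point off the branch cut, where the derivative formulas for `log`
and powers hold, and away from 0. -/
theorem frequently_mem_slitPlane (z : ℂ) : ∃ᶠ w in 𝓝 z, w ∈ Complex.slitPlane := by
  have h1 : Tendsto (fun t : ℝ => z + t * Complex.I) (𝓝[≠] (0 : ℝ)) (𝓝 z) := by
    have : Continuous fun t : ℝ => z + t * Complex.I := by fun_prop
    simpa using (this.tendsto 0).mono_left (nhdsWithin_le_nhds (s := {0}ᶜ))
  refine h1.frequently (Eventually.frequently ?_)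
  have h2 : ∀ᶠ t : ℝ in 𝓝[≠] 0, t ≠ -z.im := by
    by_cases hz : -z.im = 0
    · rw [hz]
      exact self_mem_nhdsWithin
    · exact nhdsWithin_le_nhds (isOpen_ne.mem_nhds (Ne.symm hz))
  filter_upwards [h2] with t ht
  refine Or.inr ?_
  simp only [Complex.add_im, Complex.mul_im, Complex.ofReal_re, Complex.I_im, mul_one,
    Complex.ofReal_im, Complex.I_re, mul_zero, add_zero]
  exact fun h => ht (by linarith)

/-! ### Elementary functions -/

theorem IsGeneratedByFunction.mem_of_analyticAt {h : ℂ → ℂ} {f : MultivaluedFunction}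
    (hf : IsGeneratedByFunction h f) {C : Set ℂ} (hC : C.Countable)
    (hh : ∀ w ∉ C, AnalyticAt ℂ h w) : f ∈ SolvableSFunctions := by
  obtain ⟨z, hz⟩ := hf.exists_eventually
  obtain ⟨h1, rfl⟩ := hz.self_of_nhds
  exact generatedBy_planeGerm_mem h1 hC hh

theorem countable_setOf_cos_eq_zero : {z : ℂ | Complex.cos z = 0}.Countable := by
  refine (Set.countable_range fun k : ℤ => (2 * k + 1) * (Real.pi : ℂ) / 2).mono fun z hz => ?_
  obtain ⟨k, hk⟩ := Complex.cos_eq_zero_iff.1 hz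
  exact ⟨k, hk.symm⟩

theorem countable_setOf_sin_eq_zero : {z : ℂ | Complex.sin z = 0}.Countable := by
  refine (Set.countable_range fun k : ℤ => k * (Real.pi : ℂ)).mono fun z hz => ?_
  obtain ⟨k, hk⟩ := Complex.sin_eq_zero_iff.1 hz
  exact ⟨k, hk.symm⟩

theorem analyticAt_div_sub_sq {w : ℂ} (hw : w ∉ ({1, -1} : Set ℂ)) :
    AnalyticAt ℂ (fun w : ℂ => w / (1 - w ^ 2)) w := by
  refine analyticAt_id.div (analyticAt_const.sub (analyticAt_id.pow 2)) fun h => hw ?_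
  exact sq_eq_sq_iff_eq_or_eq_neg.1 ((sub_eq_zero.1 h).symm.trans (one_pow 2).symm)

/-- Functions whose derivative is a branch of `1 / √(1 - w²)`. -/
theorem generatedBy_planeGerm_mem_of_sq_mul {k : ℂ → ℂ} {z : ℂ} (hk : AnalyticAt ℂ k z)
    (h : ∀ᶠ w in 𝓝 z, deriv k w ^ 2 * (1 - w ^ 2) = 1) :
    generatedBy (planeGerm k z) ∈ SolvableSFunctions := by
  have hne : ∀ {w : ℂ}, deriv k w ^ 2 * (1 - w ^ 2) = 1 → deriv k w ≠ 0 ∧ 1 - w ^ 2 ≠ 0 := by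
    intro w hw
    constructor <;> intro h0 <;> simp [h0] at hw
  -- Differentiating `k'² (1 - w²) = 1` and cancelling `2 k'` gives `k'' = w / (1 - w²) * k'`, a
  -- linear equation for `k'`; then `k` is recovered by integration.
  refine generatedBy_planeGerm_mem_of_deriv hk (generatedBy_planeGerm_mem_of_linear
    (r := fun w => w / (1 - w ^ 2)) hk.deriv (hne h.self_of_nhds).1 ?_
    (C := {1, -1}) ((Set.countable_singleton _).insert _) fun w hw => analyticAt_div_sub_sq hw)
  filter_upwards [h.eventually_nhds, hk.deriv.eventually_analyticAt] with w h1 h2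
  obtain ⟨h3, h4⟩ := hne h1.self_of_nhds
  have h5 := (h2.differentiableAt.hasDerivAt.pow 2).mul (((hasDerivAt_id w).pow 2).const_sub 1)
  have h6 := h5.congr_of_eventuallyEq (f₁ := fun _ => (1 : ℂ)) (by
    filter_upwards [h1] with v hv
    simpa using hv.symm)
  have h7 := h6.unique (hasDerivAt_const w 1)
  simp at h7
  have h8 : 2 * deriv k w * (deriv (deriv k) w * (1 - w ^ 2) - w * deriv k w) = 0 := by
    linear_combination h7
  have h9 := (mul_eq_zero.1 h8).resolve_left (mul_ne_zero two_ne_zero h3)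
  rw [div_mul_eq_mul_div, eq_div_iff h4]
  linear_combination h9

theorem analyticAt_inv_one_add_sq {w : ℂ} (hw : w ∉ ({Complex.I, -Complex.I} : Set ℂ)) :
    AnalyticAt ℂ (fun w : ℂ => (1 + w ^ 2)⁻¹) w := by
  refine (analyticAt_const.add (analyticAt_id.pow 2)).inv fun h => hw ?_
  refine sq_eq_sq_iff_eq_or_eq_neg.1 ?_
  rw [Complex.I_sq]
  exact eq_neg_of_add_eq_zero_right h

theorem IsBasicElementary.mem_solvableSFunctions {f : MultivaluedFunction}
    (hf : IsBasicElementary f) : f ∈ SolvableSFunctions := by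
  have hentire : ∀ {h : ℂ → ℂ}, IsGeneratedByFunction h f → Differentiable ℂ h →
      f ∈ SolvableSFunctions := fun hf hd =>
    hf.mem_of_analyticAt Set.countable_empty fun w _ => hd.analyticAt w
  cases hf with
  | const c _ h => exact hentire h (by fun_prop)
  | var _ h => exact hentire h (by fun_prop)
  | exp _ h => exact hentire h Complex.differentiable_exp
  | sin _ h => exact hentire h Complex.differentiable_sin
  | cos _ h => exact hentire h Complex.differentiable_cos
  | tan _ h =>
    refine h.mem_of_analyticAt countable_setOf_cos_eq_zero fun w hw => ?_
    exact (Complex.differentiable_sin.analyticAt w).div (Complex.differentiable_cos.analyticAt w) hw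
  | cot _ h =>
    refine h.mem_of_analyticAt countable_setOf_sin_eq_zero fun w hw => ?_
    exact (Complex.differentiable_cos.analyticAt w).div (Complex.differentiable_sin.analyticAt w) hw
  | log _ h =>
    obtain ⟨z₀, hz₀⟩ := h.exists_eventually
    obtain ⟨z, hz, h1, rfl⟩ := ((frequently_mem_slitPlane z₀).and_eventually hz₀).exists
    refine generatedBy_planeGerm_mem_of_deriv_eq h1 (r := fun w => w⁻¹) ?_
      (Set.countable_singleton (0 : ℂ)) fun w hw => analyticAt_inv hw
    filter_upwards [Complex.isOpen_slitPlane.mem_nhds hz] with w hw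
      using (Complex.hasDerivAt_log hw).deriv
  | pow α _ h =>
    obtain ⟨z₀, hz₀⟩ := h.exists_eventually
    obtain ⟨z, hz, h1, rfl⟩ := ((frequently_mem_slitPlane z₀).and_eventually hz₀).exists
    refine generatedBy_planeGerm_mem_of_linear h1 (r := fun w => α * w⁻¹) ?_ ?_
      (Set.countable_singleton (0 : ℂ)) fun w hw => analyticAt_const.mul (analyticAt_inv hw)
    · simp [Complex.cpow_eq_zero_iff, Complex.slitPlane_ne_zero hz]
    · filter_upwards [Complex.isOpen_slitPlane.mem_nhds hz] with w hw
      have h2 := ((hasDerivAt_id w).cpow_const (c := α) hw).deriv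
      simp only [id] at h2
      rw [h2, Complex.cpow_sub _ _ (Complex.slitPlane_ne_zero hw), Complex.cpow_one]
      ring
  | arcsin _ h =>
    obtain ⟨k, z, hz⟩ := h.exists_eventually
    obtain ⟨h1, rfl, -⟩ := hz.self_of_nhds
    refine generatedBy_planeGerm_mem_of_sq_mul h1 ?_
    filter_upwards [hz.eventually_nhds] with w hw
    obtain ⟨h2, -, h3⟩ := hw.self_of_nhds
    have h4 := (h2.differentiableAt.hasDerivAt.csin.congr_of_eventuallyEq (f₁ := fun w => w)
      (hw.mono fun v hv => hv.2.2.symm)).unique (hasDerivAt_id w)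
    have h5 := Complex.sin_sq_add_cos_sq (k w)
    rw [h3] at h5
    linear_combination (deriv k w * Complex.cos (k w) + 1) * h4 - deriv k w ^ 2 * h5
  | arccos _ h =>
    obtain ⟨k, z, hz⟩ := h.exists_eventually
    obtain ⟨h1, rfl, -⟩ := hz.self_of_nhds
    refine generatedBy_planeGerm_mem_of_sq_mul h1 ?_
    filter_upwards [hz.eventually_nhds] with w hw
    obtain ⟨h2, -, h3⟩ := hw.self_of_nhds
    have h4 := (h2.differentiableAt.hasDerivAt.ccos.congr_of_eventuallyEq (f₁ := fun w => w)
      (hw.mono fun v hv => hv.2.2.symm)).unique (hasDerivAt_id w)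
    have h5 := Complex.sin_sq_add_cos_sq (k w)
    rw [h3] at h5
    linear_combination (1 - deriv k w * Complex.sin (k w)) * h4 - deriv k w ^ 2 * h5
  | arctan _ h =>
    obtain ⟨k, z₀, hz₀⟩ := h.exists_eventually
    obtain ⟨z, hz, hev⟩ := ((frequently_mem_slitPlane z₀).and_eventually
      hz₀.eventually_nhds).exists
    obtain ⟨h1, rfl, -⟩ := hev.self_of_nhds
    refine generatedBy_planeGerm_mem_of_deriv_eq h1 (r := fun w => (1 + w ^ 2)⁻¹) ?_
      (C := {Complex.I, -Complex.I}) ((Set.countable_singleton _).insert _)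
      fun w hw => analyticAt_inv_one_add_sq hw
    have hev' : ∀ᶠ w in 𝓝 z, AnalyticAt ℂ k w ∧ Complex.sin (k w) = w * Complex.cos (k w) := by
      filter_upwards [hev, Complex.isOpen_slitPlane.mem_nhds hz] with w hw2 hw
      obtain ⟨h2, -, h3⟩ := hw2
      rw [Complex.tan_eq_sin_div_cos] at h3
      -- A zero of the cosine would make the tangent 0 by the convention for division by zero,
      -- forcing `w = 0`, which the slit plane excludes.
      refine ⟨h2, (div_eq_iff fun h0 => Complex.slitPlane_ne_zero hw ?_).1 h3⟩
      rw [← h3, h0, div_zero]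
    filter_upwards [hev'.eventually_nhds] with w hw
    obtain ⟨h2, h3⟩ := hw.self_of_nhds
    have hk := h2.differentiableAt.hasDerivAt
    have h4 := (hk.csin.congr_of_eventuallyEq (hw.mono fun v hv => hv.2.symm)).unique
      ((hasDerivAt_id w).mul hk.ccos)
    simp only [id] at h4
    have h5 := Complex.sin_sq_add_cos_sq (k w)
    refine eq_inv_of_mul_eq_one_left ?_
    -- Obtained by differentiating `sin k = w cos k`, multiplying by `cos k` and substituting the
    -- relation again.
    have h6 : deriv k w = Complex.cos (k w) ^ 2 := by
      linear_combination Complex.cos (k w) * h4 + Complex.sin (k w) * deriv k w * h3 -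
        deriv k w * h5
    rw [h6]
    linear_combination h5 - (Complex.sin (k w) + w * Complex.cos (k w)) * h3
  | arccot _ h =>
    obtain ⟨k, z₀, hz₀⟩ := h.exists_eventually
    obtain ⟨z, hz, hev⟩ := ((frequently_mem_slitPlane z₀).and_eventually
      hz₀.eventually_nhds).exists
    obtain ⟨h1, rfl, -⟩ := hev.self_of_nhds
    refine generatedBy_planeGerm_mem_of_deriv_eq h1 (r := fun w => -(1 + w ^ 2)⁻¹) ?_
      (C := {Complex.I, -Complex.I}) ((Set.countable_singleton _).insert _)
      fun w hw => (analyticAt_inv_one_add_sq hw).neg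
    have hev' : ∀ᶠ w in 𝓝 z, AnalyticAt ℂ k w ∧ Complex.cos (k w) = w * Complex.sin (k w) := by
      filter_upwards [hev, Complex.isOpen_slitPlane.mem_nhds hz] with w hw2 hw
      obtain ⟨h2, -, h3⟩ := hw2
      rw [Complex.cot_eq_cos_div_sin] at h3
      refine ⟨h2, (div_eq_iff fun h0 => Complex.slitPlane_ne_zero hw ?_).1 h3⟩
      rw [← h3, h0, div_zero]
    filter_upwards [hev'.eventually_nhds] with w hw
    obtain ⟨h2, h3⟩ := hw.self_of_nhds
    have hk := h2.differentiableAt.hasDerivAt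
    have h4 := (hk.ccos.congr_of_eventuallyEq (hw.mono fun v hv => hv.2.symm)).unique
      ((hasDerivAt_id w).mul hk.csin)
    simp only [id] at h4
    have h5 := Complex.sin_sq_add_cos_sq (k w)
    refine eq_neg_of_add_eq_zero_left ?_
    have h6 : deriv k w = -Complex.sin (k w) ^ 2 := by
      linear_combination -Complex.sin (k w) * h4 + Complex.cos (k w) * deriv k w * h3 -
        deriv k w * h5
    have h7 : Complex.sin (k w) ^ 2 * (1 + w ^ 2) = 1 := by
      linear_combination h5 - (Complex.cos (k w) + w * Complex.sin (k w)) * h3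
    rw [h6, ← eq_inv_of_mul_eq_one_left h7]
    ring

/-! ### Single-valued functions and the induction over the quadrature class -/

theorem mem_solvableSFunctions_of_isSingleValued {f : MultivaluedFunction} (hf : f.IsSFunction)
    (hs : f.IsSingleValued) : f ∈ SolvableSFunctions := by
  refine ⟨hf, fun x₀ hx₀ => ?_⟩
  have : Subsingleton (f.Fiber x₀) := ⟨fun p q => Subtype.ext
    (hs _ _ p.2.1 q.2.1 (p.2.2.trans q.2.2.symm))⟩
  infer_instance

theorem InExtendedQuadratureClass.mem_solvableSFunctions {f : MultivaluedFunction}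
    (hf : InExtendedQuadratureClass f) : f ∈ SolvableSFunctions := by
  induction hf with
  | elementary f h => exact h.mem_solvableSFunctions
  | singleValued f h h' => exact mem_solvableSFunctions_of_isSingleValued h h'
  | composition φ g f _ _ h hg hf => exact stableUnderComposition_solvableSFunctions g hg f hf φ h
  | meromorphic F φ f hF _ h hf =>
    exact stableUnderMeromorphicOperations_solvableSFunctions _ F hF f hf φ h
  | differentiation φ f _ h hf => exact stableUnderDifferentiation_solvableSFunctions f hf φ h
  | integration φ f _ h hf => exact stableUnderIntegration_solvableSFunctions f hf φ h

end

theorem theorem6 :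
    (StableUnderComposition SolvableSFunctions ∧
      StableUnderMeromorphicOperations SolvableSFunctions ∧
      StableUnderIntegration SolvableSFunctions ∧
      StableUnderDifferentiation SolvableSFunctions) ∧
    ∀ f : MultivaluedFunction, f.IsSFunction → ¬ f.HasSolvableMonodromyGroup →
      StronglyNonRepresentableByQuadratures f :=
  ⟨⟨stableUnderComposition_solvableSFunctions,
      stableUnderMeromorphicOperations_solvableSFunctions,
      stableUnderIntegration_solvableSFunctions, stableUnderDifferentiation_solvableSFunctions⟩,
    fun _ _ hns hf => hns hf.mem_solvableSFunctions.2⟩
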